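/- **Setting.** Let $\Theta\subset\mathbb R^d$ be compact. For $\theta\in\Theta$ let $f_\theta:\mathbb N_0^{\mathbb N}\to[0,\infty)$ be measurable. For an $\mathbb N_0$-valued process $Y=(Y_t)_{t\in\mathbb Z}$ put $\mathcal F_{t-1}=\sigma(Y_{t-1},Y_{t-2},\dots)$, $\lambda_t(\theta)=f_\theta(Y_{t-1},Y_{t-2},\dots)$, $\widehat\lambda_t(\theta)=f_\theta(Y_{t-1},\dots,Y_1,0,0,\dots)$ and $\ell_t(\theta)=Y_t\log\lambda_t(\theta)-\lambda_t(\theta)$. Write $Y\in\mathcal{OD}_{\mathbb Z}(f_\theta)$ if $\mathbb E(Y_t\mid\mathcal F_{t-1})=\lambda_t(\theta)$ a.s. for all $t\in\mathbb Z$. *Conditions $\mathbf A_i(\Theta)$, $i=0,1,2$.* For every $y$, $\theta\mapsto f_\theta(y)$ is $i$ times continuously differentiable on $\Theta$ with $\sup_{\theta\in\Theta}\|\partial^i f_\theta(y)/\partial\theta^i\|<\infty$, and there are $\alpha^{(i)}_k\ge 0$ with $\sum_{k\ge1}\alpha_k^{(0)}<1$, and $\sum_{k\ge1}\alpha^{(i)}_k<\infty$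 for $i=1,2$, such that $\sup_{\theta\in\Theta}\|\partial^i f_\theta(y)/\partial\theta^i-\partial^i f_\theta(y')/\partial\theta^i\|\le\sum_{k\ge1}\alpha^{(i)}_k|y_k-y'_k|$ for all $y,y'\in\mathbb N_0^{\mathbb N}$. *Regularity (A0)-(A6) of a stationary process $Y\in\mathcal{OD}_{\mathbb Z}(f_{\theta^*})$.* Put $a_t=\sup_{\theta\in\Theta}|\widehat\lambda_t(\theta)-\lambda_t(\theta)|$, $b_t=\sup_{\theta\in\Theta}\mathbb E\|\partial_\theta\widehat\lambda_t(\theta)-\partial_\theta\lambda_t(\theta)\|$ and $d_t=\sup_{\theta\in\Theta}\max\{\mathbb E\|\widehat\lambda_t(\theta)^{-1}\partial_\theta\widehat\lambda_t(\theta)\|,\mathbb E\|\lambda_t(\theta)^{-1}\partial_\theta\lambda_t(\theta)\|\}$. (A0) If $\theta,\theta'\in\Theta$ and $\lambda_t(\theta)=\lambda_t(\theta')$ a.s. for some $t\in\mathbb N$, then $\theta=\theta'$; and there is $\underline c>0$ with $f_\theta(y)\ge\underline c$ for all $\theta\in\Theta$ and all $y$. (A1) $\theta^*$ is an interior point of $\Theta$.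 (A2) $a_t\to0$ and $Y_ta_t\to0$ a.s. as $t\to\infty$. (A3) The matrices $J=\mathbb E\big[\tfrac1{\lambda_t(\theta^*)}\partial_\theta\lambda_t(\theta^*)\,\partial_{\theta}\lambda_t(\theta^*)'\big]$ and $I=\mathbb E\big[\tfrac{\mathrm{Var}(Y_t\mid\mathcal F_{t-1})}{\lambda_t(\theta^*)^2}\partial_\theta\lambda_t(\theta^*)\,\partial_{\theta}\lambda_t(\theta^*)'\big]$ exist (integrable entries). (A4) For $c\in\mathbb R^d$, $c'\partial_\theta\lambda_t(\theta^*)=0$ a.s. implies $c=0$. (A5) There is a neighbourhood $V\subseteq\Theta$ of $\theta^*$ with $\mathbb E\sup_{\theta\in V}|\partial^2\ell_t(\theta)/\partial\theta_i\partial\theta_k|<\infty$ for all $i,k$. (A6) For some $h>1/2$, $b_t=O(t^{-h})$ and, a.s., $b_tY_t=O(t^{-h})$ and $a_td_tY_t=O(t^{-h})$. *Statistic.* Let $u_n,v_n\to\infty$ be integers with $u_n/n\to0$ and $v_n/n\to0$. Let $q:(0,1)\to(0,\infty)$ be non-decreasing near $0$, non-increasing near $1$, with $\inf_{\varphi<\tau<1-\varphi}q(\tau)>0$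 for all $0<\varphi<1/2$. Put $T_{l,l'}=\{l,\dots,l'\}$. From observations $Y_1,\dots,Y_n$, let $\widehat\theta(T_{l,l'})$ be any maximizer over $\Theta$ of $\sum_{t=l}^{l'}\big(Y_t\log\widehat\lambda_t(\theta)-\widehat\lambda_t(\theta)\big)$. With $\widehat\theta=\widehat\theta(T_{l,l'})$, let $$\widehat J(T_{l,l'})=\tfrac1{l'-l+1}\sum_{t=l}^{l'}\tfrac1{\widehat\lambda_t(\widehat\theta)}\,\partial_\theta\widehat\lambda_t(\widehat\theta)\,\partial_\theta\widehat\lambda_t(\widehat\theta)',\qquad \widehat I(T_{l,l'})=\tfrac1{l'-l+1}\sum_{t=l}^{l'}\Big(\tfrac{Y_t}{\widehat\lambda_t(\widehat\theta)}-1\Big)^2\partial_\theta\widehat\lambda_t(\widehat\theta)\,\partial_\theta\widehat\lambda_t(\widehat\theta)',$$ and (the inverse of a singular matrix being read as $0$) $$\widehat\Sigma(u_n)=\tfrac12\Big[\widehat J(T_{1,u_n})\widehat I(T_{1,u_n})^{-1}\widehat J(T_{1,u_n})+\widehat J(T_{u_n+1,n})\widehat I(T_{u_n+1,n})^{-1}\widehat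 J(T_{u_n+1,n})\Big],$$ $$\widehat C_n=\max_{v_n\le k\le n-v_n}\frac1{q^2(k/n)}\frac{k^2(n-k)^2}{n^3}\big(\widehat\theta(T_{1,k})-\widehat\theta(T_{k+1,n})\big)'\,\widehat\Sigma(u_n)\,\big(\widehat\theta(T_{1,k})-\widehat\theta(T_{k+1,n})\big).$$ **Theorem 3.2.** Let $\theta_1^*\ne\theta_2^*$ be interior points of $\Theta$, and let $Y^{(1)}\in\mathcal{OD}_{\mathbb Z}(f_{\theta_1^*})$ and $Y^{(2)}\in\mathcal{OD}_{\mathbb Z}(f_{\theta_2^*})$ be stationary ergodic processes on a common probability space (with any joint law) such that, for some $\epsilon>2$, $\sup_{t}\mathbb E(Y^{(j)}_t)^{1+\epsilon}<\infty$ for $j=1,2$. Assume $\mathbf A_i(\Theta)$ for $i=0,1,2$ with $\alpha_k^{(0)}+\alpha_k^{(1)}=O(k^{-\gamma})$ for some $\gamma>3/2$, (A0)-(A6) for each pair $(Y^{(j)},\theta_j^*)$, $j=1,2$, and that the matrix $I$ of the first regime $(Y^{(1)},\theta_1^*)$ is nonsingular. Let $\tau^*\in(0,1)$, $t^*=[n\tau^*]$,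 and suppose that the observations are $Y_t=Y_t^{(1)}$ for $1\le t\le t^*$ and $Y_t=Y^{(2)}_t$ for $t^*<t\le n$. Then $\widehat C_n\to+\infty$ in probability as $n\to\infty$, that is, $\mathbb P(\widehat C_n\le M)\to0$ for every $M\in\mathbb R$. Consequently the test is consistent in power: for every fixed critical value $c\in\mathbb R$, $\mathbb P(\widehat C_n>c)\to1$. -/

import Mathlib

open MeasureTheory ProbabilityTheory Filter Topology Set
open scoped ENNReal

noncomputable section

namespace ChangePoint

/-- The parameter space `ℝ^d` with its Euclidean norm. -/
abbrev Param (d : ℕ) := EuclideanSpace ℝ (Fin d)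

/-- The past `(x_{t-1}, x_{t-2}, …)` of a two-sided path; coordinate `k` holds `x_{t-1-k}`. -/
def past (x : ℤ → ℕ) (t : ℤ) : ℕ → ℕ := fun k => x (t - 1 - k)

/-- The observable past `(x_{t-1}, …, x_1, 0, 0, …)`. -/
def observedPast (x : ℤ → ℕ) (t : ℤ) : ℕ → ℕ :=
  fun k => if 1 ≤ t - 1 - (k : ℤ) then x (t - 1 - k) else 0

section Model

variable {d : ℕ} {Ω : Type*} [MeasurableSpace Ω]

/-- `λ_t(θ) = f_θ(x_{t-1}, x_{t-2}, …)`. -/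
def lam (f : Param d → (ℕ → ℕ) → ℝ) (x : ℤ → ℕ) (t : ℤ) (θ : Param d) : ℝ :=
  f θ (past x t)

/-- `λ̂_t(θ) = f_θ(x_{t-1}, …, x_1, 0, 0, …)`. -/
def lamHat (f : Param d → (ℕ → ℕ) → ℝ) (x : ℤ → ℕ) (t : ℤ) (θ : Param d) : ℝ :=
  f θ (observedPast x t)

/-- `ℓ_t(θ) = x_t log λ_t(θ) - λ_t(θ)`. -/
def loglik (f : Param d → (ℕ → ℕ) → ℝ) (x : ℤ → ℕ) (t : ℤ) (θ : Param d) : ℝ :=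
  (x t : ℝ) * Real.log (lam f x t θ) - lam f x t θ

/-- The approximate Poisson quasi-log-likelihood `L̂(T_{l,l'}, θ)`, `T_{l,l'} = {l, …, l'}`. -/
def logLikHat (f : Param d → (ℕ → ℕ) → ℝ) (x : ℤ → ℕ) (l l' : ℕ) (θ : Param d) : ℝ :=
  ∑ t ∈ Finset.Icc l l', ((x t : ℝ) * Real.log (lamHat f x t θ) - lamHat f x t θ)

/-- `θ'` is a Poisson quasi-maximum likelihood estimate computed on `T_{l,l'}`:
a maximizer of `L̂(T_{l,l'}, ·)` over `Θ`. -/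
def IsPQMLE (f : Param d → (ℕ → ℕ) → ℝ) (Θ : Set (Param d)) (x : ℤ → ℕ) (l l' : ℕ)
    (θ' : Param d) : Prop :=
  θ' ∈ Θ ∧ ∀ θ ∈ Θ, logLikHat f x l l' θ ≤ logLikHat f x l l' θ'

/-- The path `ω ↦ (Y_t(ω))_t` of a process. -/
def path (Y : ℤ → Ω → ℕ) (ω : Ω) : ℤ → ℕ := fun t => Y t ω

/-- `F_{t-1} = σ(Y_{t-1}, Y_{t-2}, …)`. -/
@[reducible] def pastSigma (Y : ℤ → Ω → ℕ) (t : ℤ) : MeasurableSpace Ω :=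
  ⨆ s : {s : ℤ // s < t}, MeasurableSpace.comap (Y s) inferInstance

/-- The class `OD_T(f_θ)`: `E(Y_t | F_{t-1}) = f_θ(Y_{t-1}, Y_{t-2}, …)` for all `t ∈ T`. -/
structure ClassOD (P : Measure Ω) (T : Set ℤ) (f : Param d → (ℕ → ℕ) → ℝ) (θ : Param d)
    (Y : ℤ → Ω → ℕ) : Prop where
  measurable : ∀ t, Measurable (Y t)
  integrable : ∀ t ∈ T, Integrable (fun ω => (Y t ω : ℝ)) P
  condMean : ∀ t ∈ T,
    P[(fun ω => (Y t ω : ℝ)) | pastSigma Y t] =ᵐ[P] fun ω => lam f (path Y ω) t θ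

/-- The left shift on two-sided paths. -/
def shift (x : ℤ → ℕ) : ℤ → ℕ := fun t => x (t + 1)

/-- The process is stationary and ergodic: the shift preserves its law and is ergodic for it. -/
def StationaryErgodic (P : Measure Ω) (Y : ℤ → Ω → ℕ) : Prop :=
  Ergodic shift (P.map (path Y))

/-- Uniformly bounded moments of order `1 + ε`. -/
def MomentBound (P : Measure Ω) (Y : ℤ → Ω → ℕ) (ε : ℝ) : Prop :=
  ∃ C : ℝ, 0 < C ∧ ∀ t, Integrable (fun ω => (Y t ω : ℝ) ^ (1 + ε)) P ∧
    ∫ ω, (Y t ω : ℝ) ^ (1 + ε) ∂P < C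

/-- The Lipschitz-type condition `A_i(Θ)` with coefficients `α` (`α k` is the coefficient of
lag `k + 1`). The right-hand side may be `+∞`, hence the values in `[0, ∞]`. -/
structure LipschitzCondition (f : Param d → (ℕ → ℕ) → ℝ) (Θ : Set (Param d)) (i : ℕ)
    (α : ℕ → ℝ) : Prop where
  contDiffOn : ∀ y, ContDiffOn ℝ i (fun θ => f θ y) Θ
  bounded : ∀ y, BddAbove ((fun θ => ‖iteratedFDerivWithin ℝ i (fun θ' => f θ' y) Θ θ‖) '' Θ)
  nonneg : ∀ k, 0 ≤ α k
  summable : Summable α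
  contraction : i = 0 → ∑' k, α k < 1
  lipschitz : ∀ y y' : ℕ → ℕ, ∀ θ ∈ Θ,
    ENNReal.ofReal ‖iteratedFDerivWithin ℝ i (fun θ' => f θ' y) Θ θ
        - iteratedFDerivWithin ℝ i (fun θ' => f θ' y') Θ θ‖
      ≤ ∑' k, ENNReal.ofReal (α k * |(y k : ℝ) - (y' k : ℝ)|)

/-- `a_t = sup_{θ ∈ Θ} |λ̂_t(θ) - λ_t(θ)|`. -/
def aSeq (f : Param d → (ℕ → ℕ) → ℝ) (Θ : Set (Param d)) (x : ℤ → ℕ) (t : ℤ) : ℝ :=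
  ⨆ θ : Θ, |lamHat f x t θ - lam f x t θ|

/-- `b_t = sup_{θ ∈ Θ} E ‖∂λ̂_t(θ)/∂θ - ∂λ_t(θ)/∂θ‖`. -/
def bSeq (P : Measure Ω) (f : Param d → (ℕ → ℕ) → ℝ) (Θ : Set (Param d)) (Y : ℤ → Ω → ℕ)
    (t : ℤ) : ℝ :=
  ⨆ θ : Θ, ∫ ω, ‖gradientWithin (lamHat f (path Y ω) t) Θ θ
    - gradientWithin (lam f (path Y ω) t) Θ θ‖ ∂P

/-- `d_t = sup_{θ ∈ Θ} max {E ‖λ̂_t(θ)⁻¹ ∂λ̂_t(θ)/∂θ‖, E ‖λ_t(θ)⁻¹ ∂λ_t(θ)/∂θ‖}`. -/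
def dSeq (P : Measure Ω) (f : Param d → (ℕ → ℕ) → ℝ) (Θ : Set (Param d)) (Y : ℤ → Ω → ℕ)
    (t : ℤ) : ℝ :=
  ⨆ θ : Θ, max
    (∫ ω, ‖(lamHat f (path Y ω) t θ)⁻¹ • gradientWithin (lamHat f (path Y ω) t) Θ θ‖ ∂P)
    (∫ ω, ‖(lam f (path Y ω) t θ)⁻¹ • gradientWithin (lam f (path Y ω) t) Θ θ‖ ∂P)

/-- The integrand of the `(i, j)` entry of `J`, at time `0` (the process is stationary). -/
def infoJIntegrand (f : Param d → (ℕ → ℕ) → ℝ) (Θ : Set (Param d)) (θ : Param d)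
    (Y : ℤ → Ω → ℕ) (i j : Fin d) (ω : Ω) : ℝ :=
  1 / lam f (path Y ω) 0 θ *
    (gradientWithin (lam f (path Y ω) 0) Θ θ i * gradientWithin (lam f (path Y ω) 0) Θ θ j)

/-- The integrand of the `(i, j)` entry of `I`, at time `0` (the process is stationary). -/
def infoIIntegrand (P : Measure Ω) (f : Param d → (ℕ → ℕ) → ℝ) (Θ : Set (Param d))
    (θ : Param d) (Y : ℤ → Ω → ℕ) (i j : Fin d) (ω : Ω) : ℝ :=
  condVar (pastSigma Y 0) (fun ω' => (Y 0 ω' : ℝ)) P ω / lam f (path Y ω) 0 θ ^ 2 *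
    (gradientWithin (lam f (path Y ω) 0) Θ θ i * gradientWithin (lam f (path Y ω) 0) Θ θ j)

/-- `I = E[Var(Y_t | F_{t-1}) / λ_t(θ)² ∂λ_t(θ)/∂θ ∂λ_t(θ)/∂θ']`. -/
def infoI (P : Measure Ω) (f : Param d → (ℕ → ℕ) → ℝ) (Θ : Set (Param d)) (θ : Param d)
    (Y : ℤ → Ω → ℕ) : Matrix (Fin d) (Fin d) ℝ :=
  Matrix.of fun i j => ∫ ω, infoIIntegrand P f Θ θ Y i j ω ∂P

/-- The regularity assumptions (A0)-(A6) for a process `Y` with parameter `θ`. -/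
structure Regularity (P : Measure Ω) (f : Param d → (ℕ → ℕ) → ℝ) (Θ : Set (Param d))
    (θ : Param d) (Y : ℤ → Ω → ℕ) : Prop where
  identifiable : ∀ θ₁ ∈ Θ, ∀ θ₂ ∈ Θ, ∀ t : ℕ,
    (∀ᵐ ω ∂P, lam f (path Y ω) t θ₁ = lam f (path Y ω) t θ₂) → θ₁ = θ₂
  lowerBound : ∃ c : ℝ, 0 < c ∧ ∀ θ' ∈ Θ, ∀ y, c ≤ f θ' y
  interior : θ ∈ interior Θ
  a_tendsto : ∀ᵐ ω ∂P, Tendsto (fun t : ℕ => aSeq f Θ (path Y ω) t) atTop (𝓝 0)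
  Ya_tendsto : ∀ᵐ ω ∂P,
    Tendsto (fun t : ℕ => (Y t ω : ℝ) * aSeq f Θ (path Y ω) t) atTop (𝓝 0)
  existsJ : ∀ i j, Integrable (infoJIntegrand f Θ θ Y i j) P
  existsI : ∀ i j, Integrable (infoIIntegrand P f Θ θ Y i j) P
  nondegenerate : ∀ c : Param d,
    (∀ᵐ ω ∂P, inner ℝ c (gradientWithin (lam f (path Y ω) 0) Θ θ) = 0) → c = 0
  hessian : ∃ V : Set (Param d), IsOpen V ∧ θ ∈ V ∧ V ⊆ Θ ∧ ∀ i k : Fin d,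
    ∫⁻ ω, ⨆ θ' ∈ V, ENNReal.ofReal |gradientWithin
      (fun η => gradientWithin (loglik f (path Y ω) 0) Θ η i) Θ θ' k| ∂P < ∞
  rates : ∃ h : ℝ, 1 / 2 < h ∧
    ((fun t : ℕ => bSeq P f Θ Y t) =O[atTop] fun t : ℕ => (t : ℝ) ^ (-h)) ∧
    (∀ᵐ ω ∂P, (fun t : ℕ => bSeq P f Θ Y t * (Y t ω : ℝ)) =O[atTop]
      fun t : ℕ => (t : ℝ) ^ (-h)) ∧
    (∀ᵐ ω ∂P, (fun t : ℕ => aSeq f Θ (path Y ω) t * dSeq P f Θ Y t * (Y t ω : ℝ)) =O[atTop]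
      fun t : ℕ => (t : ℝ) ^ (-h))

/-- Weight functions `q : (0,1) → (0,∞)`: non-decreasing near `0`, non-increasing near `1`,
bounded away from `0` on every `(φ, 1 - φ)`. -/
structure IsWeight (q : ℝ → ℝ) : Prop where
  pos : ∀ τ ∈ Ioo (0 : ℝ) 1, 0 < q τ
  monotone_zero : ∃ δ ∈ Ioo (0 : ℝ) 1, MonotoneOn q (Ioo 0 δ)
  antitone_one : ∃ δ ∈ Ioo (0 : ℝ) 1, AntitoneOn q (Ioo (1 - δ) 1)
  inf_pos : ∀ φ ∈ Ioo (0 : ℝ) (1 / 2), 0 < sInf (q '' Ioo φ (1 - φ))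

/-- `Ĵ(T_{l,l'})`, where `η` stands for the estimate `θ̂(T_{l,l'})`. -/
def JHat (f : Param d → (ℕ → ℕ) → ℝ) (Θ : Set (Param d)) (x : ℤ → ℕ) (l l' : ℕ)
    (η : Param d) : Matrix (Fin d) (Fin d) ℝ :=
  Matrix.of fun i j => 1 / ((l' : ℝ) - l + 1) * ∑ t ∈ Finset.Icc l l',
    1 / lamHat f x t η *
      (gradientWithin (lamHat f x t) Θ η i * gradientWithin (lamHat f x t) Θ η j)

/-- `Î(T_{l,l'})`, where `η` stands for the estimate `θ̂(T_{l,l'})`. -/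
def IHat (f : Param d → (ℕ → ℕ) → ℝ) (Θ : Set (Param d)) (x : ℤ → ℕ) (l l' : ℕ)
    (η : Param d) : Matrix (Fin d) (Fin d) ℝ :=
  Matrix.of fun i j => 1 / ((l' : ℝ) - l + 1) * ∑ t ∈ Finset.Icc l l',
    ((x t : ℝ) / lamHat f x t η - 1) ^ 2 *
      (gradientWithin (lamHat f x t) Θ η i * gradientWithin (lamHat f x t) Θ η j)

/-- `Ĵ(T_{l,l'}) Î(T_{l,l'})⁻¹ Ĵ(T_{l,l'})`; the inverse of a singular matrix is `0`. -/
def sandwich (f : Param d → (ℕ → ℕ) → ℝ) (Θ : Set (Param d)) (x : ℤ → ℕ) (l l' : ℕ)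
    (η : Param d) : Matrix (Fin d) (Fin d) ℝ :=
  JHat f Θ x l l' η * (IHat f Θ x l l' η)⁻¹ * JHat f Θ x l l' η

/-- `Σ̂(u)` for a sample of size `n`; `est l l'` is the estimate `θ̂(T_{l,l'})`. -/
def SigmaHat (f : Param d → (ℕ → ℕ) → ℝ) (Θ : Set (Param d)) (x : ℤ → ℕ)
    (est : ℕ → ℕ → Param d) (u n : ℕ) : Matrix (Fin d) (Fin d) ℝ :=
  (1 / 2 : ℝ) • (sandwich f Θ x 1 u (est 1 u) + sandwich f Θ x (u + 1) n (est (u + 1) n))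

/-- `Ĉ_{n,k}`. -/
def CHatAt (f : Param d → (ℕ → ℕ) → ℝ) (Θ : Set (Param d)) (q : ℝ → ℝ) (x : ℤ → ℕ)
    (est : ℕ → ℕ → Param d) (u n k : ℕ) : ℝ :=
  1 / q ((k : ℝ) / n) ^ 2 * ((k : ℝ) ^ 2 * ((n : ℝ) - k) ^ 2 / (n : ℝ) ^ 3) *
    ((est 1 k - est (k + 1) n).ofLp ⬝ᵥ
      (SigmaHat f Θ x est u n).mulVec (est 1 k - est (k + 1) n).ofLp)

/-- `Ĉ_n = max_{v ≤ k ≤ n - v} Ĉ_{n,k}`, a maximum over a finite set. -/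
def CHat (f : Param d → (ℕ → ℕ) → ℝ) (Θ : Set (Param d)) (q : ℝ → ℝ) (x : ℤ → ℕ)
    (est : ℕ → ℕ → Param d) (u v n : ℕ) : ℝ :=
  sSup ((fun k => CHatAt f Θ q x est u n k) '' {k : ℕ | v ≤ k ∧ k + v ≤ n})

/-- The observed path with a single change after time `tstar`:
`Y_t = Y⁽¹⁾_t` for `t ≤ tstar` and `Y_t = Y⁽²⁾_t` for `t > tstar`. -/
def changePath (Y₁ Y₂ : ℤ → Ω → ℕ) (tstar : ℤ) (ω : Ω) : ℤ → ℕ :=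
  fun t => if t ≤ tstar then Y₁ t ω else Y₂ t ω

/-- Divergence to `+∞` in probability: `P(X_n ≤ M) → 0` for every real `M`. -/
def DivergesInProbability (P : Measure Ω) (X : ℕ → Ω → ℝ) : Prop :=
  ∀ M : ℝ, Tendsto (fun n => P {ω | X n ω ≤ M}) atTop (𝓝 0)

end Model

end ChangePoint

end

open ChangePoint

/-! Up to the factor `1 / q ^ 2`, the statistic at a candidate `k ≈ n s` is `n s² (1 - s)²` times a
quadratic form of the difference of two estimates. Divergence therefore follows from two facts: at
one good candidate the estimates stay a fixed distance apart, and there the quadratic form of `n Σ̂`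
exceeds every constant multiple of the squared norm.

Separation. Write `L₁`, `L₂` for the mean quasi-log-likelihoods of the two regimes; `L_j` has its
unique maximum at `θ_j` (`meanLogLik_lt`). The natural candidate `k ≈ n τ` is not available, because
nothing bounds `q` from above near `τ`; an upper bound comes only from monotonicity near `0` or near
`1`. For `s < τ` close to `0` the left estimate tends to `θ₁`, while the right one nearly maximizes
`(τ - s) L₁ + (1 - τ) L₂`, the mixture `τ L₁ + (1 - τ) L₂` minus `s L₁`. If the full mixture is at
least as large at `θ₂` as at `θ₁`, subtracting `s L₁` makes the comparison strict, since `L₁ θ₁ > L₁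
θ₂`, so the right estimate avoids a neighbourhood of `θ₁` (`exists_negligible_dist_lt_of_lt`). In
the opposite case the mirror argument works at some `s > τ` close to `1`
(`exists_negligible_dist_lt_of_gt`). No limit of the estimate on the mixed window is needed.

Normalization. The window from `u n + 1` to `n` contains the change, and only the nonnegativity of
its sandwich matrix is used. For the first `u n` observations convergence of `Î`, an average of
fourth-order terms, is not available from moments slightly above order three. It suffices that
first-order averages are controlled: Cauchy-Schwarz bounds `Ĵ` below by a constant, and bounding a
sum of squares by the square of the sum gives `Î ≤ K² u n`. Hence `Ĵ Î⁻¹ Ĵ` is at least a constant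
over `u n`, which exceeds `B / n` for every `B` because `u n = o(n)`
(`negligible_quadraticForm_sandwich_lt`).

Both parts rest on a uniform weak law of large numbers derived from the mean ergodic theorem
(`negligible_sum_Icc_uniform`), with truncation of pasts as the source of equicontinuity, and on a
bound for the effect of replacing the stationary past by the observed one
(`CubicBound.negligible_cut`). The estimates are arbitrary maximizers, possibly not measurable in
`ω`, so events are handled through outer measure: monotonicity and subadditivity only. -/

namespace ChangePoint

/-! ### Events of vanishing outer probability. -/

/-- The (outer) probabilities of the events `s n` tend to zero. -/
def Negligible {Ω : Type*} [MeasurableSpace Ω] (P : Measure Ω) (s : ℕ → Set Ω) : Prop :=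
  Tendsto (fun n => P (s n)) atTop (𝓝 0)

section Negligible

variable {Ω : Type*} [MeasurableSpace Ω] {P : Measure Ω}

theorem negligible_iff {s : ℕ → Set Ω} :
    Negligible P s ↔ ∀ δ : ℝ, 0 < δ → ∀ᶠ n in atTop, P (s n) ≤ ENNReal.ofReal δ := by
  unfold Negligible
  rw [ENNReal.tendsto_nhds_zero]
  constructor
  · intro h δ hδ
    exact h _ (by simpa using hδ)
  · intro h ε hε
    rcases eq_or_ne ε ∞ with rfl | hne
    · exact Eventually.of_forall fun _ => le_top
    · filter_upwards [h ε.toReal (ENNReal.toReal_pos hε.ne' hne)] with n hn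
      rwa [ENNReal.ofReal_toReal hne] at hn

theorem Negligible.mono {s t : ℕ → Set Ω} (ht : Negligible P t)
    (h : ∀ᶠ n in atTop, s n ⊆ t n) : Negligible P s := by
  refine tendsto_of_tendsto_of_tendsto_of_le_of_le' tendsto_const_nhds ht
    (Eventually.of_forall fun _ => zero_le) ?_
  filter_upwards [h] with n hn using measure_mono hn

theorem Negligible.union {s t : ℕ → Set Ω} (hs : Negligible P s) (ht : Negligible P t) :
    Negligible P (fun n => s n ∪ t n) := by
  refine tendsto_of_tendsto_of_tendsto_of_le_of_le tendsto_const_nhds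
    (by simpa using Tendsto.add hs ht) (fun _ => zero_le) (fun n => measure_union_le _ _)

theorem Negligible.biUnion {ι : Type*} (I : Finset ι) {s : ι → ℕ → Set Ω}
    (hs : ∀ i ∈ I, Negligible P (s i)) : Negligible P (fun n => ⋃ i ∈ I, s i n) := by
  refine tendsto_of_tendsto_of_tendsto_of_le_of_le tendsto_const_nhds
    (by simpa using tendsto_finsetSum I hs) (fun _ => zero_le)
    (fun n => measure_biUnion_finset_le _ _)

theorem Negligible.comp {s : ℕ → Set Ω} (hs : Negligible P s) {m : ℕ → ℕ}
    (hm : Tendsto m atTop atTop) : Negligible P (fun n => s (m n)) :=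
  Filter.Tendsto.comp (g := fun n => P (s n)) hs hm

/-- Markov's inequality for sums of `m n` nonnegative terms with small mean. -/
theorem negligible_of_lintegral_le {e : ℕ → Ω → ℝ≥0∞} (he : ∀ n, AEMeasurable (e n) P)
    {m r : ℕ → ℝ} (hr : Tendsto r atTop (𝓝 0)) (hm : ∀ᶠ n in atTop, 0 < m n)
    (h : ∀ᶠ n in atTop, ∫⁻ ω, e n ω ∂P ≤ ENNReal.ofReal (r n * m n)) {η : ℝ} (hη : 0 < η) :
    Negligible P (fun n => {ω | ENNReal.ofReal (η * m n) ≤ e n ω}) := by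
  have h0 : Tendsto (fun n => ENNReal.ofReal (r n / η)) atTop (𝓝 0) := by
    have : Tendsto (fun n => r n / η) atTop (𝓝 0) := by simpa using hr.div_const η
    simpa using ENNReal.tendsto_ofReal this
  refine tendsto_of_tendsto_of_tendsto_of_le_of_le' tendsto_const_nhds h0
    (Eventually.of_forall fun _ => zero_le) ?_
  filter_upwards [hm, h] with n hn h1
  have hpos : 0 < η * m n := by positivity
  refine (meas_ge_le_lintegral_div (he n) (by simpa using hpos) ENNReal.ofReal_ne_top).trans ?_
  refine (ENNReal.div_le_div_right h1 _).trans ?_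
  rw [← ENNReal.ofReal_div_of_pos hpos]
  apply ENNReal.ofReal_le_ofReal
  rw [mul_comm η, mul_div_mul_comm, mul_comm]
  rw [div_mul_eq_mul_div, mul_div_assoc']
  apply le_of_eq
  field_simp

end Negligible

/-! ### Mean ergodic theorem and uniform weak laws of large numbers. -/

section Ergodic

variable {X : Type*} [MeasurableSpace X] {ν : Measure X} {T : X → X}

/-- Von Neumann's theorem for the Koopman operator `U` on `L²`: the averages converge to the
projection onto the fixed vectors of `U`. Ergodicity makes the limit constant, and invariance of the
integral identifies the constant. -/
theorem tendsto_eLpNorm_birkhoffAverage_sub_integral [IsProbabilityMeasure ν] (hT : Ergodic T ν) {φ : X → ℝ}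
    (hφ : MemLp φ 2 ν) :
    Tendsto (fun m : ℕ => eLpNorm (fun x => birkhoffAverage ℝ T φ m x - ∫ y, φ y ∂ν) 2 ν)
      atTop (𝓝 0) := by
  have hmp := hT.toMeasurePreserving
  set U : Lp ℝ 2 ν →L[ℝ] Lp ℝ 2 ν :=
    (Lp.compMeasurePreservingₗᵢ ℝ T hmp).toContinuousLinearMap with hU
  have hUval : ∀ g : Lp ℝ 2 ν, U g = Lp.compMeasurePreserving T hmp g := fun g => rfl
  have hU1 : ‖U‖ ≤ 1 := LinearIsometry.norm_toContinuousLinearMap_le _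
  have hlim := U.tendsto_birkhoffAverage_orthogonalProjection hU1 (hφ.toLp φ)
  set g : Lp ℝ 2 ν := ((U.eqLocus (1 : Lp ℝ 2 ν →L[ℝ] Lp ℝ 2 ν)).orthogonalProjectionOnto
    (hφ.toLp φ) : Lp ℝ 2 ν) with hg
  have hgfix : U g = g := by
    have := ((U.eqLocus (1 : Lp ℝ 2 ν →L[ℝ] Lp ℝ 2 ν)).orthogonalProjectionOnto
      (hφ.toLp φ)).2
    exact this
  obtain ⟨a, ha⟩ : ∃ a : ℝ, g =ᵐ[ν] fun _ => a := by
    have h1 : (g : X → ℝ) ∘ T =ᵐ[ν] g := by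
      have := Lp.coeFn_compMeasurePreserving g hmp
      rw [← hUval, hgfix] at this
      exact this.symm
    exact hT.ae_eq_const_of_ae_eq_comp_ae (Lp.aestronglyMeasurable g) h1
  have hiter : ∀ i : ℕ, U^[i] (hφ.toLp φ)
      = (hφ.comp_measurePreserving (hmp.iterate i)).toLp _ := by
    intro i
    have : ∀ i, U^[i] (hφ.toLp φ) = Lp.compMeasurePreserving (T^[i]) (hmp.iterate i) (hφ.toLp φ) := by
      intro i
      have h2 := Lp.compMeasurePreserving_iterate (E := ℝ) (p := 2) hmp i
      have h3 : (U : Lp ℝ 2 ν → Lp ℝ 2 ν) = Lp.compMeasurePreserving T hmp := rfl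
      rw [h3]
      rw [h2]
    rw [this]
    rfl
  have hmem : ∀ i : ℕ, MemLp (φ ∘ T^[i]) 2 ν := fun i => hφ.comp_measurePreserving (hmp.iterate i)
  have havg : ∀ m : ℕ, (birkhoffAverage ℝ U _root_.id m (hφ.toLp φ) : Lp ℝ 2 ν)
      =ᵐ[ν] birkhoffAverage ℝ T φ m := by
    intro m
    simp only [birkhoffAverage, birkhoffSum, _root_.id, hiter]
    refine (Lp.coeFn_smul _ _).trans ?_
    have h2 : ((∑ i ∈ Finset.range m, (hmem i).toLp _ : Lp ℝ 2 ν) : X → ℝ)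
        =ᵐ[ν] fun x => ∑ i ∈ Finset.range m, φ (T^[i] x) := by
      have h3 := Lp.coeFn_finsetSum (Finset.range m) (fun i => (hmem i).toLp _)
      refine h3.trans ?_
      have h4 : ∀ᵐ x ∂ν, ∀ i : ℕ, ((hmem i).toLp (φ ∘ T^[i])) x = φ (T^[i] x) :=
        ae_all_iff.2 fun i => (hmem i).coeFn_toLp
      filter_upwards [h4] with x hx
      simp [hx]
    filter_upwards [h2] with x hx
    simp only [Pi.smul_apply]
    rw [hx]
    rfl
  have hint : ∀ i : ℕ, ∫ x, φ (T^[i] x) ∂ν = ∫ x, φ x ∂ν := fun i => by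
    have hm := hmp.iterate i
    rw [← integral_map (φ := T^[i]) (f := φ) hm.measurable.aemeasurable
      (by rw [hm.map_eq]; exact hφ.1), hm.map_eq]
  have hlim2 : Tendsto (fun m => eLpNorm (fun x => birkhoffAverage ℝ T φ m x - a) 2 ν)
      atTop (𝓝 0) := by
    have := (Lp.tendsto_Lp_iff_tendsto_eLpNorm' _ _).1 hlim
    refine this.congr fun m => eLpNorm_congr_ae ?_
    filter_upwards [havg m, ha] with x hx hx2
    simp only [Pi.sub_apply]
    rw [hx, hx2]
  have hinta : ∀ m : ℕ, m ≠ 0 → ∫ x, birkhoffAverage ℝ T φ m x ∂ν = ∫ x, φ x ∂ν := by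
    intro m hm
    simp only [birkhoffAverage, birkhoffSum]
    rw [integral_smul, integral_finsetSum]
    · simp only [hint, Finset.sum_const, Finset.card_range, smul_eq_mul, nsmul_eq_mul]
      field_simp
    · intro i _
      exact (hmem i).integrable (by norm_num)
  have hmemavg : ∀ m, MemLp (birkhoffAverage ℝ T φ m) 2 ν := fun m =>
    (memLp_congr_ae (havg m)).1 (Lp.memLp _)
  have haeq : a = ∫ x, φ x ∂ν := by
    have h1 : Tendsto (fun m => ∫ x, birkhoffAverage ℝ T φ m x ∂ν) atTop (𝓝 (∫ _, a ∂ν)) := by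
      refine tendsto_integral_of_L1' (fun _ => a) aestronglyMeasurable_const
        (Eventually.of_forall fun m => (hmemavg m).integrable (by norm_num)) ?_
      refine tendsto_of_tendsto_of_tendsto_of_le_of_le tendsto_const_nhds hlim2
        (fun _ => zero_le) (fun m => ?_)
      exact eLpNorm_le_eLpNorm_of_exponent_le (by norm_num)
        ((hmemavg m).1.sub aestronglyMeasurable_const)
    have h2 : Tendsto (fun m => ∫ x, birkhoffAverage ℝ T φ m x ∂ν) atTop (𝓝 (∫ x, φ x ∂ν)) := by
      refine tendsto_const_nhds.congr' ?_
      filter_upwards [eventually_ne_atTop 0] with m hm using (hinta m hm).symm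
    simpa using tendsto_nhds_unique h1 h2
  rw [← haeq]
  exact hlim2

theorem negligible_birkhoffSum_of_memLp_two [IsProbabilityMeasure ν] (hT : Ergodic T ν) {φ : X → ℝ} (hφ : MemLp φ 2 ν)
    {η : ℝ} (hη : 0 < η) :
    Negligible ν fun m : ℕ => {x | η * m < |birkhoffSum T φ m x - m * ∫ y, φ y ∂ν|} := by
  have h := tendsto_eLpNorm_birkhoffAverage_sub_integral hT hφ
  have hmeas : ∀ m : ℕ, AEStronglyMeasurable (birkhoffAverage ℝ T φ m) ν := by
    intro m
    have : birkhoffAverage ℝ T φ m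
        = (m : ℝ)⁻¹ • ∑ i ∈ Finset.range m, φ ∘ T^[i] := by
      ext x
      simp [birkhoffAverage, birkhoffSum]
    rw [this]
    refine AEStronglyMeasurable.const_smul ?_ _
    exact Finset.aestronglyMeasurable_sum _ fun i _ =>
      hφ.1.comp_measurePreserving (hT.toMeasurePreserving.iterate i)
  have h2 := tendstoInMeasure_of_tendsto_eLpNorm (l := atTop) (p := 2) (by norm_num) hmeas
    (aestronglyMeasurable_const (b := ∫ y, φ y ∂ν)) h
  have h3 := (tendstoInMeasure_iff_norm.1 h2) η hη
  refine Negligible.mono h3 ?_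
  filter_upwards [eventually_gt_atTop 0] with m hm x hx
  have hm' : (0 : ℝ) < m := by exact_mod_cast hm
  simp only [mem_ofPred_eq, birkhoffAverage, smul_eq_mul, Real.norm_eq_abs] at hx ⊢
  have : (m : ℝ)⁻¹ * birkhoffSum T φ m x - ∫ y, φ y ∂ν
      = (m : ℝ)⁻¹ * (birkhoffSum T φ m x - m * ∫ y, φ y ∂ν) := by field_simp
  rw [this, abs_mul, abs_of_pos (inv_pos.2 hm'), inv_mul_eq_div, le_div_iff₀ hm']
  exact hx.le

theorem lintegral_birkhoffSum (hT : MeasurePreserving T ν ν) {R : X → ℝ≥0∞}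
    (hR : AEMeasurable R ν) (m : ℕ) :
    ∫⁻ x, birkhoffSum T R m x ∂ν = m * ∫⁻ x, R x ∂ν := by
  simp only [birkhoffSum]
  have hi : ∀ i : ℕ, AEMeasurable (fun x => R (T^[i] x)) ν := fun i =>
    hR.comp_quasiMeasurePreserving (hT.iterate i).quasiMeasurePreserving
  rw [lintegral_finsetSum' _ fun i _ => hi i]
  have : ∀ i ∈ Finset.range m, ∫⁻ x, R (T^[i] x) ∂ν = ∫⁻ x, R x ∂ν := fun i _ => by
    have hm := hT.iterate i
    rw [← lintegral_map' (f := R) (g := T^[i]) (by rw [hm.map_eq]; exact hR)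
      hm.measurable.aemeasurable, hm.map_eq]
  rw [Finset.sum_congr rfl this]
  simp

theorem aemeasurable_birkhoffSum (hT : MeasurePreserving T ν ν) {R : X → ℝ≥0∞}
    (hR : AEMeasurable R ν) (m : ℕ) : AEMeasurable (birkhoffSum T R m) ν := by
  have : birkhoffSum T R m = ∑ i ∈ Finset.range m, R ∘ T^[i] := by
    ext x; simp [birkhoffSum]
  rw [this]
  exact Finset.aemeasurable_sum _ fun i _ =>
    hR.comp_quasiMeasurePreserving (hT.iterate i).quasiMeasurePreserving

/-- Markov's inequality with invariance. The bound does not depend on `m`, so approximation errors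
that are small in `L¹` are controlled for all window lengths at once. -/
theorem measure_birkhoffSum_ge_le (hT : MeasurePreserving T ν ν) {R : X → ℝ≥0∞}
    (hR : AEMeasurable R ν) {a b : ℝ} (hb : 0 < b) (hRa : ∫⁻ x, R x ∂ν ≤ ENNReal.ofReal a)
    {m : ℕ} (hm : 0 < m) :
    ν {x | ENNReal.ofReal (b * m) ≤ birkhoffSum T R m x} ≤ ENNReal.ofReal (a / b) := by
  have hm' : (0 : ℝ) < m := by exact_mod_cast hm
  have hpos : 0 < b * m := by positivity
  refine (meas_ge_le_lintegral_div (aemeasurable_birkhoffSum hT hR m) (by simpa using hpos)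
    ENNReal.ofReal_ne_top).trans ?_
  rw [lintegral_birkhoffSum hT hR]
  have h1 : (m : ℝ≥0∞) * ∫⁻ x, R x ∂ν ≤ ENNReal.ofReal (m * a) := by
    rw [ENNReal.ofReal_mul hm'.le, ENNReal.ofReal_natCast]
    gcongr
  refine (ENNReal.div_le_div_right h1 _).trans ?_
  rw [← ENNReal.ofReal_div_of_pos hpos]
  apply ENNReal.ofReal_le_ofReal
  apply le_of_eq
  field_simp

/-- A finite sum of reals is bounded by the sum of extended bounds for its terms. -/
theorem abs_sum_lt_of_ofReal_le {ι : Type*} {s : Finset ι} {a : ι → ℝ} {R : ι → ℝ≥0∞}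
    (h : ∀ i ∈ s, ENNReal.ofReal |a i| ≤ R i) {b : ℝ} (hb : ∑ i ∈ s, R i < ENNReal.ofReal b) :
    ∑ i ∈ s, |a i| < b := by
  have h1 : ENNReal.ofReal (∑ i ∈ s, |a i|) < ENNReal.ofReal b := by
    rw [ENNReal.ofReal_sum_of_nonneg fun i _ => abs_nonneg _]
    exact (Finset.sum_le_sum h).trans_lt hb
  exact (ENNReal.ofReal_lt_ofReal_iff_of_nonneg (Finset.sum_nonneg fun i _ => abs_nonneg _)).1 h1

/-- The `L²` case applies to a simple function close to `φ` in `L¹`; the remainder is handled by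
Markov's inequality. -/
theorem negligible_birkhoffSum [IsProbabilityMeasure ν] (hT : Ergodic T ν) {φ : X → ℝ} (hφ : Integrable φ ν)
    {η : ℝ} (hη : 0 < η) :
    Negligible ν fun m : ℕ => {x | η * m < |birkhoffSum T φ m x - m * ∫ y, φ y ∂ν|} := by
  rw [negligible_iff]
  intro δ hδ
  -- The first bound keeps the two integrals within `η / 3`; the second makes the Markov bound `a /
  -- (η / 3)` at most `δ / 2`.
  set a : ℝ := min (η / 3) (δ * η / 6) with ha
  have ha0 : 0 < a := by positivity
  obtain ⟨g, hg, -⟩ := (memLp_one_iff_integrable.2 hφ).exists_simpleFunc_eLpNorm_sub_lt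
    (by simp) (ε := ENNReal.ofReal a) (by simpa using ha0)
  have hg2 : MemLp g 2 ν := g.memLp_of_isFiniteMeasure 2 ν
  have hgi : Integrable g ν := hg2.integrable (by norm_num)
  set R : X → ℝ≥0∞ := fun x => ‖φ x - g x‖ₑ with hR
  have hRm : AEMeasurable R ν := (hφ.1.sub hgi.1).enorm
  have hRa : ∫⁻ x, R x ∂ν ≤ ENNReal.ofReal a := by
    have := hg.le
    rwa [eLpNorm_one_eq_lintegral_enorm] at this
  have hdiff : |∫ x, φ x ∂ν - ∫ x, g x ∂ν| ≤ η / 3 := by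
    rw [← integral_sub hφ hgi]
    have h1 : ENNReal.ofReal |∫ x, (φ x - g x) ∂ν| ≤ ENNReal.ofReal a := by
      rw [← Real.enorm_eq_ofReal_abs]
      exact (enorm_integral_le_lintegral_enorm _).trans hRa
    exact ((ENNReal.ofReal_le_ofReal_iff ha0.le).1 h1).trans (min_le_left _ _)
  have hN := negligible_iff.1 (negligible_birkhoffSum_of_memLp_two hT hg2 (η := η / 3)
    (by positivity)) (δ / 2) (by positivity)
  filter_upwards [hN, eventually_gt_atTop 0] with m hm hm0
  have hm' : (0 : ℝ) < m := by exact_mod_cast hm0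
  have hsub : {x | η * m < |birkhoffSum T φ m x - m * ∫ y, φ y ∂ν|}
      ⊆ {x | η / 3 * m < |birkhoffSum T g m x - m * ∫ y, g y ∂ν|}
        ∪ {x | ENNReal.ofReal (η / 3 * m) ≤ birkhoffSum T R m x} := by
    intro x hx
    by_contra hcon
    simp only [mem_union, mem_ofPred_eq, not_or, not_lt, not_le] at hcon hx
    have h1 : |birkhoffSum T φ m x - birkhoffSum T g m x| < η / 3 * m := by
      simp only [birkhoffSum]
      rw [← Finset.sum_sub_distrib]
      refine (Finset.abs_sum_le_sum_abs _ _).trans_lt ?_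
      refine abs_sum_lt_of_ofReal_le (R := fun i => R (T^[i] x)) (fun i _ => ?_) hcon.2
      simp only [hR, Real.enorm_eq_ofReal_abs]
      exact le_rfl
    have h2 : |(m : ℝ) * ∫ y, φ y ∂ν - m * ∫ y, g y ∂ν| ≤ η / 3 * m := by
      rw [← mul_sub, abs_mul, abs_of_pos hm', mul_comm]
      gcongr
    have h3 := hcon.1
    rw [abs_lt] at h1
    rw [abs_le] at h2 h3
    rcases lt_abs.1 hx with hx | hx <;> linarith
  refine (measure_mono hsub).trans ((measure_union_le _ _).trans ?_)
  have h4 := measure_birkhoffSum_ge_le hT.toMeasurePreserving hRm (b := η / 3) (by positivity)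
    hRa hm0
  have h5 : a / (η / 3) ≤ δ / 2 := by
    rw [div_le_iff₀ (by positivity)]
    have := min_le_right (η / 3) (δ * η / 6)
    calc a ≤ δ * η / 6 := this
      _ = _ := by ring
  calc _ ≤ ENNReal.ofReal (δ / 2) + ENNReal.ofReal (δ / 2) :=
        add_le_add hm (h4.trans (ENNReal.ofReal_le_ofReal h5))
    _ = ENNReal.ofReal δ := by
        rw [← ENNReal.ofReal_add (by positivity) (by positivity)]
        congr 1; ring

/-- A uniform law of large numbers in probability over a totally bounded index set, for
functions with a small mean modulus of continuity. -/
theorem negligible_birkhoffSum_uniform [IsProbabilityMeasure ν] {ι : Type*} [PseudoMetricSpace ι] (hT : Ergodic T ν)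
    {K : Set ι} (hK : TotallyBounded K) {φ : ι → X → ℝ} (hφ : ∀ θ ∈ K, Integrable (φ θ) ν)
    (hmod : ∀ η : ℝ, 0 < η → ∃ r > 0, ∃ R : X → ℝ≥0∞, AEMeasurable R ν ∧
      ∫⁻ x, R x ∂ν ≤ ENNReal.ofReal η ∧ ∀ θ ∈ K, ∀ θ' ∈ K, dist θ θ' < r →
        ∀ x, ENNReal.ofReal |φ θ x - φ θ' x| ≤ R x)
    {η : ℝ} (hη : 0 < η) :
    Negligible ν fun m : ℕ =>
      {x | ∃ θ ∈ K, η * m < |birkhoffSum T (φ θ) m x - m * ∫ y, φ θ y ∂ν|} := by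
  rw [negligible_iff]
  intro δ hδ
  set a : ℝ := min (η / 3) (δ * η / 6) with ha
  have ha0 : 0 < a := by positivity
  obtain ⟨r, hr, R, hRm, hRa, hR⟩ := hmod a ha0
  -- A finite `r`-net reduces uniformity over `K` to finitely many laws of large numbers; the
  -- modulus `R` controls the passage to the nearest net point simultaneously for all parameters.
  obtain ⟨t, htK, htf, hcov⟩ :=
    Metric.finite_approx_of_totallyBounded hK r hr
  have hN := negligible_iff.1 (Negligible.biUnion htf.toFinset
    (s := fun θ m => {x | η / 3 * m < |birkhoffSum T (φ θ) m x - m * ∫ y, φ θ y ∂ν|})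
    (P := ν) (fun θ hθ => negligible_birkhoffSum hT (hφ θ (htK (htf.mem_toFinset.1 hθ)))
      (η := η / 3) (by positivity))) (δ / 2) (by positivity)
  filter_upwards [hN, eventually_gt_atTop 0] with m hm hm0
  have hm' : (0 : ℝ) < m := by exact_mod_cast hm0
  have hsub : {x | ∃ θ ∈ K, η * m < |birkhoffSum T (φ θ) m x - m * ∫ y, φ θ y ∂ν|}
      ⊆ (⋃ θ ∈ htf.toFinset, {x | η / 3 * m < |birkhoffSum T (φ θ) m x - m * ∫ y, φ θ y ∂ν|})
        ∪ {x | ENNReal.ofReal (η / 3 * m) ≤ birkhoffSum T R m x} := by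
    rintro x ⟨θ, hθ, hx⟩
    by_contra hcon
    simp only [mem_union, mem_ofPred_eq, not_or, not_le, mem_iUnion, not_exists, not_lt] at hcon
    obtain ⟨θ', hθ', hd⟩ : ∃ θ' ∈ t, dist θ θ' < r := by simpa using hcov hθ
    have hθ'K := htK hθ'
    have hclose := hR θ hθ θ' hθ'K hd
    have h1 : |birkhoffSum T (φ θ) m x - birkhoffSum T (φ θ') m x| < η / 3 * m := by
      simp only [birkhoffSum]
      rw [← Finset.sum_sub_distrib]
      refine (Finset.abs_sum_le_sum_abs _ _).trans_lt ?_
      exact abs_sum_lt_of_ofReal_le (R := fun i => R (T^[i] x)) (fun i _ => hclose _) hcon.2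
    have h2 : |(m : ℝ) * ∫ y, φ θ y ∂ν - m * ∫ y, φ θ' y ∂ν| ≤ η / 3 * m := by
      rw [← mul_sub, abs_mul, abs_of_pos hm', mul_comm, ← integral_sub (hφ θ hθ) (hφ θ' hθ'K)]
      gcongr
      have h1 : ENNReal.ofReal |∫ x, (φ θ x - φ θ' x) ∂ν| ≤ ENNReal.ofReal a := by
        rw [← Real.enorm_eq_ofReal_abs]
        refine (enorm_integral_le_lintegral_enorm _).trans (le_trans ?_ hRa)
        refine lintegral_mono fun x => ?_
        rw [Real.enorm_eq_ofReal_abs]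
        exact hclose x
      exact ((ENNReal.ofReal_le_ofReal_iff ha0.le).1 h1).trans (min_le_left _ _)
    have h3 := hcon.1 θ' (htf.mem_toFinset.2 hθ')
    rw [abs_lt] at h1
    rw [abs_le] at h2 h3
    rcases lt_abs.1 hx with hx | hx <;> linarith
  refine (measure_mono hsub).trans ((measure_union_le _ _).trans ?_)
  have h4 := measure_birkhoffSum_ge_le hT.toMeasurePreserving hRm (b := η / 3) (by positivity)
    hRa hm0
  have h5 : a / (η / 3) ≤ δ / 2 := by
    rw [div_le_iff₀ (by positivity)]
    have := min_le_right (η / 3) (δ * η / 6)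
    calc a ≤ δ * η / 6 := this
      _ = _ := by ring
  calc _ ≤ ENNReal.ofReal (δ / 2) + ENNReal.ofReal (δ / 2) :=
        add_le_add hm (h4.trans (ENNReal.ofReal_le_ofReal h5))
    _ = ENNReal.ofReal δ := by
        rw [← ENNReal.ofReal_add (by positivity) (by positivity)]
        congr 1; ring

/-- The uniform law of large numbers along windows `Icc (l n) (l' n)` of growing length. -/
theorem negligible_sum_Icc_uniform [IsProbabilityMeasure ν] {ι : Type*} [PseudoMetricSpace ι] (hT : Ergodic T ν)
    {K : Set ι} (hK : TotallyBounded K) {φ : ι → X → ℝ} (hφ : ∀ θ ∈ K, Integrable (φ θ) ν)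
    (hmod : ∀ η : ℝ, 0 < η → ∃ r > 0, ∃ R : X → ℝ≥0∞, AEMeasurable R ν ∧
      ∫⁻ x, R x ∂ν ≤ ENNReal.ofReal η ∧ ∀ θ ∈ K, ∀ θ' ∈ K, dist θ θ' < r →
        ∀ x, ENNReal.ofReal |φ θ x - φ θ' x| ≤ R x)
    {l l' : ℕ → ℕ} (hl : Tendsto (fun n => l' n + 1 - l n) atTop atTop)
    {η : ℝ} (hη : 0 < η) :
    Negligible ν fun n : ℕ =>
      {x | ∃ θ ∈ K, η * (l' n + 1 - l n : ℕ) < |∑ t ∈ Finset.Icc (l n) (l' n), φ θ (T^[t] x)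
        - (l' n + 1 - l n : ℕ) * ∫ y, φ θ y ∂ν|} := by
  have h := (negligible_birkhoffSum_uniform hT hK hφ hmod hη).comp hl
  refine tendsto_of_tendsto_of_tendsto_of_le_of_le tendsto_const_nhds h
    (fun _ => zero_le) (fun n => ?_)
  set S := {x | ∃ θ ∈ K, η * (l' n + 1 - l n : ℕ)
    < |birkhoffSum T (φ θ) (l' n + 1 - l n) x - (l' n + 1 - l n : ℕ) * ∫ y, φ θ y ∂ν|} with hS
  have hm := hT.toMeasurePreserving.iterate (l n)
  have hsum : ∀ θ x, ∑ t ∈ Finset.Icc (l n) (l' n), φ θ (T^[t] x)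
      = birkhoffSum T (φ θ) (l' n + 1 - l n) (T^[l n] x) := by
    intro θ x
    have : Finset.Icc (l n) (l' n) = Finset.Ico (l n) (l' n + 1) := by
      ext; simp
    rw [this, Finset.sum_Ico_eq_sum_range]
    simp only [birkhoffSum]
    refine Finset.sum_congr rfl fun i _ => ?_
    rw [← Function.iterate_add_apply, add_comm]
  -- A window starting at `l n` is an initial window seen from `T^[l n] x`, so invariance removes
  -- the starting point. The uniform event need not be measurable, hence only the inequality
  -- `Measure.le_map_apply` is used below.
  have hpre : {x | ∃ θ ∈ K, η * (l' n + 1 - l n : ℕ) < |∑ t ∈ Finset.Icc (l n) (l' n),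
      φ θ (T^[t] x) - (l' n + 1 - l n : ℕ) * ∫ y, φ θ y ∂ν|} = T^[l n] ⁻¹' S := by
    ext x
    simp only [hsum, hS, mem_ofPred_eq, mem_preimage]
  refine (congrArg ν hpre).trans_le ?_
  calc ν (T^[l n] ⁻¹' S) ≤ (ν.map T^[l n]) S := Measure.le_map_apply hm.measurable.aemeasurable S
    _ = ν S := by rw [hm.map_eq]

end Ergodic

/-! ### Weighted distances of pasts and equicontinuity by truncation. -/

section Weights

/-- The weighted `ℓ¹` distance of two pasts. -/
noncomputable def wdist (β : ℕ → ℝ) (y y' : ℕ → ℕ) : ℝ≥0∞ :=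
  ∑' k, ENNReal.ofReal (β k * |(y k : ℝ) - (y' k : ℝ)|)

/-- The total weight `∑ β k`. -/
noncomputable def mass (β : ℕ → ℝ) : ℝ≥0∞ := ∑' k, ENNReal.ofReal (β k)

/-- The tail weight `∑_{k ≥ j} β k`. -/
noncomputable def tail (β : ℕ → ℝ) (j : ℕ) : ℝ≥0∞ :=
  ∑' k, if j ≤ k then ENNReal.ofReal (β k) else 0

/-- `z t + ∑ β k z (t - 1 - k)`. -/
noncomputable def env (β : ℕ → ℝ) (z : ℤ → ℝ≥0∞) (t : ℤ) : ℝ≥0∞ :=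
  z t + ∑' k : ℕ, ENNReal.ofReal (β k) * z (t - 1 - k)

/-- `∑_{k ≥ j} β k z (t - 1 - k)`. -/
noncomputable def cut (β : ℕ → ℝ) (j : ℕ) (z : ℤ → ℝ≥0∞) (t : ℤ) : ℝ≥0∞ :=
  ∑' k : ℕ, (if j ≤ k then ENNReal.ofReal (β k) else 0) * z (t - 1 - k)

/-- A bound for the weighted distance of a past to its truncation to `m` lags and values
at most `m`. -/
noncomputable def rem (β : ℕ → ℝ) (m : ℕ) (z : ℤ → ℝ≥0∞) (t : ℤ) : ℝ≥0∞ :=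
  (∑' k : ℕ, ENNReal.ofReal (β k) * z (t - 1 - k) ^ 2) * (m : ℝ≥0∞)⁻¹ + cut β m z t

variable {β : ℕ → ℝ}

theorem mass_ne_top (hs : Summable β) (hβ : ∀ k, 0 ≤ β k) : mass β ≠ ∞ := by
  unfold mass
  rw [← ENNReal.ofReal_tsum_of_nonneg hβ hs]
  exact ENNReal.ofReal_ne_top

theorem tail_le_mass (j : ℕ) : tail β j ≤ mass β :=
  ENNReal.tsum_le_tsum fun k => by split_ifs <;> simp

theorem tail_anti : Antitone (tail β) := fun i j hij =>
  ENNReal.tsum_le_tsum fun k => by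
    split_ifs with h1 h2
    · exact le_rfl
    · exact absurd (hij.trans h1) h2
    · exact zero_le
    · exact le_rfl

theorem tendsto_tail (hs : Summable β) (hβ : ∀ k, 0 ≤ β k) :
    Tendsto (tail β) atTop (𝓝 0) := by
  have h := ENNReal.tendsto_tsum_compl_atTop_zero (f := fun k => ENNReal.ofReal (β k))
    (mass_ne_top hs hβ)
  have h2 := h.comp tendsto_finset_range
  refine h2.congr fun j => ?_
  simp only [Function.comp, tail]
  refine (tsum_subtype {x | x ∉ Finset.range j} fun k => ENNReal.ofReal (β k)).trans ?_
  refine tsum_congr fun k => ?_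
  simp [indicator, Finset.mem_range]

theorem wdist_le_of_le {α : ℕ → ℝ} (h : ∀ k, α k ≤ β k) (y y' : ℕ → ℕ) :
    wdist α y y' ≤ wdist β y y' :=
  ENNReal.tsum_le_tsum fun k => ENNReal.ofReal_le_ofReal
    (mul_le_mul_of_nonneg_right (h k) (abs_nonneg _))

theorem wdist_le_tsum (w : ℕ → ℝ≥0∞) {b : ℕ → ℝ≥0∞} {y y' : ℕ → ℕ} (hβ : ∀ k, 0 ≤ β k)
    (h : ∀ k, ENNReal.ofReal (β k) * ENNReal.ofReal |(y k : ℝ) - (y' k : ℝ)| ≤ b k * w k) :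
    wdist β y y' ≤ ∑' k, b k * w k :=
  ENNReal.tsum_le_tsum fun k => by
    rw [ENNReal.ofReal_mul (hβ k)]
    exact h k

/-- Truncation of a past to its first `m` lags and to values at most `m`. -/
def trunc (m : ℕ) (y : ℕ → ℕ) : ℕ → ℕ := fun k => if k < m then min (y k) m else 0

/-- Finiteness lets continuity in the parameter at each truncated past be upgraded to one modulus
common to all of them. -/
theorem finite_range_trunc (m : ℕ) : (range (trunc m)).Finite := by
  refine (Set.finite_range fun g : Fin m → Fin (m + 1) =>
    fun k : ℕ => if h : k < m then (g ⟨k, h⟩ : ℕ) else 0).subset ?_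
  rintro _ ⟨y, rfl⟩
  refine ⟨fun i => ⟨min (y i) m, Nat.lt_succ_of_le (min_le_right _ _)⟩, ?_⟩
  funext k
  simp only [trunc]
  split_ifs <;> rfl

/-- Capping a value at `m` costs nothing unless it exceeds `m`, and then costs at most `y k ≤ (y k)²
/ m`; this gives the quadratic term of `rem`. The dropped lags give the `cut` term. -/
theorem wdist_trunc_le (hβ : ∀ k, 0 ≤ β k) {m : ℕ} (hm : 0 < m) {y : ℕ → ℕ} {z : ℤ → ℝ≥0∞}
    {t : ℤ} (hy : ∀ k : ℕ, (y k : ℝ≥0∞) ≤ z (t - 1 - k)) :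
    wdist β y (trunc m y) ≤ rem β m z t := by
  have hm0 : (m : ℝ≥0∞) ≠ 0 := by exact_mod_cast hm.ne'
  have h : wdist β y (trunc m y) ≤ ∑' k : ℕ, (ENNReal.ofReal (β k) * z (t - 1 - k) ^ 2
      * (m : ℝ≥0∞)⁻¹ + (if m ≤ k then ENNReal.ofReal (β k) else 0) * z (t - 1 - k)) := by
    refine ENNReal.tsum_le_tsum fun k => ?_
    rw [ENNReal.ofReal_mul (hβ k)]
    by_cases hk : k < m
    · refine le_add_right ?_
      rw [mul_assoc]
      gcongr
      simp only [trunc, hk, if_true]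
      rcases le_or_gt (y k) m with hle | hlt
      · simp [min_eq_left hle]
      · rw [min_eq_right hlt.le]
        have h1 : ENNReal.ofReal |(y k : ℝ) - m| ≤ y k := by
          rw [← ENNReal.ofReal_natCast]
          apply ENNReal.ofReal_le_ofReal
          rw [abs_of_nonneg (by simpa using hlt.le)]
          linarith [(Nat.cast_nonneg m : (0 : ℝ) ≤ m)]
        refine h1.trans ?_
        rw [← div_eq_mul_inv, ENNReal.le_div_iff_mul_le (Or.inl hm0) (Or.inl (by simp)), pow_two]
        have h2 : (m : ℝ≥0∞) ≤ y k := by exact_mod_cast hlt.le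
        exact mul_le_mul' (hy k) (h2.trans (hy k))
    · refine le_add_left ?_
      have hk' : m ≤ k := not_lt.1 hk
      simp only [trunc, hk, if_false, hk', if_true]
      gcongr
      simp only [Nat.cast_zero, sub_zero, Nat.abs_cast, ENNReal.ofReal_natCast]
      exact hy k
  refine h.trans_eq ?_
  rw [ENNReal.tsum_add, ENNReal.tsum_mul_right]
  rfl

/-- Functions of the past that are continuous in the parameter and Lipschitz in the past are
equicontinuous in the parameter, up to the truncation error. -/
theorem exists_modulus {ι E : Type*} [PseudoMetricSpace ι] [PseudoMetricSpace E]
    (hβ : ∀ k, 0 ≤ β k) {K : Set ι} (hK : IsCompact K) {F : ι → (ℕ → ℕ) → E}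
    (hc : ∀ y, ContinuousOn (fun θ => F θ y) K)
    (hl : ∀ θ ∈ K, ∀ y y', edist (F θ y) (F θ y') ≤ wdist β y y')
    {m : ℕ} (hm : 0 < m) {η : ℝ} (hη : 0 < η) :
    ∃ r > 0, ∀ θ ∈ K, ∀ θ' ∈ K, dist θ θ' < r → ∀ (y : ℕ → ℕ) (z : ℤ → ℝ≥0∞) (t : ℤ),
      (∀ k : ℕ, (y k : ℝ≥0∞) ≤ z (t - 1 - k)) →
      edist (F θ y) (F θ' y) ≤ ENNReal.ofReal η + 2 * rem β m z t := by
  have h1 : ∀ y ∈ range (trunc m), ∀ᶠ r in 𝓝[>] (0 : ℝ), ∀ θ ∈ K, ∀ θ' ∈ K, dist θ θ' < r →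
      edist (F θ y) (F θ' y) ≤ ENNReal.ofReal η := by
    intro y _
    have hu := hK.uniformContinuousOn_of_continuous (hc y)
    obtain ⟨δ, hδ, h⟩ := Metric.uniformContinuousOn_iff.1 hu η hη
    filter_upwards [Ioo_mem_nhdsGT hδ] with r hr θ hθ θ' hθ' hd
    rw [edist_dist]
    exact ENNReal.ofReal_le_ofReal (h θ hθ θ' hθ' (hd.trans hr.2)).le
  -- One radius serves all truncated pasts; a general past is compared with its truncation at both
  -- parameters, whence the factor `2` in front of `rem`.
  have h2 := ((finite_range_trunc m).eventually_all).2 h1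
  obtain ⟨r, hr, hr0⟩ := (h2.and self_mem_nhdsWithin).exists
  refine ⟨r, hr0, fun θ hθ θ' hθ' hd y z t hy => ?_⟩
  have h3 := hr (trunc m y) ⟨y, rfl⟩ θ hθ θ' hθ' hd
  have h4 := wdist_trunc_le hβ hm hy
  calc edist (F θ y) (F θ' y) ≤ edist (F θ y) (F θ (trunc m y))
        + edist (F θ (trunc m y)) (F θ' (trunc m y)) + edist (F θ' (trunc m y)) (F θ' y) :=
        edist_triangle4 _ _ _ _
    _ ≤ rem β m z t + ENNReal.ofReal η + rem β m z t := by
        refine add_le_add (add_le_add ((hl θ hθ _ _).trans h4) h3) ?_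
        rw [edist_comm]
        exact (hl θ' hθ' _ _).trans h4
    _ = _ := by ring

end Weights

/-! ### Moment bounds for the dominating process. -/

section Moments

variable {Ω : Type*} [MeasurableSpace Ω]

/-- A process with values in `[1, ∞]` all of whose third-order moments are at most `M`. -/
structure CubicBound (P : Measure Ω) (Z : Ω → ℤ → ℝ≥0∞) (M : ℝ≥0∞) : Prop where
  measurable : ∀ t, Measurable fun ω => Z ω t
  one_le : ∀ ω t, 1 ≤ Z ω t
  bound : ∀ r s t, ∫⁻ ω, Z ω r * Z ω s * Z ω t ∂P ≤ M

variable {P : Measure Ω} {Z : Ω → ℤ → ℝ≥0∞} {M : ℝ≥0∞} {β : ℕ → ℝ}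

theorem lintegral_mul_tsum_le {Q : Ω → ℝ≥0∞} (hQ : Measurable Q) {W : ℕ → Ω → ℝ≥0∞}
    (hW : ∀ k, Measurable (W k)) {C : ℝ≥0∞} (h : ∀ k, ∫⁻ ω, Q ω * W k ω ∂P ≤ C)
    (b : ℕ → ℝ≥0∞) : ∫⁻ ω, Q ω * ∑' k, b k * W k ω ∂P ≤ C * ∑' k, b k := by
  have h1 : ∀ ω, Q ω * ∑' k, b k * W k ω = ∑' k, b k * (Q ω * W k ω) := fun ω => by
    rw [← ENNReal.tsum_mul_left]
    exact tsum_congr fun k => by ring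
  simp only [h1]
  rw [lintegral_tsum fun k => ((hQ.fun_mul (hW k)).const_mul _).aemeasurable, mul_comm,
    ← ENNReal.tsum_mul_right]
  refine ENNReal.tsum_le_tsum fun k => ?_
  rw [lintegral_const_mul _ (hQ.fun_mul (hW k))]
  gcongr
  exact h k

variable (hZ : CubicBound P Z M)
include hZ

theorem CubicBound.measurable_env (t : ℤ) : Measurable fun ω => env β (Z ω) t :=
  (hZ.measurable t).add (Measurable.tsum fun _ => (hZ.measurable _).const_mul _)

theorem CubicBound.measurable_cut (j : ℕ) (t : ℤ) : Measurable fun ω => cut β j (Z ω) t :=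
  Measurable.tsum fun _ => (hZ.measurable _).const_mul _

theorem CubicBound.measurable_rem (m : ℕ) (t : ℤ) : Measurable fun ω => rem β m (Z ω) t :=
  ((Measurable.tsum fun _ => ((hZ.measurable _).pow_const 2).const_mul _).mul_const _).add
    (hZ.measurable_cut m t)

theorem CubicBound.lintegral_env_mul_mul (t r s : ℤ) :
    ∫⁻ ω, env β (Z ω) t * (Z ω r * Z ω s) ∂P ≤ (1 + mass β) * M := by
  have hm : Measurable fun ω => Z ω r * Z ω s := (hZ.measurable r).mul (hZ.measurable s)
  have h1 : ∀ ω, env β (Z ω) t * (Z ω r * Z ω s) = Z ω r * Z ω s * Z ω t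
      + (Z ω r * Z ω s) * ∑' k : ℕ, ENNReal.ofReal (β k) * Z ω (t - 1 - k) := fun ω => by
    unfold env; ring
  simp only [h1]
  rw [lintegral_add_left (hm.fun_mul (hZ.measurable t)), add_mul, one_mul]
  refine add_le_add (hZ.bound r s t) ?_
  rw [mul_comm]
  exact lintegral_mul_tsum_le hm (fun _ => hZ.measurable _) (fun _ => hZ.bound _ _ _) _

/-- Since `Z ≥ 1`, lower-order moments are dominated by third-order ones by inserting further
factors `Z`. -/
theorem CubicBound.lintegral_env_mul (t s : ℤ) :
    ∫⁻ ω, env β (Z ω) t * Z ω s ∂P ≤ (1 + mass β) * M := by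
  refine le_trans (lintegral_mono fun ω => ?_) (hZ.lintegral_env_mul_mul t s s)
  gcongr
  exact le_mul_of_one_le_left (zero_le) (hZ.one_le ω s)

theorem CubicBound.lintegral_env (t : ℤ) :
    ∫⁻ ω, env β (Z ω) t ∂P ≤ (1 + mass β) * M := by
  refine le_trans (lintegral_mono fun ω => ?_) (hZ.lintegral_env_mul t t)
  exact le_mul_of_one_le_right (zero_le) (hZ.one_le ω t)

theorem CubicBound.lintegral_env_mul_cut (t : ℤ) (j : ℕ) :
    ∫⁻ ω, env β (Z ω) t * cut β j (Z ω) t ∂P ≤ (1 + mass β) * M * tail β j :=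
  lintegral_mul_tsum_le (hZ.measurable_env t) (fun _ => hZ.measurable _)
    (fun _ => hZ.lintegral_env_mul _ _) _

/-- Third moments are needed here: the truncation error contains squares of past values, and the
score-type factor `env` multiplies them by one more value. -/
theorem CubicBound.lintegral_env_mul_rem (t : ℤ) (m : ℕ) :
    ∫⁻ ω, env β (Z ω) t * rem β m (Z ω) t ∂P
      ≤ (1 + mass β) * M * (mass β * (m : ℝ≥0∞)⁻¹ + tail β m) := by
  have hmeas : Measurable fun ω => env β (Z ω) t
      * ∑' k : ℕ, ENNReal.ofReal (β k) * Z ω (t - 1 - k) ^ 2 :=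
    (hZ.measurable_env t).mul
      (Measurable.tsum fun _ => ((hZ.measurable _).pow_const 2).const_mul _)
  have h1 : ∀ ω, env β (Z ω) t * rem β m (Z ω) t
      = (env β (Z ω) t * ∑' k : ℕ, ENNReal.ofReal (β k) * Z ω (t - 1 - k) ^ 2)
        * (m : ℝ≥0∞)⁻¹ + env β (Z ω) t * cut β m (Z ω) t := fun ω => by
    unfold rem; ring
  simp only [h1]
  rw [lintegral_add_left (hmeas.mul_const _), mul_add, lintegral_mul_const _ hmeas, ← mul_assoc]
  refine add_le_add ?_ (hZ.lintegral_env_mul_cut t m)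
  gcongr
  refine lintegral_mul_tsum_le (hZ.measurable_env t) (fun _ => (hZ.measurable _).pow_const 2)
    (fun k => ?_) _
  simpa only [pow_two] using hZ.lintegral_env_mul_mul t _ _

/-- The mean of `env * (η + 2 rem)` is small if `η` is small and `m` is large. -/
theorem CubicBound.exists_lintegral_le (hM : M ≠ ∞) (hs : Summable β) (hβ : ∀ k, 0 ≤ β k)
    {δ : ℝ} (hδ : 0 < δ) : ∃ m : ℕ, 0 < m ∧ ∃ η : ℝ, 0 < η ∧ ∀ t,
      ∫⁻ ω, env β (Z ω) t * (ENNReal.ofReal η + 2 * rem β m (Z ω) t) ∂P ≤ ENNReal.ofReal δ := by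
  set A : ℝ≥0∞ := (1 + mass β) * M with hA
  have hmass := mass_ne_top hs hβ
  have hA' : A ≠ ∞ := ENNReal.mul_ne_top (by simp [hmass]) hM
  have h1 : Tendsto (fun m : ℕ => A * (mass β * (m : ℝ≥0∞)⁻¹ + tail β m)) atTop (𝓝 0) := by
    have h2 : Tendsto (fun m : ℕ => mass β * (m : ℝ≥0∞)⁻¹ + tail β m) atTop (𝓝 (mass β * 0 + 0)) :=
      (ENNReal.Tendsto.const_mul ENNReal.tendsto_inv_nat_nhds_zero (Or.inr hmass)).add
        (tendsto_tail hs hβ)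
    have h3 := ENNReal.Tendsto.const_mul h2 (Or.inr hA')
    simpa using h3
  have h4 := (ENNReal.tendsto_nhds_zero.1 h1) (ENNReal.ofReal (δ / 4)) (by simpa using hδ)
  obtain ⟨m, hm, hm0⟩ := (h4.and (eventually_gt_atTop 0)).exists
  -- With `A` bounding the mean of `env`, this `η` contributes at most `δ / 2`, and `m` was chosen
  -- so that twice the truncation term contributes at most `2 * (δ / 4)`.
  refine ⟨m, hm0, δ / (2 * (A.toReal + 1)), by positivity, fun t => ?_⟩
  have h5 : ∀ ω, env β (Z ω) t * (ENNReal.ofReal (δ / (2 * (A.toReal + 1))) + 2 * rem β m (Z ω) t)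
      = env β (Z ω) t * ENNReal.ofReal (δ / (2 * (A.toReal + 1)))
        + 2 * (env β (Z ω) t * rem β m (Z ω) t) := fun ω => by ring
  simp only [h5]
  rw [lintegral_add_left ((hZ.measurable_env t).mul_const _),
    lintegral_mul_const _ (hZ.measurable_env t),
    lintegral_const_mul _ ((hZ.measurable_env t).fun_mul (hZ.measurable_rem m t))]
  have h6 : A * ENNReal.ofReal (δ / (2 * (A.toReal + 1))) ≤ ENNReal.ofReal (δ / 2) := by
    rw [← ENNReal.ofReal_toReal hA', ← ENNReal.ofReal_mul ENNReal.toReal_nonneg,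
      ENNReal.toReal_ofReal ENNReal.toReal_nonneg]
    apply ENNReal.ofReal_le_ofReal
    have : (0 : ℝ) ≤ A.toReal := ENNReal.toReal_nonneg
    rw [mul_div_assoc', div_le_div_iff₀ (by positivity) (by positivity)]
    nlinarith
  calc _ ≤ A * ENNReal.ofReal (δ / (2 * (A.toReal + 1)))
        + 2 * (A * (mass β * (m : ℝ≥0∞)⁻¹ + tail β m)) := by
        gcongr
        · exact hZ.lintegral_env t
        · exact hZ.lintegral_env_mul_rem t m
    _ ≤ ENNReal.ofReal (δ / 2) + 2 * ENNReal.ofReal (δ / 4) := by gcongr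
    _ = ENNReal.ofReal δ := by
        rw [show (2 : ℝ≥0∞) = ENNReal.ofReal 2 by simp, ← ENNReal.ofReal_mul (by norm_num),
          ← ENNReal.ofReal_add (by positivity) (by positivity)]
        congr 1; ring

/-- The contamination of the past by values before time `b` is negligible on average over
windows of growing length after `b`. -/
theorem CubicBound.negligible_cut (hM : M ≠ ∞) (hs : Summable β) (hβ : ∀ k, 0 ≤ β k)
    {b l l' : ℕ → ℕ} (hb : ∀ᶠ n in atTop, b n < l n)
    (hl : Tendsto (fun n => l' n + 1 - l n) atTop atTop) {η : ℝ} (hη : 0 < η) :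
    Negligible P fun n => {ω | ENNReal.ofReal (η * (l' n + 1 - l n : ℕ)) ≤
      ∑ t ∈ Finset.Icc (l n) (l' n), env β (Z ω) t * cut β (t - 1 - b n) (Z ω) t} := by
  set A : ℝ≥0∞ := (1 + mass β) * M with hA
  have hmass := mass_ne_top hs hβ
  have hA' : A ≠ ∞ := ENNReal.mul_ne_top (by simp [hmass]) hM
  have htop : ∀ j, tail β j ≠ ∞ := fun j => ne_top_of_le_ne_top hmass (tail_le_mass j)
  -- Only the Cesàro means of the tails must vanish; no rate of decay of the weights is required.
  have hces : Tendsto (fun m : ℕ => A.toReal * ((m : ℝ)⁻¹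
      * ∑ i ∈ Finset.range m, (tail β i).toReal)) atTop (𝓝 0) := by
    have h1 : Tendsto (fun i => (tail β i).toReal) atTop (𝓝 0) := by
      simpa [Function.comp_def] using (ENNReal.tendsto_toReal (by simp)).comp (tendsto_tail hs hβ)
    simpa using h1.cesaro.const_mul A.toReal
  refine negligible_of_lintegral_le (fun n => ?_) (hces.comp hl) ?_ ?_ hη
  · exact (Finset.measurable_sum (Finset.Icc (l n) (l' n)) fun (t : ℕ) _ =>
      (hZ.measurable_env (β := β) t).fun_mul (hZ.measurable_cut (β := β) (t - 1 - b n) t)).aemeasurable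
  · filter_upwards [hl.eventually_gt_atTop 0] with n hn
    exact_mod_cast hn
  · filter_upwards [hl.eventually_gt_atTop 0, hb] with n hn hbn
    rw [lintegral_finsetSum _ fun (t : ℕ) _ =>
      (hZ.measurable_env (t : ℤ)).fun_mul (hZ.measurable_cut _ _)]
    -- As `b n < l n`, the first contaminated lag satisfies `t - 1 - b n ≥ t - l n`, so the bound
    -- depends only on the position of `t` in the window.
    have h2 : ∀ t ∈ Finset.Icc (l n) (l' n),
        ∫⁻ ω, env β (Z ω) t * cut β (t - 1 - b n) (Z ω) t ∂P ≤ A * tail β (t - l n) := by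
      intro t ht
      refine (hZ.lintegral_env_mul_cut t _).trans ?_
      gcongr
      apply tail_anti
      have := (Finset.mem_Icc.1 ht).1
      omega
    refine (Finset.sum_le_sum h2).trans ?_
    have h3 : ∑ t ∈ Finset.Icc (l n) (l' n), A * tail β (t - l n)
        = ∑ i ∈ Finset.range (l' n + 1 - l n), A * tail β i := by
      have : Finset.Icc (l n) (l' n) = Finset.Ico (l n) (l' n + 1) := by
        ext; simp
      rw [this, Finset.sum_Ico_eq_sum_range]
      exact Finset.sum_congr rfl fun i _ => by simp
    rw [h3, ← Finset.mul_sum]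
    have hn' : (0 : ℝ) < (l' n + 1 - l n : ℕ) := by exact_mod_cast hn
    apply le_of_eq
    simp only [Function.comp]
    have h4 : A.toReal * (((l' n + 1 - l n : ℕ) : ℝ)⁻¹
        * ∑ i ∈ Finset.range (l' n + 1 - l n), (tail β i).toReal) * (l' n + 1 - l n : ℕ)
        = A.toReal * ∑ i ∈ Finset.range (l' n + 1 - l n), (tail β i).toReal := by
      field_simp
    rw [h4, ENNReal.ofReal_mul ENNReal.toReal_nonneg, ENNReal.ofReal_toReal hA',
      ENNReal.ofReal_sum_of_nonneg fun i _ => ENNReal.toReal_nonneg]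
    congr 1
    exact Finset.sum_congr rfl fun i _ => (ENNReal.ofReal_toReal (htop i)).symm

end Moments

/-! ### Path space, shifts, and observed versus stationary pasts. -/

section Paths

theorem shift_iterate (x : ℤ → ℕ) (t : ℕ) (s : ℤ) : shift^[t] x s = x (s + t) := by
  induction t generalizing x s with
  | zero => simp
  | succ t ih =>
    rw [Function.iterate_succ_apply, ih]
    simp only [shift]
    congr 1
    push_cast
    ring

theorem past_shift_iterate (x : ℤ → ℕ) (t : ℕ) : past (shift^[t] x) 0 = past x t := by
  funext k
  simp only [past, shift_iterate]
  congr 1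
  ring

theorem measurable_past (t : ℤ) : Measurable fun x : ℤ → ℕ => past x t :=
  measurable_pi_lambda _ fun k => measurable_pi_apply (t - 1 - k)

theorem measurable_past_path_pastSigma {Ω : Type*} (Y : ℤ → Ω → ℕ) (t : ℤ) :
    Measurable[pastSigma Y t] fun ω => past (path Y ω) t := by
  refine @measurable_pi_lambda _ _ _ (pastSigma Y t) _ _ fun k => ?_
  have h1 : Measurable[MeasurableSpace.comap (Y (t - 1 - k)) inferInstance] (Y (t - 1 - k)) :=
    comap_measurable _
  refine Measurable.mono h1 ?_ le_rfl
  exact le_iSup (fun s : {s : ℤ // s < t} => MeasurableSpace.comap (Y s) inferInstance)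
    ⟨t - 1 - k, by omega⟩

variable {Ω : Type*} [MeasurableSpace Ω]

theorem measurable_path {Y : ℤ → Ω → ℕ} (hY : ∀ t, Measurable (Y t)) : Measurable (path Y) :=
  measurable_pi_lambda _ hY

theorem pastSigma_le {Y : ℤ → Ω → ℕ} (hY : ∀ t, Measurable (Y t)) (t : ℤ) :
    pastSigma Y t ≤ ‹MeasurableSpace Ω› :=
  iSup_le fun s => (hY s).comap_le

/-- The laws of large numbers live on path space under the law of one regime, whereas `Z` lives on
`Ω` and dominates both; the domination passes the same moment bound to each law. -/
theorem CubicBound.map_path {P : Measure Ω} {Z : Ω → ℤ → ℝ≥0∞} {M : ℝ≥0∞} {Y : ℤ → Ω → ℕ}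
    (hZ : CubicBound P Z M) (hY : ∀ t, Measurable (Y t))
    (hYZ : ∀ ω t, (1 : ℝ≥0∞) + Y t ω ≤ Z ω t) :
    CubicBound (P.map (path Y)) (fun x t => (1 : ℝ≥0∞) + x t) M where
  measurable t := by
    have : Measurable fun x : ℤ → ℕ => ((x t : ℕ) : ℝ≥0∞) :=
      (measurable_of_countable _).comp (measurable_pi_apply t)
    exact this.const_add 1
  one_le x t := le_self_add
  bound r s t := by
    have h : ∀ t : ℤ, Measurable fun x : ℤ → ℕ => (1 : ℝ≥0∞) + ((x t : ℕ) : ℝ≥0∞) := fun t =>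
      Measurable.const_add ((measurable_of_countable _).comp (measurable_pi_apply t)) 1
    rw [lintegral_map (((h r).fun_mul (h s)).fun_mul (h t)) (measurable_path hY)]
    refine le_trans (lintegral_mono fun ω => ?_) (hZ.bound r s t)
    exact mul_le_mul' (mul_le_mul' (hYZ ω r) (hYZ ω s)) (hYZ ω t)

/-- On the window `Icc l l'` the path `x` agrees with `y`, its observed past agrees with that
of `y` back to time `b`, and both are dominated by `z`. -/
structure Tracks (x y : ℤ → ℕ) (z : ℤ → ℝ≥0∞) (b l l' : ℕ) : Prop where
  eq : ∀ t ∈ Finset.Icc l l', x t = y t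
  past_eq : ∀ t ∈ Finset.Icc l l', ∀ k, k < t - 1 - b → observedPast x t k = past y t k
  observedPast_le : ∀ t ∈ Finset.Icc l l', ∀ k : ℕ,
    (observedPast x t k : ℝ≥0∞) ≤ z ((t : ℤ) - 1 - k)
  le : ∀ t, (1 : ℝ≥0∞) + y t ≤ z t

theorem Tracks.past_le {x y : ℤ → ℕ} {z : ℤ → ℝ≥0∞} {b l l' : ℕ} (h : Tracks x y z b l l')
    (t : ℤ) (k : ℕ) : (past y t k : ℝ≥0∞) ≤ z (t - 1 - k) :=
  le_trans le_add_self (h.le _)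

/-- Lags reaching times after `b` contribute nothing. At the others both values lie between `0` and
`z`, so their difference is at most `z` rather than a sum of two bounds. -/
theorem Tracks.wdist_le {β : ℕ → ℝ} {x y : ℤ → ℕ} {z : ℤ → ℝ≥0∞} {b l l' : ℕ}
    (h : Tracks x y z b l l') (hβ : ∀ k, 0 ≤ β k) {t : ℕ} (ht : t ∈ Finset.Icc l l') :
    wdist β (observedPast x t) (past y t) ≤ cut β (t - 1 - b) z t := by
  refine wdist_le_tsum (fun k : ℕ => z (t - 1 - k)) hβ fun k => ?_
  split_ifs with hk
  · gcongr
    have h1 := h.observedPast_le t ht k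
    have h2 := h.past_le t k
    rcases le_total (observedPast x t k) (past y t k) with hle | hle
    · refine le_trans ?_ h2
      rw [abs_of_nonpos (by simpa using hle), ← ENNReal.ofReal_natCast]
      apply ENNReal.ofReal_le_ofReal
      linarith [(Nat.cast_nonneg (observedPast x t k) : (0 : ℝ) ≤ _)]
    · refine le_trans ?_ h1
      rw [abs_of_nonneg (by simpa using hle), ← ENNReal.ofReal_natCast]
      apply ENNReal.ofReal_le_ofReal
      linarith [(Nat.cast_nonneg (past y t k) : (0 : ℝ) ≤ _)]
  · rw [h.past_eq t ht k (not_le.1 hk)]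
    simp

end Paths

/-! ### The mean quasi-log-likelihood and its law of large numbers. -/

section Model

variable {d : ℕ} {Ω : Type*} [MeasurableSpace Ω]

/-- Regularity of the conditional mean function: it is continuous in the parameter on a compact
set, Lipschitz in the past, and bounded below by `c > 0`. -/
structure RegularMean (f : Param d → (ℕ → ℕ) → ℝ) (Θ : Set (Param d)) (β : ℕ → ℝ)
    (c : ℝ) : Prop where
  compact : IsCompact Θ
  measurable : ∀ θ ∈ Θ, Measurable (f θ)
  pos : 0 < c
  le : ∀ θ ∈ Θ, ∀ y, c ≤ f θ y
  cont : ∀ y, ContinuousOn (fun θ => f θ y) Θ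
  lip : ∀ θ ∈ Θ, ∀ y y', edist (f θ y) (f θ y') ≤ wdist β y y'
  nonneg : ∀ k, 0 ≤ β k
  summable : Summable β

variable {f : Param d → (ℕ → ℕ) → ℝ} {Θ : Set (Param d)} {β : ℕ → ℝ} {c : ℝ}

theorem one_le_env {z : ℤ → ℝ≥0∞} (hz : ∀ t, 1 ≤ z t) (t : ℤ) : 1 ≤ env β z t :=
  (hz t).trans le_self_add

/-- Linear growth of Lipschitz functions of the past. -/
theorem enorm_le_mul_env {E : Type*} [NormedAddCommGroup E] {F : (ℕ → ℕ) → E} {C : ℝ}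
    (hβ : ∀ k, 0 ≤ β k) (hl : ∀ y y', edist (F y) (F y') ≤ wdist β y y') (hC : 1 ≤ C)
    (h0 : ‖F 0‖ ≤ C) {y : ℕ → ℕ} {z : ℤ → ℝ≥0∞} {t : ℤ} (hz : ∀ t, 1 ≤ z t)
    (hy : ∀ k : ℕ, (y k : ℝ≥0∞) ≤ z (t - 1 - k)) :
    ‖F y‖ₑ ≤ ENNReal.ofReal C * env β z t := by
  have h1 : wdist β y 0 ≤ ∑' k : ℕ, ENNReal.ofReal (β k) * z (t - 1 - k) := by
    refine wdist_le_tsum (fun k : ℕ => z (t - 1 - k)) hβ fun k => ?_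
    gcongr
    simpa using hy k
  have h2 : ‖F 0‖ₑ ≤ ENNReal.ofReal C := by
    rw [← ofReal_norm]
    exact ENNReal.ofReal_le_ofReal h0
  have h3 : (1 : ℝ≥0∞) ≤ ENNReal.ofReal C := by simpa using hC
  calc ‖F y‖ₑ = edist (F y) 0 := (edist_zero_right _).symm
    _ ≤ edist (F y) (F 0) + edist (F 0) 0 := edist_triangle _ _ _
    _ ≤ (∑' k : ℕ, ENNReal.ofReal (β k) * z (t - 1 - k)) + ENNReal.ofReal C := by
        gcongr
        · exact (hl y 0).trans h1
        · rwa [edist_zero_right]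
    _ ≤ ENNReal.ofReal C * (∑' k : ℕ, ENNReal.ofReal (β k) * z (t - 1 - k))
        + ENNReal.ofReal C * z t := by
        gcongr
        · exact le_mul_of_one_le_left zero_le h3
        · exact le_mul_of_one_le_right zero_le (hz t)
    _ = _ := by unfold env; ring

theorem RegularMean.exists_bound (h : RegularMean f Θ β c) :
    ∃ C : ℝ, 1 ≤ C ∧ ∀ θ ∈ Θ, ‖f θ 0‖ ≤ C := by
  obtain ⟨C, hC⟩ := h.compact.exists_bound_of_continuousOn (h.cont 0)
  exact ⟨max C 1, le_max_right _ _, fun θ hθ => (hC θ hθ).trans (le_max_left _ _)⟩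

/-- The logarithm is `1 / c`-Lipschitz on `[c, ∞)`, by `log x ≤ x - 1` applied to the ratio in both
orders. -/
theorem abs_quasiLogLik_sub_le {a b c w : ℝ} (hc : 0 < c) (ha : c ≤ a) (hb : c ≤ b)
    (hw : 0 ≤ w) :
    |(w * Real.log a - a) - (w * Real.log b - b)| ≤ (w / c + 1) * |a - b| := by
  have key : ∀ {a b : ℝ}, c ≤ a → c ≤ b → Real.log a - Real.log b ≤ |a - b| / c := by
    intro a b ha hb
    have ha0 : 0 < a := hc.trans_le ha
    have hb0 : 0 < b := hc.trans_le hb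
    rw [← Real.log_div ha0.ne' hb0.ne']
    calc Real.log (a / b) ≤ a / b - 1 := Real.log_le_sub_one_of_pos (by positivity)
      _ = (a - b) / b := by field_simp
      _ ≤ |a - b| / b := by gcongr; exact le_abs_self _
      _ ≤ |a - b| / c := by gcongr
  have h1 : |Real.log a - Real.log b| ≤ |a - b| / c := by
    rw [abs_le]
    constructor
    · have := key hb ha
      rw [abs_sub_comm] at this
      linarith
    · exact key ha hb
  calc |(w * Real.log a - a) - (w * Real.log b - b)|
      = |w * (Real.log a - Real.log b) - (a - b)| := by congr 1; ring
    _ ≤ |w * (Real.log a - Real.log b)| + |a - b| := abs_sub _ _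
    _ = w * |Real.log a - Real.log b| + |a - b| := by rw [abs_mul, abs_of_nonneg hw]
    _ ≤ w * (|a - b| / c) + |a - b| := by gcongr
    _ = _ := by ring

theorem ofReal_abs_quasiLogLik_sub_le {a b c : ℝ} {w : ℕ} (hc : 0 < c) (ha : c ≤ a) (hb : c ≤ b)
    {z : ℤ → ℝ≥0∞} {t : ℤ} (hw : (1 : ℝ≥0∞) + w ≤ z t) {e : ℝ≥0∞} (he : edist a b ≤ e) :
    ENNReal.ofReal |(w * Real.log a - a) - (w * Real.log b - b)|
      ≤ ENNReal.ofReal (1 / c + 1) * (env β z t * e) := by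
  refine (ENNReal.ofReal_le_ofReal (abs_quasiLogLik_sub_le hc ha hb (Nat.cast_nonneg w))).trans ?_
  rw [ENNReal.ofReal_mul (by positivity), ← mul_assoc]
  refine mul_le_mul' ?_ (by rwa [edist_dist, Real.dist_eq] at he)
  have h1 : (w : ℝ) / c + 1 ≤ (1 / c + 1) * (1 + w) := by
    have : (0 : ℝ) ≤ 1 / c := by positivity
    have h2 : (0 : ℝ) ≤ w := Nat.cast_nonneg w
    rw [div_eq_mul_one_div (w : ℝ) c]
    nlinarith
  refine (ENNReal.ofReal_le_ofReal h1).trans ?_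
  rw [ENNReal.ofReal_mul (by positivity)]
  gcongr
  calc ENNReal.ofReal (1 + w) = 1 + w := by
        rw [ENNReal.ofReal_add (by norm_num) (by positivity)]; simp
    _ ≤ z t := hw
    _ ≤ env β z t := le_self_add

/-- The mean `E ℓ_0(θ)` of the quasi-log-likelihood under the law `ν` of the path. -/
noncomputable def meanLogLik (f : Param d → (ℕ → ℕ) → ℝ) (ν : Measure (ℤ → ℕ))
    (θ : Param d) : ℝ :=
  ∫ x, loglik f x 0 θ ∂ν

theorem loglik_shift_iterate (x : ℤ → ℕ) (t : ℕ) (θ : Param d) :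
    loglik f (shift^[t] x) 0 θ = loglik f x t θ := by
  simp only [loglik, lam, past_shift_iterate, shift_iterate, zero_add]

section Law

variable {ν : Measure (ℤ → ℕ)} {M : ℝ≥0∞}

theorem lintegral_enorm_lam_ne_top (h : RegularMean f Θ β c)
    (hν : CubicBound ν (fun x t => (1 : ℝ≥0∞) + x t) M) (hM : M ≠ ∞) {θ : Param d} (hθ : θ ∈ Θ)
    (s : ℤ) : ∫⁻ x, (1 + (x s : ℝ≥0∞)) * ‖lam f x 0 θ‖ₑ ∂ν ≠ ∞ := by
  obtain ⟨C, hC, hb⟩ := h.exists_bound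
  have hmass := mass_ne_top h.summable h.nonneg
  have h1 : ∫⁻ x, (1 + (x s : ℝ≥0∞)) * ‖lam f x 0 θ‖ₑ ∂ν
      ≤ ENNReal.ofReal C * ((1 + mass β) * M) := by
    calc _ ≤ ∫⁻ x, ENNReal.ofReal C * (env β (fun t => (1 : ℝ≥0∞) + x t) 0
            * (1 + (x s : ℝ≥0∞))) ∂ν := by
          refine lintegral_mono fun x => ?_
          rw [mul_comm, ← mul_assoc]
          gcongr
          exact enorm_le_mul_env h.nonneg (h.lip θ hθ) hC (hb θ hθ) (fun _ => le_self_add)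
            (fun k => le_add_self)
      _ ≤ _ := by
          rw [lintegral_const_mul' _ _ ENNReal.ofReal_ne_top]
          gcongr
          exact hν.lintegral_env_mul 0 s
  exact ne_top_of_le_ne_top
    (ENNReal.mul_ne_top ENNReal.ofReal_ne_top (ENNReal.mul_ne_top (by simp [hmass]) hM)) h1

theorem integrable_lam (h : RegularMean f Θ β c)
    (hν : CubicBound ν (fun x t => (1 : ℝ≥0∞) + x t) M) (hM : M ≠ ∞) {θ : Param d} (hθ : θ ∈ Θ) :
    Integrable (fun x => lam f x 0 θ) ν := by
  refine ⟨((h.measurable θ hθ).comp (measurable_past 0)).aestronglyMeasurable, ?_⟩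
  refine lt_of_le_of_lt (lintegral_mono fun x => ?_)
    (lintegral_enorm_lam_ne_top h hν hM hθ 0).lt_top
  exact le_mul_of_one_le_left zero_le le_self_add

/-- On `[c, ∞)` the logarithm lies between `log c` and `λ - 1`, so `|log λ| ≤ K λ`, and the product
is dominated by a second-order moment. -/
theorem integrable_mul_log_lam [IsFiniteMeasure ν] (h : RegularMean f Θ β c)
    (hν : CubicBound ν (fun x t => (1 : ℝ≥0∞) + x t) M) (hM : M ≠ ∞) {θ : Param d} (hθ : θ ∈ Θ) :
    Integrable (fun x => (x 0 : ℝ) * Real.log (lam f x 0 θ)) ν := by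
  have h1 : Measurable fun x => lam f x 0 θ := (h.measurable θ hθ).comp (measurable_past 0)
  have h2 : Measurable fun x : ℤ → ℕ => (x 0 : ℝ) :=
    (measurable_of_countable _).comp (measurable_pi_apply 0)
  refine ⟨(h2.mul (Real.measurable_log.comp h1)).aestronglyMeasurable, ?_⟩
  have hfin := lintegral_enorm_lam_ne_top h hν hM hθ 0
  set K : ℝ := 1 + |Real.log c| / c with hK
  have hK0 : 0 ≤ K := by have := h.pos; positivity
  refine lt_of_le_of_lt (b := ∫⁻ x, ENNReal.ofReal K * ((1 + (x 0 : ℝ≥0∞)) * ‖lam f x 0 θ‖ₑ) ∂ν)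
    (lintegral_mono fun x => ?_) ?_
  · have hl : c ≤ lam f x 0 θ := h.le θ hθ _
    have hl0 := h.pos.trans_le hl
    have hlog : |Real.log (lam f x 0 θ)| ≤ K * lam f x 0 θ := by
      have h3 : |Real.log c| ≤ |Real.log c| / c * lam f x 0 θ := by
        rw [div_mul_eq_mul_div, le_div_iff₀ h.pos]
        gcongr
      rw [abs_le]
      constructor
      · have := Real.log_le_log h.pos hl
        have := neg_abs_le (Real.log c)
        rw [hK]
        linarith
      · have := Real.log_le_sub_one_of_pos hl0
        have := abs_nonneg (Real.log c)
        rw [hK]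
        linarith
    rw [enorm_mul, ← mul_assoc, mul_comm (ENNReal.ofReal K), mul_assoc]
    refine mul_le_mul' ?_ ?_
    · rw [Real.enorm_natCast]
      exact le_add_self
    · rw [Real.enorm_eq_ofReal_abs, Real.enorm_eq_ofReal_abs, ← ENNReal.ofReal_mul hK0,
        abs_of_pos hl0]
      exact ENNReal.ofReal_le_ofReal hlog
  · rw [lintegral_const_mul' _ _ ENNReal.ofReal_ne_top]
    exact (ENNReal.mul_ne_top ENNReal.ofReal_ne_top hfin).lt_top

theorem integrable_loglik [IsFiniteMeasure ν] (h : RegularMean f Θ β c)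
    (hν : CubicBound ν (fun x t => (1 : ℝ≥0∞) + x t) M) (hM : M ≠ ∞) {θ : Param d} (hθ : θ ∈ Θ) :
    Integrable (fun x => loglik f x 0 θ) ν :=
  (integrable_mul_log_lam h hν hM hθ).sub (integrable_lam h hν hM hθ)

/-- The modulus of the conditional mean, multiplied by the Lipschitz factor of the
quasi-log-likelihood, has small mean. This feeds both the uniform law of large numbers and the
continuity of `meanLogLik`. -/
theorem exists_modulus_loglik (h : RegularMean f Θ β c)
    (hν : CubicBound ν (fun x t => (1 : ℝ≥0∞) + x t) M) (hM : M ≠ ∞) {η : ℝ} (hη : 0 < η) :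
    ∃ r > 0, ∃ R : (ℤ → ℕ) → ℝ≥0∞, AEMeasurable R ν ∧ ∫⁻ x, R x ∂ν ≤ ENNReal.ofReal η ∧
      ∀ θ ∈ Θ, ∀ θ' ∈ Θ, dist θ θ' < r →
        ∀ x, ENNReal.ofReal |loglik f x 0 θ - loglik f x 0 θ'| ≤ R x := by
  have hc0 : 0 < 1 / c + 1 := by have := h.pos; positivity
  obtain ⟨m, hm, ε, hε, hint⟩ := hν.exists_lintegral_le hM h.summable h.nonneg
    (δ := η / (1 / c + 1)) (by positivity)
  obtain ⟨r, hr, hmod⟩ := exists_modulus h.nonneg h.compact h.cont h.lip hm hε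
  refine ⟨r, hr, fun x => ENNReal.ofReal (1 / c + 1) * (env β (fun t => (1 : ℝ≥0∞) + x t) 0
    * (ENNReal.ofReal ε + 2 * rem β m (fun t => (1 : ℝ≥0∞) + x t) 0)), ?_, ?_, ?_⟩
  · exact (((hν.measurable_env 0).fun_mul
      (((hν.measurable_rem m 0).const_mul 2).const_add _)).const_mul _).aemeasurable
  · rw [lintegral_const_mul' _ _ ENNReal.ofReal_ne_top]
    refine (mul_le_mul' le_rfl (hint 0)).trans ?_
    rw [← ENNReal.ofReal_mul hc0.le]
    apply ENNReal.ofReal_le_ofReal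
    apply le_of_eq
    field_simp
  · intro θ hθ θ' hθ' hd x
    refine ofReal_abs_quasiLogLik_sub_le h.pos (h.le θ hθ _) (h.le θ' hθ' _)
      (z := fun t => (1 : ℝ≥0∞) + x t) (t := 0) le_rfl ?_
    exact hmod θ hθ θ' hθ' hd _ (fun t => (1 : ℝ≥0∞) + x t) 0 (fun k => le_add_self)

theorem continuousOn_meanLogLik [IsFiniteMeasure ν] (h : RegularMean f Θ β c)
    (hν : CubicBound ν (fun x t => (1 : ℝ≥0∞) + x t) M) (hM : M ≠ ∞) :
    ContinuousOn (meanLogLik f ν) Θ := by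
  rw [Metric.continuousOn_iff]
  intro θ hθ ε hε
  obtain ⟨r, hr, R, -, hRi, hR⟩ := exists_modulus_loglik h hν hM (η := ε / 2) (by positivity)
  refine ⟨r, hr, fun θ' hθ' hd => ?_⟩
  rw [Real.dist_eq, meanLogLik, meanLogLik, ← integral_sub (integrable_loglik h hν hM hθ')
    (integrable_loglik h hν hM hθ)]
  have h1 : ENNReal.ofReal |∫ x, (loglik f x 0 θ' - loglik f x 0 θ) ∂ν|
      ≤ ENNReal.ofReal (ε / 2) := by
    rw [← Real.enorm_eq_ofReal_abs]
    refine (enorm_integral_le_lintegral_enorm _).trans (le_trans ?_ hRi)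
    refine lintegral_mono fun x => ?_
    rw [Real.enorm_eq_ofReal_abs]
    exact hR θ' hθ' θ hθ hd x
  have := (ENNReal.ofReal_le_ofReal_iff (by positivity)).1 h1
  linarith

end Law

section Trajectory

variable {P : Measure Ω} {Y : ℤ → Ω → ℕ} {Z : Ω → ℤ → ℝ≥0∞} {M : ℝ≥0∞}

/-- Events on the path space that are negligible for the law of a process are negligible for the
process. -/
theorem Negligible.preimage_path (hY : ∀ t, Measurable (Y t)) {S : ℕ → Set (ℤ → ℕ)}
    (hS : Negligible (P.map (path Y)) S) : Negligible P fun n => path Y ⁻¹' S n :=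
  tendsto_of_tendsto_of_tendsto_of_le_of_le tendsto_const_nhds hS (fun _ => zero_le)
    fun _ => Measure.le_map_apply (measurable_path hY).aemeasurable _

/-- The uniform law of large numbers for the approximate quasi-log-likelihood on windows where the
observations follow one regime. -/
theorem negligible_logLikHat [IsProbabilityMeasure P] (h : RegularMean f Θ β c) (hY : ∀ t, Measurable (Y t))
    (herg : StationaryErgodic P Y) (hZ : CubicBound P Z M) (hM : M ≠ ∞)
    (hYZ : ∀ ω t, (1 : ℝ≥0∞) + Y t ω ≤ Z ω t) {x : ℕ → Ω → ℤ → ℕ} {b l l' : ℕ → ℕ}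
    (hb : ∀ᶠ n in atTop, b n < l n) (hl : Tendsto (fun n => l' n + 1 - l n) atTop atTop)
    (hx : ∀ᶠ n in atTop, ∀ ω, Tracks (x n ω) (path Y ω) (Z ω) (b n) (l n) (l' n))
    {η : ℝ} (hη : 0 < η) :
    Negligible P fun n => {ω | ∃ θ ∈ Θ, η * (l' n + 1 - l n : ℕ)
      < |logLikHat f (x n ω) (l n) (l' n) θ
        - (l' n + 1 - l n : ℕ) * meanLogLik f (P.map (path Y)) θ|} := by
  have hc0 : 0 < 1 / c + 1 := by have := h.pos; positivity
  have hν := hZ.map_path hY hYZ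
  have : IsProbabilityMeasure (P.map (path Y)) :=
    Measure.isProbabilityMeasure_map (measurable_path hY).aemeasurable
  -- The error splits into two halves: the ergodic fluctuation of the stationary log-likelihood, and
  -- the effect of replacing the stationary past by the observed one.
  have h1 := (negligible_sum_Icc_uniform (T := shift) herg h.compact.totallyBounded
    (fun θ hθ => integrable_loglik h hν hM hθ) (fun ε hε => exists_modulus_loglik h hν hM hε)
    hl (η := η / 2) (by positivity)).preimage_path hY
  have h2 := hZ.negligible_cut hM h.summable h.nonneg hb hl (η := η / 2 / (1 / c + 1))
    (by positivity)
  refine (h1.union h2).mono ?_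
  filter_upwards [hx] with n hxn
  rintro ω ⟨θ, hθ, hω⟩
  by_contra hcon
  simp only [mem_union, mem_preimage, mem_ofPred_eq, not_or, not_exists, not_and, not_lt,
    not_le] at hcon
  obtain ⟨hc1, hc2⟩ := hcon
  have hc1 := hc1 θ hθ
  simp only [loglik_shift_iterate] at hc1
  have htr := hxn ω
  have hd : |logLikHat f (x n ω) (l n) (l' n) θ
      - ∑ t ∈ Finset.Icc (l n) (l' n), loglik f (path Y ω) t θ| < η / 2 * (l' n + 1 - l n : ℕ) := by
    rw [logLikHat, ← Finset.sum_sub_distrib]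
    refine (Finset.abs_sum_le_sum_abs _ _).trans_lt ?_
    refine abs_sum_lt_of_ofReal_le (R := fun t : ℕ => ENNReal.ofReal (1 / c + 1)
      * (env β (Z ω) t * cut β (t - 1 - b n) (Z ω) t)) (fun t ht => ?_) ?_
    · have := htr.eq t ht
      rw [this]
      exact ofReal_abs_quasiLogLik_sub_le h.pos (h.le θ hθ _) (h.le θ hθ _) (hYZ ω t)
        ((h.lip θ hθ _ _).trans (htr.wdist_le h.nonneg ht))
    · rw [← Finset.mul_sum]
      calc _ < ENNReal.ofReal (1 / c + 1)
            * ENNReal.ofReal (η / 2 / (1 / c + 1) * (l' n + 1 - l n : ℕ)) := by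
            exact ENNReal.mul_lt_mul_right (by simpa using hc0) ENNReal.ofReal_ne_top hc2
        _ = _ := by
            rw [← ENNReal.ofReal_mul hc0.le]
            congr 1
            field_simp
  have := abs_sub_le (logLikHat f (x n ω) (l n) (l' n) θ)
    (∑ t ∈ Finset.Icc (l n) (l' n), loglik f (path Y ω) t θ)
    ((l' n + 1 - l n : ℕ) * meanLogLik f (P.map (path Y)) θ)
  simp only [meanLogLik] at this hω
  linarith

/-- The true parameter is the unique maximizer of the mean quasi-log-likelihood. -/
theorem meanLogLik_lt [IsProbabilityMeasure P] (h : RegularMean f Θ β c) {θ₀ : Param d}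
    (hOD : ClassOD P univ f θ₀ Y) (hZ : CubicBound P Z M) (hM : M ≠ ∞)
    (hYZ : ∀ ω t, (1 : ℝ≥0∞) + Y t ω ≤ Z ω t)
    (hid : ∀ θ₁ ∈ Θ, ∀ θ₂ ∈ Θ,
      (∀ᵐ ω ∂P, lam f (path Y ω) 0 θ₁ = lam f (path Y ω) 0 θ₂) → θ₁ = θ₂)
    (hθ₀ : θ₀ ∈ Θ) {θ : Param d} (hθ : θ ∈ Θ) (hne : θ ≠ θ₀) :
    meanLogLik f (P.map (path Y)) θ < meanLogLik f (P.map (path Y)) θ₀ := by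
  have hY := hOD.measurable
  have hν := hZ.map_path hY hYZ
  have : IsProbabilityMeasure (P.map (path Y)) :=
    Measure.isProbabilityMeasure_map (measurable_path hY).aemeasurable
  have hpm := (measurable_path hY)
  have hint : ∀ {F : (ℤ → ℕ) → ℝ}, Integrable F (P.map (path Y)) →
      Integrable (fun ω => F (path Y ω)) P := fun {F} hF =>
    (integrable_map_measure hF.1 hpm.aemeasurable).1 hF
  have hlamm : ∀ {θ}, θ ∈ Θ →
      StronglyMeasurable[pastSigma Y 0] fun ω => lam f (path Y ω) 0 θ := fun {θ} hθ =>
    ((h.measurable θ hθ).comp (measurable_past_path_pastSigma Y 0)).stronglyMeasurable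
  have hlogm : ∀ {θ}, θ ∈ Θ →
      StronglyMeasurable[pastSigma Y 0] fun ω => Real.log (lam f (path Y ω) 0 θ) := fun {θ} hθ =>
    (Real.measurable_log.comp
      ((h.measurable θ hθ).comp (measurable_past_path_pastSigma Y 0))).stronglyMeasurable
  have hYlog : ∀ {θ}, θ ∈ Θ → Integrable (fun ω => (Y 0 ω : ℝ) * Real.log (lam f (path Y ω) 0 θ)) P :=
    fun {θ} hθ => hint (integrable_mul_log_lam h hν hM hθ)
  have hlam : ∀ {θ}, θ ∈ Θ → Integrable (fun ω => lam f (path Y ω) 0 θ) P :=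
    fun {θ} hθ => hint (integrable_lam h hν hM hθ)
  -- `log λ(θ)` is determined by the past, so conditioning replaces `Y 0` by its conditional mean
  -- `λ(θ₀)`.
  have hcond : ∀ {θ}, θ ∈ Θ →
      P[(fun ω => (Y 0 ω : ℝ)) * (fun ω => Real.log (lam f (path Y ω) 0 θ)) | pastSigma Y 0]
        =ᵐ[P] fun ω => lam f (path Y ω) 0 θ₀ * Real.log (lam f (path Y ω) 0 θ) := by
    intro θ hθ
    refine (condExp_mul_of_stronglyMeasurable_right (hlogm hθ) (hYlog hθ)
      (hOD.integrable 0 trivial)).trans ?_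
    filter_upwards [hOD.condMean 0 trivial] with ω hω
    simp only [Pi.mul_apply]
    rw [hω]
  have hinteq : ∀ {θ}, θ ∈ Θ → ∫ ω, (Y 0 ω : ℝ) * Real.log (lam f (path Y ω) 0 θ) ∂P
      = ∫ ω, lam f (path Y ω) 0 θ₀ * Real.log (lam f (path Y ω) 0 θ) ∂P := by
    intro θ hθ
    rw [← integral_congr_ae (hcond hθ), integral_condExp (pastSigma_le hY 0)]
    rfl
  have hlamlog : ∀ {θ}, θ ∈ Θ →
      Integrable (fun ω => lam f (path Y ω) 0 θ₀ * Real.log (lam f (path Y ω) 0 θ)) P :=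
    fun {θ} hθ => integrable_condExp.congr (hcond hθ)
  have hmean : ∀ {θ}, θ ∈ Θ → meanLogLik f (P.map (path Y)) θ
      = ∫ ω, (lam f (path Y ω) 0 θ₀ * Real.log (lam f (path Y ω) 0 θ)
        - lam f (path Y ω) 0 θ) ∂P := by
    intro θ hθ
    rw [meanLogLik, integral_map hpm.aemeasurable (integrable_loglik h hν hM hθ).1,
      integral_sub (hlamlog hθ) (hlam hθ), ← hinteq hθ, ← integral_sub (hYlog hθ) (hlam hθ)]
    rfl
  by_contra hcon
  rw [not_lt] at hcon
  refine hne (hid θ hθ θ₀ hθ₀ ?_)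
  set g : Ω → ℝ := fun ω => (lam f (path Y ω) 0 θ₀ * Real.log (lam f (path Y ω) 0 θ₀)
    - lam f (path Y ω) 0 θ₀) - (lam f (path Y ω) 0 θ₀ * Real.log (lam f (path Y ω) 0 θ)
    - lam f (path Y ω) 0 θ) with hg
  have hgint : Integrable g P := ((hlamlog hθ₀).sub (hlam hθ₀)).sub ((hlamlog hθ).sub (hlam hθ))
  -- With `r = λ(θ) / λ(θ₀)` the loss is `λ(θ₀) (r - 1 - log r)`: a Poisson Kullback-Leibler
  -- divergence, nonnegative and zero only for `r = 1`. A nonpositive mean loss thus forces the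
  -- intensities to agree almost surely.
  have hgeq : ∀ ω, g ω = lam f (path Y ω) 0 θ₀ * (lam f (path Y ω) 0 θ / lam f (path Y ω) 0 θ₀ - 1
      - Real.log (lam f (path Y ω) 0 θ / lam f (path Y ω) 0 θ₀)) := by
    intro ω
    have h1 : 0 < lam f (path Y ω) 0 θ := h.pos.trans_le (h.le θ hθ _)
    have h2 : 0 < lam f (path Y ω) 0 θ₀ := h.pos.trans_le (h.le θ₀ hθ₀ _)
    rw [Real.log_div h1.ne' h2.ne', hg]
    field_simp
    ring
  have hgnn : ∀ ω, 0 ≤ g ω := by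
    intro ω
    have h1 : 0 < lam f (path Y ω) 0 θ := h.pos.trans_le (h.le θ hθ _)
    have h2 : 0 < lam f (path Y ω) 0 θ₀ := h.pos.trans_le (h.le θ₀ hθ₀ _)
    rw [hgeq]
    have := Real.log_le_sub_one_of_pos (div_pos h1 h2)
    exact mul_nonneg h2.le (by linarith)
  have hg0 : ∫ ω, g ω ∂P ≤ 0 := by
    have h0 : ∫ ω, g ω ∂P = meanLogLik f (P.map (path Y)) θ₀ - meanLogLik f (P.map (path Y)) θ := by
      rw [hmean hθ₀, hmean hθ]
      exact integral_sub ((hlamlog hθ₀).sub (hlam hθ₀)) ((hlamlog hθ).sub (hlam hθ))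
    linarith
  have hz := (integral_eq_zero_iff_of_nonneg hgnn hgint).1
    (le_antisymm hg0 (integral_nonneg hgnn))
  filter_upwards [hz] with ω hω
  have h1 : 0 < lam f (path Y ω) 0 θ := h.pos.trans_le (h.le θ hθ _)
  have h2 : 0 < lam f (path Y ω) 0 θ₀ := h.pos.trans_le (h.le θ₀ hθ₀ _)
  simp only [Pi.zero_apply] at hω
  rw [hgeq] at hω
  have h3 := (mul_eq_zero.1 hω).resolve_left h2.ne'
  by_contra hne'
  have h4 : lam f (path Y ω) 0 θ / lam f (path Y ω) 0 θ₀ ≠ 1 := by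
    rwa [Ne, div_eq_one_iff_eq h2.ne']
  have := Real.log_lt_sub_one_of_pos (div_pos h1 h2) h4
  linarith

end Trajectory

end Model

/-! ### Deterministic bounds for sandwich matrices. -/

section QuadraticForms

open Matrix

variable {d : ℕ}

/-- A lower bound for the quadratic form `J I⁻¹ J`. -/
theorem le_quadraticForm_sandwich {J I : Matrix (Fin d) (Fin d) ℝ} (hJ : Jᵀ = J) (hI : Iᵀ = I)
    (hdet : I.det ≠ 0) (hI0 : ∀ w, 0 ≤ w ⬝ᵥ I *ᵥ w) {T j : ℝ} (hT : 0 < T)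
    (hIT : ∀ w, w ⬝ᵥ I *ᵥ w ≤ T * (w ⬝ᵥ w)) (hj : 0 ≤ j)
    (hJj : ∀ w, j * (w ⬝ᵥ w) ≤ w ⬝ᵥ J *ᵥ w) (x : Fin d → ℝ) :
    j ^ 2 / T * (x ⬝ᵥ x) ≤ x ⬝ᵥ (J * I⁻¹ * J) *ᵥ x := by
  set v := J *ᵥ x with hv
  set w := I⁻¹ *ᵥ v with hw
  have hIw : I *ᵥ w = v := by
    rw [hw, mulVec_mulVec, Matrix.mul_nonsing_inv I (isUnit_iff_ne_zero.2 hdet), one_mulVec]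
  have hJx : ∀ y, x ⬝ᵥ J *ᵥ y = v ⬝ᵥ y := fun y => by
    rw [dotProduct_mulVec, ← mulVec_transpose, hJ]
  have hIy : ∀ a b, a ⬝ᵥ I *ᵥ b = (I *ᵥ a) ⬝ᵥ b := fun a b => by
    rw [dotProduct_mulVec, ← mulVec_transpose, hI]
  have heq : x ⬝ᵥ (J * I⁻¹ * J) *ᵥ x = v ⬝ᵥ w := by
    rw [← mulVec_mulVec, ← mulVec_mulVec, hJx]
  rw [heq]
  -- Expanding this square gives `v·I⁻¹v ≥ 2 T⁻¹ |v|² - T⁻² v·Iv ≥ T⁻¹ |v|²`, avoiding any spectral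
  -- decomposition.
  have h1 := hI0 (w - T⁻¹ • v)
  have h2 : (w - T⁻¹ • v) ⬝ᵥ I *ᵥ (w - T⁻¹ • v)
      = v ⬝ᵥ w - 2 * T⁻¹ * (v ⬝ᵥ v) + T⁻¹ ^ 2 * (v ⬝ᵥ I *ᵥ v) := by
    rw [mulVec_sub, mulVec_smul, hIw, sub_dotProduct, dotProduct_sub, dotProduct_sub,
      smul_dotProduct, smul_dotProduct, dotProduct_smul, dotProduct_smul, hIy w v, hIw,
      dotProduct_comm w v]
    simp only [smul_eq_mul]
    ring
  have h3 : T⁻¹ ^ 2 * (v ⬝ᵥ I *ᵥ v) ≤ T⁻¹ * (v ⬝ᵥ v) := by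
    calc T⁻¹ ^ 2 * (v ⬝ᵥ I *ᵥ v) ≤ T⁻¹ ^ 2 * (T * (v ⬝ᵥ v)) := by
          gcongr
          exact hIT v
      _ = _ := by field_simp
  have h4 : j ^ 2 * (x ⬝ᵥ x) ≤ v ⬝ᵥ v := by
    -- The same completion of the square gives `|Jx|² ≥ 2 j (x·Jx) - j² |x|² ≥ j² |x|²`.
    have h5 : 0 ≤ (v - j • x) ⬝ᵥ (v - j • x) := by
      simp only [dotProduct]
      exact Finset.sum_nonneg fun i _ => mul_self_nonneg _
    have h6 : (v - j • x) ⬝ᵥ (v - j • x) = v ⬝ᵥ v - 2 * j * (v ⬝ᵥ x) + j ^ 2 * (x ⬝ᵥ x) := by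
      rw [sub_dotProduct, dotProduct_sub, dotProduct_sub, smul_dotProduct, smul_dotProduct,
        dotProduct_smul, dotProduct_smul, dotProduct_comm x v]
      simp only [smul_eq_mul]
      ring
    have h7 := hJj x
    rw [hJx] at h7
    nlinarith
  rw [h2] at h1
  have h8 : j ^ 2 / T * (x ⬝ᵥ x) ≤ T⁻¹ * (v ⬝ᵥ v) := by
    rw [div_eq_inv_mul, mul_assoc]
    gcongr
  linarith

/-- For invertible `I` the form at `x` is that of `I` at `I⁻¹ J x`; for singular `I` the inverse is
read as `0`. This is all that is used about the window containing the change. -/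
theorem quadraticForm_sandwich_nonneg {J I : Matrix (Fin d) (Fin d) ℝ} (hJ : Jᵀ = J)
    (hI0 : ∀ w, 0 ≤ w ⬝ᵥ I *ᵥ w) (x : Fin d → ℝ) : 0 ≤ x ⬝ᵥ (J * I⁻¹ * J) *ᵥ x := by
  by_cases hdet : I.det = 0
  · rw [Matrix.nonsing_inv_apply_not_isUnit I (by simp [hdet])]
    simp
  · set v := J *ᵥ x with hv
    have hIw : I *ᵥ (I⁻¹ *ᵥ v) = v := by
      rw [mulVec_mulVec, Matrix.mul_nonsing_inv I (isUnit_iff_ne_zero.2 hdet), one_mulVec]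
    have h := hI0 (I⁻¹ *ᵥ v)
    rw [hIw, dotProduct_comm] at h
    rwa [← mulVec_mulVec, ← mulVec_mulVec, dotProduct_mulVec, ← mulVec_transpose, hJ, ← hv]

/-- The matrix `κ ∑ a_t g_t g_t'`. -/
def gram {ι : Type*} (s : Finset ι) (κ : ℝ) (a : ι → ℝ) (g : ι → Param d) :
    Matrix (Fin d) (Fin d) ℝ :=
  Matrix.of fun i j => κ * ∑ t ∈ s, a t * (g t i * g t j)

variable {ι : Type*} (s : Finset ι) (κ : ℝ) (a : ι → ℝ) (g : ι → Param d)

theorem gram_transpose : (gram s κ a g)ᵀ = gram s κ a g := by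
  ext i j
  simp only [gram, transpose_apply, of_apply]
  congr 1
  exact Finset.sum_congr rfl fun t _ => by ring

theorem quadraticForm_gram (x : Fin d → ℝ) :
    x ⬝ᵥ gram s κ a g *ᵥ x = κ * ∑ t ∈ s, a t * (x ⬝ᵥ (g t).ofLp) ^ 2 := by
  have h1 : x ⬝ᵥ gram s κ a g *ᵥ x
      = ∑ i, ∑ j, ∑ t ∈ s, κ * (a t * (x i * x j * (g t i * g t j))) := by
    simp only [gram, dotProduct, mulVec, of_apply, Finset.mul_sum, Finset.sum_mul]
    exact Finset.sum_congr rfl fun i _ => Finset.sum_congr rfl fun j _ =>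
      Finset.sum_congr rfl fun t _ => by ring
  have h2 : κ * ∑ t ∈ s, a t * (x ⬝ᵥ (g t).ofLp) ^ 2
      = ∑ t ∈ s, ∑ i, ∑ j, κ * (a t * (x i * x j * (g t i * g t j))) := by
    simp only [pow_two, dotProduct, Finset.sum_mul_sum]
    simp only [Finset.mul_sum]
    exact Finset.sum_congr rfl fun t _ => Finset.sum_congr rfl fun i _ =>
      Finset.sum_congr rfl fun j _ => by ring
  rw [h1, h2, Finset.sum_comm (s := s)]
  refine Finset.sum_congr rfl fun i _ => ?_
  rw [Finset.sum_comm (s := s)]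

theorem quadraticForm_gram_nonneg (hκ : 0 ≤ κ) (ha : ∀ t ∈ s, 0 ≤ a t) (x : Fin d → ℝ) :
    0 ≤ x ⬝ᵥ gram s κ a g *ᵥ x := by
  rw [quadraticForm_gram]
  exact mul_nonneg hκ (Finset.sum_nonneg fun t ht => mul_nonneg (ha t ht) (sq_nonneg _))

variable (f : Param d → (ℕ → ℕ) → ℝ) (Θ : Set (Param d)) (x : ℤ → ℕ) (l l' : ℕ) (η : Param d)

theorem JHat_eq_gram : JHat f Θ x l l' η = gram (Finset.Icc l l') (1 / ((l' : ℝ) - l + 1))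
    (fun t => 1 / lamHat f x t η) (fun t => gradientWithin (lamHat f x t) Θ η) := rfl

theorem IHat_eq_gram : IHat f Θ x l l' η = gram (Finset.Icc l l') (1 / ((l' : ℝ) - l + 1))
    (fun t => ((x t : ℝ) / lamHat f x t η - 1) ^ 2)
    (fun t => gradientWithin (lamHat f x t) Θ η) := rfl

theorem quadraticForm_sandwichHat_nonneg {f : Param d → (ℕ → ℕ) → ℝ} {Θ : Set (Param d)} {x : ℤ → ℕ}
    {l l' : ℕ} {η : Param d} (hl : l ≤ l' + 1) (w : Fin d → ℝ) :
    0 ≤ w ⬝ᵥ sandwich f Θ x l l' η *ᵥ w := by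
  have hκ : (0 : ℝ) ≤ 1 / ((l' : ℝ) - l + 1) := by
    have : (l : ℝ) ≤ l' + 1 := by exact_mod_cast hl
    apply one_div_nonneg.2
    linarith
  refine quadraticForm_sandwich_nonneg ?_ ?_ w
  · rw [JHat_eq_gram, gram_transpose]
  · intro v
    rw [IHat_eq_gram]
    exact quadraticForm_gram_nonneg _ _ _ _ hκ (fun t _ => sq_nonneg _) v

/-- A deterministic lower bound for the quadratic form of the sandwich matrix on the first
`m` observations. -/
theorem le_quadraticForm_sandwich_Icc {f : Param d → (ℕ → ℕ) → ℝ} {Θ : Set (Param d)} {x : ℤ → ℕ}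
    {m : ℕ} {η : Param d} (hm : 0 < m) (hpos : ∀ y, 0 < f η y) {κ K : ℝ} (hκ : 0 < κ) (hK : 0 < K)
    (hJ : ∀ w : Param d, ‖w‖ = 1 →
      κ * m ≤ ∑ t ∈ Finset.Icc 1 m, |inner ℝ w (gradientWithin (lamHat f x t) Θ η)|)
    (hI : ∀ w : Param d, ‖w‖ = 1 →
      κ * m ≤ ∑ t ∈ Finset.Icc 1 m,
        |inner ℝ w (((x t : ℝ) - lamHat f x t η) • gradientWithin (lamHat f x t) Θ η)|)
    (hlam : ∑ t ∈ Finset.Icc 1 m, lamHat f x t η ≤ K * m)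
    (hgrad : ∑ t ∈ Finset.Icc 1 m,
      |(x t : ℝ) / lamHat f x t η - 1| * ‖gradientWithin (lamHat f x t) Θ η‖ ≤ K * m)
    (v : Param d) :
    (κ / K) ^ 4 / m * ‖v‖ ^ 2 ≤ v.ofLp ⬝ᵥ sandwich f Θ x 1 m η *ᵥ v.ofLp := by
  set s := Finset.Icc 1 m with hs
  set g : ℕ → Param d := fun t => gradientWithin (lamHat f x t) Θ η with hg
  set L : ℕ → ℝ := fun t => lamHat f x t η with hL
  have hLpos : ∀ t, 0 < L t := fun t => hpos _
  have hm' : (0 : ℝ) < m := by exact_mod_cast hm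
  have hcoef : (1 : ℝ) / ((m : ℝ) - (1 : ℕ) + 1) = 1 / m := by push_cast; ring
  have hdot : ∀ w z : Param d, w.ofLp ⬝ᵥ z.ofLp = inner ℝ w z := fun w z => by
    rw [EuclideanSpace.inner_eq_star_dotProduct, dotProduct_comm]
    rfl
  have hnsq : ∀ w : Param d, w.ofLp ⬝ᵥ w.ofLp = ‖w‖ ^ 2 := fun w => by
    rw [hdot, real_inner_self_eq_norm_sq]
  have hscale : ∀ G : ℕ → Param d,
      (∀ w : Param d, ‖w‖ = 1 → κ * m ≤ ∑ t ∈ s, |inner ℝ w (G t)|) →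
      ∀ w : Param d, κ * m * ‖w‖ ≤ ∑ t ∈ s, |inner ℝ w (G t)| := by
    intro G hG w
    rcases eq_or_ne w 0 with rfl | hw
    · simp
    · have hn : 0 < ‖w‖ := norm_pos_iff.2 hw
      have := hG (‖w‖⁻¹ • w) (by rw [norm_smul, norm_inv, norm_norm, inv_mul_cancel₀ hn.ne'])
      simp only [inner_smul_left, abs_mul, ← Finset.mul_sum] at this
      rw [show |(starRingEnd ℝ) ‖w‖⁻¹| = ‖w‖⁻¹ by simp, ← div_eq_inv_mul, le_div_iff₀ hn] at this
      exact this
  have hJquad : ∀ w : Param d, κ ^ 2 / K * ‖w‖ ^ 2 ≤ w.ofLp ⬝ᵥ JHat f Θ x 1 m η *ᵥ w.ofLp := by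
    intro w
    rw [JHat_eq_gram, quadraticForm_gram, hcoef]
    simp only [hdot]
    have h1 := hscale g hJ w
    have hsum : 0 ≤ ∑ t ∈ s, |inner ℝ w (g t)| := Finset.sum_nonneg fun _ _ => abs_nonneg _
    have hne : 0 < ∑ t ∈ s, L t := Finset.sum_pos (fun t _ => hLpos t) ⟨1, by simp [hs]; omega⟩
    -- Cauchy-Schwarz in Engel form turns the lower bound on a first-order average into one on the
    -- quadratic form of `Ĵ`.
    have h2 : (∑ t ∈ s, |inner ℝ w (g t)|) ^ 2 / ∑ t ∈ s, L t
        ≤ ∑ t ∈ s, |inner ℝ w (g t)| ^ 2 / L t :=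
      Finset.sq_sum_div_le_sum_sq_div _ _ (fun t _ => hLpos t)
    have h3 : ∑ t ∈ s, |inner ℝ w (g t)| ^ 2 / L t = ∑ t ∈ s, 1 / L t * (inner ℝ w (g t)) ^ 2 :=
      Finset.sum_congr rfl fun t _ => by rw [sq_abs]; ring
    have h4 : (κ * m * ‖w‖) ^ 2 / (K * m) ≤ (∑ t ∈ s, |inner ℝ w (g t)|) ^ 2 / ∑ t ∈ s, L t := by
      gcongr
    have h5 : κ ^ 2 / K * ‖w‖ ^ 2 = 1 / m * ((κ * m * ‖w‖) ^ 2 / (K * m)) := by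
      field_simp
    rw [h5]
    refine mul_le_mul_of_nonneg_left ?_ (by positivity)
    rw [← h3]
    exact h4.trans h2
  have hIquad : ∀ w : Param d, w.ofLp ⬝ᵥ IHat f Θ x 1 m η *ᵥ w.ofLp ≤ K ^ 2 * m * ‖w‖ ^ 2 := by
    intro w
    rw [IHat_eq_gram, quadraticForm_gram, hcoef]
    simp only [hdot]
    -- A sum of squares is bounded by the square of the sum. This crude step introduces the factor
    -- `m` into the bound on `Î`, but requires no fourth moments.
    have h1 : ∑ t ∈ s, ((x t : ℝ) / L t - 1) ^ 2 * (inner ℝ w (g t)) ^ 2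
        ≤ (∑ t ∈ s, |(x t : ℝ) / L t - 1| * ‖g t‖) ^ 2 * ‖w‖ ^ 2 := by
      have h2 : ∀ t ∈ s, ((x t : ℝ) / L t - 1) ^ 2 * (inner ℝ w (g t)) ^ 2
          ≤ (|(x t : ℝ) / L t - 1| * ‖g t‖) ^ 2 * ‖w‖ ^ 2 := by
        intro t _
        rw [mul_pow, sq_abs, mul_assoc, ← mul_pow ‖g t‖]
        refine mul_le_mul_of_nonneg_left ?_ (sq_nonneg _)
        rw [sq_le_sq, abs_of_nonneg (by positivity : 0 ≤ ‖g t‖ * ‖w‖), mul_comm]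
        exact abs_real_inner_le_norm _ _
      refine (Finset.sum_le_sum h2).trans ?_
      rw [← Finset.sum_mul]
      gcongr
      exact Finset.sum_sq_le_sq_sum_of_nonneg fun t _ => by positivity
    calc _ ≤ 1 / (m : ℝ) * ((∑ t ∈ s, |(x t : ℝ) / L t - 1| * ‖g t‖) ^ 2 * ‖w‖ ^ 2) := by
          gcongr
      _ ≤ 1 / (m : ℝ) * ((K * m) ^ 2 * ‖w‖ ^ 2) := by
          gcongr
      _ = _ := by field_simp
  -- A kernel vector of `Î` would be orthogonal to every score vector `(x t - L t) • g t`,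
  -- contradicting `hI`. Invertibility matters because the convention for singular matrices would
  -- otherwise make the sandwich zero.
  have hdet : (IHat f Θ x 1 m η).det ≠ 0 := by
    intro h0
    obtain ⟨w, hw, hw0⟩ := Matrix.exists_mulVec_eq_zero_iff.2 h0
    set W : Param d := WithLp.toLp 2 w with hW
    have hWne : 0 < ‖W‖ := by
      rw [norm_pos_iff]
      intro h
      apply hw
      have := congrArg WithLp.ofLp h
      simpa [hW] using this
    have h1 : W.ofLp ⬝ᵥ IHat f Θ x 1 m η *ᵥ W.ofLp = 0 := by
      change w ⬝ᵥ IHat f Θ x 1 m η *ᵥ w = 0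
      rw [hw0, dotProduct_zero]
    rw [IHat_eq_gram, quadraticForm_gram, hcoef] at h1
    simp only [hdot] at h1
    have h2 := (mul_eq_zero.1 h1).resolve_left (by positivity)
    rw [Finset.sum_eq_zero_iff_of_nonneg fun t _ => by positivity] at h2
    have h3 : ∑ t ∈ s, |inner ℝ W (((x t : ℝ) - L t) • g t)| = 0 := by
      refine Finset.sum_eq_zero fun t ht => ?_
      have h4 := h2 t ht
      rw [abs_eq_zero, inner_smul_right]
      rcases mul_eq_zero.1 h4 with h5 | h5
      · have h6 : (x t : ℝ) / L t - 1 = 0 := by simpa using h5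
        have h7 : (x t : ℝ) = L t := by
          have := sub_eq_zero.1 h6
          rwa [div_eq_one_iff_eq (hLpos t).ne'] at this
        rw [h7]; simp
      · have h6 : inner ℝ W (g t) = 0 := pow_eq_zero_iff (two_ne_zero) |>.1 h5
        rw [h6, mul_zero]
    have h5 := hscale _ hI W
    rw [h3] at h5
    have : 0 < κ * m * ‖W‖ := by positivity
    linarith
  have hto : ∀ w : Fin d → ℝ, w = (WithLp.toLp 2 w : Param d).ofLp := fun w => rfl
  -- With `T = K² m` and `j = κ² / K`, the constant `j² / T` is `(κ / K)⁴ / m`.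
  have key := le_quadraticForm_sandwich (J := JHat f Θ x 1 m η) (I := IHat f Θ x 1 m η)
    (by rw [JHat_eq_gram, gram_transpose]) (by rw [IHat_eq_gram, gram_transpose]) hdet
    (fun w => by
      rw [IHat_eq_gram]
      exact quadraticForm_gram_nonneg _ _ _ _ (by rw [hcoef]; positivity)
        (fun t _ => sq_nonneg _) w)
    (T := K ^ 2 * m) (by positivity)
    (fun w => by rw [hto w, hnsq]; exact hIquad _) (j := κ ^ 2 / K) (by positivity)
    (fun w => by rw [hto w, hnsq]; exact hJquad _) v.ofLp
  rw [hnsq] at key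
  refine le_trans (le_of_eq ?_) key
  field_simp

end QuadraticForms

/-! ### Maximizers of uniformly approximated functions. -/

section Argmax

variable {Ω ι : Type*} [MeasurableSpace Ω] [TopologicalSpace ι] {P : Measure Ω}

/-- Maximizers of random functions that are uniformly close to `s n • D` avoid every compact set
on which `D` is smaller than somewhere else. -/
theorem negligible_argmax_mem {Θ A : Set ι} (hA : IsCompact A) (hAΘ : A ⊆ Θ) {D : ι → ℝ}
    (hD : ContinuousOn D A) {θ' : ι} (hθ' : θ' ∈ Θ) (hlt : ∀ θ ∈ A, D θ < D θ')
    {S : ℕ → Ω → ι → ℝ} {s : ℕ → ℝ} (hs : ∀ᶠ n in atTop, 0 < s n)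
    (hS : ∀ η : ℝ, 0 < η →
      Negligible P fun n => {ω | ∃ θ ∈ Θ, η * s n < |S n ω θ - s n * D θ|})
    {e : ℕ → Ω → ι} (he : ∀ᶠ n in atTop, ∀ ω, S n ω θ' ≤ S n ω (e n ω)) :
    Negligible P fun n => {ω | e n ω ∈ A} := by
  obtain ⟨a, ha, hle⟩ := hA.exists_forall_le' (f := fun θ => D θ' - D θ)
    (continuousOn_const.sub hD) (a := 0) (fun θ hθ => sub_pos.2 (hlt θ hθ))
  -- The gap `a` of `D` on `A` cannot be bridged by two approximation errors of `a / 3`, one at `θ'`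
  -- and one at the maximizer.
  refine (hS (a / 3) (by positivity)).mono ?_
  filter_upwards [hs, he] with n hn hen ω hω
  by_contra hcon
  simp only [mem_ofPred_eq, not_exists, not_and, not_lt] at hcon hω
  have h1 := abs_le.1 (hcon θ' hθ')
  have h2 := abs_le.1 (hcon _ (hAΘ hω))
  have h3 := hle _ hω
  have h4 := hen ω
  have h5 : s n * a ≤ s n * (D θ' - D (e n ω)) := by gcongr
  have h6 : 0 < s n * a := by positivity
  nlinarith

end Argmax

/-! ### Regularity of the gradient in the parameter. -/

section Gradient

variable {d : ℕ}

/-- The gradient in the parameter of the conditional mean function. -/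
noncomputable def pastGrad (f : Param d → (ℕ → ℕ) → ℝ) (Θ : Set (Param d)) (θ : Param d)
    (y : ℕ → ℕ) : Param d :=
  gradientWithin (fun η => f η y) Θ θ

/-- Regularity of the gradient of the conditional mean function on a ball around `θ₀`. -/
structure RegularGradient (f : Param d → (ℕ → ℕ) → ℝ) (Θ : Set (Param d)) (β : ℕ → ℝ)
    (θ₀ : Param d) (r₀ : ℝ) : Prop where
  pos : 0 < r₀
  subset : Metric.closedBall θ₀ r₀ ⊆ Θ
  measurable : Measurable (pastGrad f Θ θ₀)
  cont : ∀ y, ContinuousOn (fun θ => pastGrad f Θ θ y) (Metric.closedBall θ₀ r₀)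
  lip : ∀ θ ∈ Metric.closedBall θ₀ r₀, ∀ y y',
    edist (pastGrad f Θ θ y) (pastGrad f Θ θ y') ≤ wdist β y y'

/-- A directional derivative is a pointwise limit of difference quotients; the index is shifted by
`N` so that every evaluation point lies where `F` is measurable. -/
theorem measurable_of_hasFDerivAt {X : Type*} [MeasurableSpace X] {F : Param d → X → ℝ}
    {F' : X → Param d →L[ℝ] ℝ} {θ : Param d} (hF : ∀ x, HasFDerivAt (fun η => F η x) (F' x) θ)
    (hm : ∀ᶠ η in 𝓝 θ, Measurable (F η)) (v : Param d) : Measurable fun x => F' x v := by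
  have hu : Tendsto (fun n : ℕ => 1 / ((n : ℝ) + 1)) atTop (𝓝[>] 0) := by
    refine tendsto_nhdsWithin_iff.2 ⟨tendsto_one_div_add_atTop_nhds_zero_nat, ?_⟩
    exact Eventually.of_forall fun n => mem_Ioi.2 Nat.one_div_pos_of_nat
  have hpt : Tendsto (fun n : ℕ => θ + (1 / ((n : ℝ) + 1)) • v) atTop (𝓝 θ) := by
    have h0 : Tendsto (fun n : ℕ => 1 / ((n : ℝ) + 1)) atTop (𝓝 0) :=
      tendsto_one_div_add_atTop_nhds_zero_nat
    simpa using tendsto_const_nhds.add (h0.smul_const v)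
  obtain ⟨N, hN⟩ := eventually_atTop.1 (hpt.eventually hm)
  refine measurable_of_tendsto_metrizable
    (f := fun (n : ℕ) x => (1 / (((n + N : ℕ) : ℝ) + 1))⁻¹ •
      (F (θ + (1 / (((n + N : ℕ) : ℝ) + 1)) • v) x - F θ x)) (fun n => ?_) ?_
  · exact ((hN (n + N) (Nat.le_add_left _ _)).fun_sub hm.self_of_nhds).const_smul
      ((1 / (((n + N : ℕ) : ℝ) + 1))⁻¹)
  · rw [tendsto_pi_nhds]
    intro x
    have h1 := ((hF x).hasLineDerivAt v).tendsto_slope_zero_right.comp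
      (hu.comp (tendsto_add_atTop_nat N))
    simpa [Function.comp_def] using h1

theorem LipschitzCondition.exists_regularGradient {f : Param d → (ℕ → ℕ) → ℝ} {Θ : Set (Param d)}
    {α β : ℕ → ℝ} (hA : LipschitzCondition f Θ 1 α) (hle : ∀ k, α k ≤ β k)
    (hm : ∀ θ ∈ Θ, Measurable (f θ)) {θ₀ : Param d} (hθ₀ : θ₀ ∈ interior Θ) :
    ∃ r₀, RegularGradient f Θ β θ₀ r₀ := by
  obtain ⟨r₀, hr₀, hball⟩ := Metric.nhds_basis_closedBall.mem_iff.1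
    (isOpen_interior.mem_nhds hθ₀)
  have hnhds : ∀ θ ∈ interior Θ, Θ ∈ 𝓝 θ := fun θ hθ => mem_interior_iff_mem_nhds.1 hθ
  have hC : ∀ y, ContDiffOn ℝ 1 (fun θ => f θ y) Θ := fun y => by simpa using hA.contDiffOn y
  have hfd : ∀ y, ∀ θ ∈ interior Θ,
      HasFDerivAt (fun η => f η y) (fderivWithin ℝ (fun η => f η y) Θ θ) θ := fun y θ hθ => by
    have h1 : DifferentiableAt ℝ (fun η => f η y) θ :=
      ((hC y).contDiffAt (hnhds θ hθ)).differentiableAt (by norm_num)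
    rw [fderivWithin_of_mem_nhds (hnhds θ hθ)]
    exact h1.hasFDerivAt
  refine ⟨r₀, hr₀, hball.trans interior_subset, ?_, ?_, ?_⟩
  · have hcoord : ∀ i, Measurable fun y => pastGrad f Θ θ₀ y i := by
      intro i
      have h1 := measurable_of_hasFDerivAt (F := f) (fun y => hfd y θ₀ hθ₀)
        (by filter_upwards [hnhds θ₀ hθ₀] with η hη using hm η hη)
        (EuclideanSpace.single i (1 : ℝ))
      refine (congrArg Measurable (funext fun y => ?_)).mp h1
      rw [← inner_gradientWithin_left, EuclideanSpace.inner_single_right]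
      simp [pastGrad]
    have : pastGrad f Θ θ₀ = fun y => WithLp.toLp 2 fun i => pastGrad f Θ θ₀ y i := rfl
    rw [this]
    exact (WithLp.measurable_toLp 2 _).comp (measurable_pi_lambda _ hcoord)
  · intro y
    have h1 : ContinuousOn (fun θ => fderivWithin ℝ (fun η => f η y) Θ θ) (interior Θ) := by
      have h2 := ((hC y).mono interior_subset).continuousOn_fderiv_of_isOpen isOpen_interior
        (by norm_num)
      refine h2.congr fun θ hθ => ?_
      exact fderivWithin_of_mem_nhds (hnhds θ hθ)
    exact (LinearIsometryEquiv.continuous _).comp_continuousOn (h1.mono hball)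
  · intro θ hθ y y'
    have hu : UniqueDiffWithinAt ℝ Θ θ := uniqueDiffWithinAt_of_mem_nhds (hnhds θ (hball hθ))
    have h1 := (hA.lipschitz y y' θ (hball.trans interior_subset hθ)).trans
      (wdist_le_of_le hle y y')
    refine le_trans ?_ h1
    unfold pastGrad gradientWithin
    -- The Riesz isometry converts gradients to linear forms, whose norms are then compared with
    -- those of the one-linear iterated derivatives.
    rw [LinearIsometryEquiv.edist_map, edist_dist, dist_eq_norm]
    apply ENNReal.ofReal_le_ofReal
    refine ContinuousLinearMap.opNorm_le_bound _ (norm_nonneg _) fun v => ?_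
    have h2 := (iteratedFDerivWithin ℝ 1 (fun θ' => f θ' y) Θ θ
      - iteratedFDerivWithin ℝ 1 (fun θ' => f θ' y') Θ θ).le_opNorm (fun _ => v)
    simpa [iteratedFDerivWithin_one_apply hu] using h2

end Gradient

/-! ### Lower bounds for averages of linear forms, uniform near the true parameter. -/

section LowerBound

variable {d : ℕ} {Ω : Type*} [MeasurableSpace Ω] {P : Measure Ω}

/-- The probability that some parameter near `θ₀` is bad can be made eventually small by
shrinking the neighbourhood of `θ₀`. -/
def LocallyNegligible (P : Measure Ω) (θ₀ : Param d) (bad : ℕ → Ω → Param d → Prop) : Prop :=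
  ∀ δ : ℝ, 0 < δ → ∃ ρ > 0, ∀ᶠ n in atTop,
    P {ω | ∃ θ, dist θ θ₀ < ρ ∧ bad n ω θ} ≤ ENNReal.ofReal δ

/-- Quantifying over all nearby `θ` inside the event makes it applicable to a random, possibly
nonmeasurable, consistent estimate. -/
theorem LocallyNegligible.negligible {θ₀ : Param d} {bad : ℕ → Ω → Param d → Prop}
    (h : LocallyNegligible P θ₀ bad) {e : ℕ → Ω → Param d}
    (he : ∀ ρ : ℝ, 0 < ρ → Negligible P fun n => {ω | ρ ≤ dist (e n ω) θ₀}) :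
    Negligible P fun n => {ω | bad n ω (e n ω)} := by
  rw [negligible_iff]
  intro δ hδ
  obtain ⟨ρ, hρ, h1⟩ := h (δ / 2) (by positivity)
  filter_upwards [h1, negligible_iff.1 (he ρ hρ) (δ / 2) (by positivity)] with n hn1 hn2
  calc P {ω | bad n ω (e n ω)}
      ≤ P ({ω | ∃ θ, dist θ θ₀ < ρ ∧ bad n ω θ} ∪ {ω | ρ ≤ dist (e n ω) θ₀}) := by
        refine measure_mono fun ω hω => ?_
        rcases lt_or_ge (dist (e n ω) θ₀) ρ with hlt | hge
        · exact Or.inl ⟨_, hlt, hω⟩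
        · exact Or.inr hge
    _ ≤ ENNReal.ofReal (δ / 2) + ENNReal.ofReal (δ / 2) :=
        (measure_union_le _ _).trans (add_le_add hn1 hn2)
    _ = ENNReal.ofReal δ := by
        rw [← ENNReal.ofReal_add (by positivity) (by positivity)]; congr 1; ring

variable {Y : ℤ → Ω → ℕ} {Z : Ω → ℤ → ℝ≥0∞} {M : ℝ≥0∞} {β : ℕ → ℝ}

theorem measure_sum_ge_le {W : ℕ → Ω → ℝ≥0∞} (hW : ∀ t, Measurable (W t)) {a : ℝ}
    (ha : ∀ t, ∫⁻ ω, W t ω ∂P ≤ ENNReal.ofReal a) {l l' : ℕ} (hl : l ≤ l') {K : ℝ} (hK : 0 < K) :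
    P {ω | ENNReal.ofReal (K * (l' + 1 - l : ℕ)) ≤ ∑ t ∈ Finset.Icc l l', W t ω}
      ≤ ENNReal.ofReal (a / K) := by
  have hm : (0 : ℝ) < (l' + 1 - l : ℕ) := by
    have : 0 < l' + 1 - l := by omega
    exact_mod_cast this
  have hpos : 0 < K * (l' + 1 - l : ℕ) := by positivity
  refine (meas_ge_le_lintegral_div (Finset.measurable_sum _ fun t _ => hW t).aemeasurable
    (by simpa using hpos) ENNReal.ofReal_ne_top).trans ?_
  rw [lintegral_finsetSum _ fun t _ => hW t]
  have h1 : ∑ t ∈ Finset.Icc l l', ∫⁻ ω, W t ω ∂P ≤ ENNReal.ofReal ((l' + 1 - l : ℕ) * a) := by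
    rw [ENNReal.ofReal_mul hm.le, ENNReal.ofReal_natCast]
    refine (Finset.sum_le_sum fun t _ => ha t).trans_eq ?_
    rw [Finset.sum_const, Nat.card_Icc, nsmul_eq_mul]
  refine (ENNReal.div_le_div_right h1 _).trans ?_
  rw [← ENNReal.ofReal_div_of_pos hpos]
  apply ENNReal.ofReal_le_ofReal
  apply le_of_eq
  field_simp

/-- If the stationary vectors `Φ` are not concentrated on a hyperplane, then the averages of
`|⟪w, Φ̂_t(θ)⟫|` are bounded below, uniformly in unit vectors `w` and in `θ` near `θ₀`. -/
theorem exists_locallyNegligible_sum_abs_inner_lt [IsProbabilityMeasure P]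
    (hs : Summable β) (hβ : ∀ k, 0 ≤ β k) (hY : ∀ t, Measurable (Y t))
    (herg : StationaryErgodic P Y) (hZ : CubicBound P Z M) (hM : M ≠ ∞) {b l l' : ℕ → ℕ}
    (hb : ∀ᶠ n in atTop, b n < l n) (hl : Tendsto (fun n => l' n + 1 - l n) atTop atTop)
    {Φ : (ℤ → ℕ) → Param d} (hΦ : Integrable Φ (P.map (path Y)))
    (hΦ0 : ∀ w, (∀ᵐ x ∂(P.map (path Y)), inner ℝ w (Φ x) = 0) → w = 0)
    {Φh : ℕ → Ω → ℕ → Param d → Param d} {θ₀ : Param d} {C : ℝ} (hC : 0 < C)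
    (herr : ∀ m : ℕ, 0 < m → ∀ η : ℝ, 0 < η → ∃ ρ > 0, ∀ᶠ n in atTop, ∀ ω θ, dist θ θ₀ < ρ →
      ∀ t ∈ Finset.Icc (l n) (l' n), edist (Φh n ω t θ) (Φ (shift^[t] (path Y ω)))
        ≤ ENNReal.ofReal C * (env β (Z ω) t * (ENNReal.ofReal η + 2 * rem β m (Z ω) t))
          + ENNReal.ofReal C * (env β (Z ω) t * cut β (t - 1 - b n) (Z ω) t)) :
    ∃ κ > 0, LocallyNegligible P θ₀ fun n ω θ => ∃ w : Param d, ‖w‖ = 1 ∧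
      ∑ t ∈ Finset.Icc (l n) (l' n), |inner ℝ w (Φh n ω t θ)| < κ * (l' n + 1 - l n : ℕ) := by
  set ν := P.map (path Y) with hν
  have : IsProbabilityMeasure ν :=
    Measure.isProbabilityMeasure_map (measurable_path hY).aemeasurable
  set φ : Param d → (ℤ → ℕ) → ℝ := fun w x => |inner ℝ w (Φ x)| with hφ
  have hφint : ∀ w, Integrable (φ w) ν := fun w => (hΦ.const_inner w).abs
  have hφdiff : ∀ w w' x, |φ w x - φ w' x| ≤ ‖w - w'‖ * ‖Φ x‖ := fun w w' x => by
    refine (abs_abs_sub_abs_le _ _).trans ?_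
    rw [← inner_sub_left]
    exact abs_real_inner_le_norm _ _
  have hcont : Continuous fun w => ∫ x, φ w x ∂ν := by
    refine LipschitzWith.continuous (K := (∫ x, ‖Φ x‖ ∂ν).toNNReal)
      (LipschitzWith.of_dist_le_mul fun w w' => ?_)
    rw [Real.dist_eq, ← integral_sub (hφint w) (hφint w'),
      Real.coe_toNNReal _ (integral_nonneg fun _ => norm_nonneg _), dist_eq_norm, mul_comm,
      ← integral_const_mul]
    refine (abs_integral_le_integral_abs).trans ?_
    exact integral_mono ((hφint w).sub (hφint w')).abs (hΦ.norm.const_mul _) (hφdiff w w')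
  have hpos : ∀ w ∈ Metric.sphere (0 : Param d) 1, 0 < ∫ x, φ w x ∂ν := by
    intro w hw
    refine lt_of_le_of_ne (integral_nonneg fun _ => abs_nonneg _) fun h0 => ?_
    have h1 := (integral_eq_zero_iff_of_nonneg (fun _ => abs_nonneg _) (hφint w)).1 h0.symm
    have h2 : w = 0 := hΦ0 w (by filter_upwards [h1] with x hx using abs_eq_zero.1 hx)
    simp [h2] at hw
  -- Nondegeneracy makes `E |⟪w, Φ⟫|` positive for each unit vector; continuity and compactness of
  -- the sphere give a common lower bound.
  obtain ⟨κ₀, hκ₀, hmin⟩ := (isCompact_sphere (0 : Param d) 1).exists_forall_le'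
    hcont.continuousOn hpos
  have hLLN := (negligible_sum_Icc_uniform (T := shift) (φ := φ) herg
    (isCompact_sphere (0 : Param d) 1).totallyBounded (fun w _ => hφint w) (fun η hη => by
      have hfin : ∫⁻ x, ‖Φ x‖ₑ ∂ν ≠ ∞ := hΦ.2.ne
      set I := (∫⁻ x, ‖Φ x‖ₑ ∂ν).toReal with hI
      have hI0 : 0 ≤ I := ENNReal.toReal_nonneg
      refine ⟨η / (I + 1), by positivity,
        fun x => ENNReal.ofReal (η / (I + 1)) * ‖Φ x‖ₑ, hΦ.1.enorm.const_mul _, ?_, ?_⟩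
      · rw [lintegral_const_mul' _ _ ENNReal.ofReal_ne_top, ← ENNReal.ofReal_toReal hfin, ← hI,
          ← ENNReal.ofReal_mul (by positivity)]
        apply ENNReal.ofReal_le_ofReal
        rw [div_mul_eq_mul_div, div_le_iff₀ (by positivity)]
        nlinarith
      · intro w _ w' _ hd x
        change _ ≤ ENNReal.ofReal (η / (I + 1)) * ‖Φ x‖ₑ
        rw [← ofReal_norm, ← ENNReal.ofReal_mul (by positivity)]
        apply ENNReal.ofReal_le_ofReal
        refine (hφdiff w w' x).trans ?_
        gcongr
        rw [← dist_eq_norm]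
        exact hd.le) hl (η := κ₀ / 4) (by positivity)).preimage_path hY
  have hcut := hZ.negligible_cut hM hs hβ hb hl (η := κ₀ / 8 / C) (by positivity)
  -- Of the mean `κ₀`, the ergodic fluctuation may consume `κ₀ / 4`, the change of parameter `κ₀ /
  -- 8` and the contaminated past `κ₀ / 8`.
  refine ⟨κ₀ / 2, by positivity, fun δ hδ => ?_⟩
  obtain ⟨m, hm, η, hη, hint⟩ := hZ.exists_lintegral_le hM hs hβ
    (δ := κ₀ / 8 / C * (δ / 2)) (by positivity)
  obtain ⟨ρ, hρ, herr⟩ := herr m hm η hη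
  refine ⟨ρ, hρ, ?_⟩
  filter_upwards [herr, hl.eventually_gt_atTop 0,
    negligible_iff.1 (hLLN.union hcut) (δ / 2) (by positivity)] with n hn hn0 hn1
  have hmeas : ∀ t : ℕ, Measurable fun ω =>
      env β (Z ω) t * (ENNReal.ofReal η + 2 * rem β m (Z ω) t) := fun t =>
    (hZ.measurable_env t).fun_mul (((hZ.measurable_rem m t).const_mul 2).const_add _)
  have hMarkov := measure_sum_ge_le (P := P) hmeas (fun t => hint t) (l := l n) (l' := l' n)
    (by omega) (K := κ₀ / 8 / C) (by positivity)
  have hsub : {ω | ∃ θ, dist θ θ₀ < ρ ∧ ∃ w : Param d, ‖w‖ = 1 ∧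
      ∑ t ∈ Finset.Icc (l n) (l' n), |inner ℝ w (Φh n ω t θ)| < κ₀ / 2 * (l' n + 1 - l n : ℕ)} ⊆
      ((path Y ⁻¹' {x | ∃ w ∈ Metric.sphere (0 : Param d) 1, κ₀ / 4 * (l' n + 1 - l n : ℕ)
        < |∑ t ∈ Finset.Icc (l n) (l' n), φ w (shift^[t] x)
          - (l' n + 1 - l n : ℕ) * ∫ y, φ w y ∂ν|}) ∪
        {ω | ENNReal.ofReal (κ₀ / 8 / C * (l' n + 1 - l n : ℕ)) ≤
          ∑ t ∈ Finset.Icc (l n) (l' n), env β (Z ω) t * cut β (t - 1 - b n) (Z ω) t}) ∪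
      {ω | ENNReal.ofReal (κ₀ / 8 / C * (l' n + 1 - l n : ℕ)) ≤
        ∑ t ∈ Finset.Icc (l n) (l' n),
          env β (Z ω) t * (ENNReal.ofReal η + 2 * rem β m (Z ω) t)} := by
    rintro ω ⟨θ, hθ, w, hw, hlt⟩
    by_contra hcon
    simp only [mem_union, mem_preimage, mem_ofPred_eq, not_or, not_exists, not_and, not_lt,
      not_le] at hcon
    obtain ⟨⟨h1, h2⟩, h3⟩ := hcon
    have h1 := (abs_le.1 (h1 w (by simpa using hw))).1
    have h4 := hmin w (by simpa using hw)
    have hm0 : (0 : ℝ) < (l' n + 1 - l n : ℕ) := by exact_mod_cast hn0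
    have h5 : κ₀ * (l' n + 1 - l n : ℕ) ≤ (l' n + 1 - l n : ℕ) * ∫ y, φ w y ∂ν := by
      rw [mul_comm]; gcongr
    have h6 : ∑ t ∈ Finset.Icc (l n) (l' n),
        |φ w (shift^[t] (path Y ω)) - abs (inner ℝ w (Φh n ω t θ))|
        < κ₀ / 4 * (l' n + 1 - l n : ℕ) := by
      refine abs_sum_lt_of_ofReal_le (R := fun t : ℕ => ENNReal.ofReal C * (env β (Z ω) t
        * (ENNReal.ofReal η + 2 * rem β m (Z ω) t))
          + ENNReal.ofReal C * (env β (Z ω) t * cut β (t - 1 - b n) (Z ω) t)) (fun t ht => ?_) ?_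
      · refine le_trans ?_ (hn ω θ hθ t ht)
        rw [edist_dist]
        apply ENNReal.ofReal_le_ofReal
        refine (abs_abs_sub_abs_le _ _).trans ?_
        rw [← inner_sub_right, dist_comm, dist_eq_norm]
        refine (abs_real_inner_le_norm _ _).trans ?_
        rw [hw, one_mul]
      · rw [Finset.sum_add_distrib, ← Finset.mul_sum, ← Finset.mul_sum]
        calc _ < ENNReal.ofReal C * ENNReal.ofReal (κ₀ / 8 / C * (l' n + 1 - l n : ℕ))
              + ENNReal.ofReal C * ENNReal.ofReal (κ₀ / 8 / C * (l' n + 1 - l n : ℕ)) := by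
              exact ENNReal.add_lt_add
                (ENNReal.mul_lt_mul_right (by simpa using hC) ENNReal.ofReal_ne_top h3)
                (ENNReal.mul_lt_mul_right (by simpa using hC) ENNReal.ofReal_ne_top h2)
          _ = _ := by
              rw [← ENNReal.ofReal_mul hC.le, ← ENNReal.ofReal_add (by positivity) (by positivity)]
              congr 1
              field_simp
              ring
    have h7 : ∑ t ∈ Finset.Icc (l n) (l' n), φ w (shift^[t] (path Y ω))
        - ∑ t ∈ Finset.Icc (l n) (l' n), |inner ℝ w (Φh n ω t θ)|
        ≤ ∑ t ∈ Finset.Icc (l n) (l' n),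
          |φ w (shift^[t] (path Y ω)) - abs (inner ℝ w (Φh n ω t θ))| := by
      rw [← Finset.sum_sub_distrib]
      exact Finset.sum_le_sum fun t _ => le_abs_self _
    linarith
  refine (measure_mono hsub).trans ((measure_union_le _ _).trans ?_)
  have h8 : κ₀ / 8 / C * (δ / 2) / (κ₀ / 8 / C) = δ / 2 := by field_simp
  rw [h8] at hMarkov
  calc _ ≤ ENNReal.ofReal (δ / 2) + ENNReal.ofReal (δ / 2) := add_le_add hn1 hMarkov
    _ = ENNReal.ofReal δ := by
      rw [← ENNReal.ofReal_add (by positivity) (by positivity)]; congr 1; ring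

end LowerBound

/-! ### Lower bound for the normalizing matrix on the first observations. -/

section Information

variable {d : ℕ} {Ω : Type*} [MeasurableSpace Ω] {P : Measure Ω} {Y : ℤ → Ω → ℕ}
  {Z : Ω → ℤ → ℝ≥0∞} {M : ℝ≥0∞} {β : ℕ → ℝ} {f : Param d → (ℕ → ℕ) → ℝ} {Θ : Set (Param d)}
  {c r₀ : ℝ} {θ₀ : Param d}

theorem CubicBound.lintegral_env_mul_env (hZ : CubicBound P Z M) (t : ℤ) :
    ∫⁻ ω, env β (Z ω) t * env β (Z ω) t ∂P ≤ (1 + mass β) * ((1 + mass β) * M) := by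
  have h1 : ∀ ω, env β (Z ω) t * env β (Z ω) t = env β (Z ω) t * Z ω t
      + env β (Z ω) t * ∑' k : ℕ, ENNReal.ofReal (β k) * Z ω (t - 1 - k) := fun ω => by
    conv_lhs => rw [env]
    rw [env]; ring
  simp only [h1]
  rw [lintegral_add_left ((hZ.measurable_env t).fun_mul (hZ.measurable t)), add_mul, one_mul]
  refine add_le_add (hZ.lintegral_env_mul t t) ?_
  rw [mul_comm]
  exact lintegral_mul_tsum_le (hZ.measurable_env t) (fun _ => hZ.measurable _)
    (fun _ => hZ.lintegral_env_mul _ _) _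

/-- Stability of the score vector, from `(w - a) p - (w - b) q = (w - a) (p - q) + (b - a) q` with
linear growth bounds on all factors. -/
theorem edist_sub_smul_le {E : Type*} [NormedAddCommGroup E] [NormedSpace ℝ E] {w a b : ℝ}
    {p q : E} {A e : ℝ≥0∞} {C : ℝ} (hC : 0 ≤ C) (hab : edist a b ≤ e) (hpq : edist p q ≤ e)
    (hw : ‖w‖ₑ ≤ A) (ha : ‖a‖ₑ ≤ ENNReal.ofReal C * A) (hq : ‖q‖ₑ ≤ ENNReal.ofReal C * A) :
    edist ((w - a) • p) ((w - b) • q) ≤ ENNReal.ofReal (1 + 2 * C) * (A * e) := by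
  have h1 : (w - a) • p - (w - b) • q = (w - a) • (p - q) + (b - a) • q := by
    rw [smul_sub, sub_smul b a]; simp only [sub_smul]; abel
  rw [edist_eq_enorm_sub] at hab hpq ⊢
  rw [h1]
  have h2 : ENNReal.ofReal (1 + 2 * C) = 1 + ENNReal.ofReal C + ENNReal.ofReal C := by
    rw [add_assoc, ← ENNReal.ofReal_add hC hC, ENNReal.ofReal_add (by norm_num) (by positivity),
      ENNReal.ofReal_one]
    congr 2; ring
  calc ‖(w - a) • (p - q) + (b - a) • q‖ₑ
      ≤ ‖w - a‖ₑ * ‖p - q‖ₑ + ‖b - a‖ₑ * ‖q‖ₑ := by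
        refine (enorm_add_le _ _).trans_eq ?_
        rw [enorm_smul, enorm_smul]
    _ ≤ (A + ENNReal.ofReal C * A) * e + e * (ENNReal.ofReal C * A) := by
        gcongr
        · exact enorm_sub_le.trans (add_le_add hw ha)
        · rwa [← edist_eq_enorm_sub, edist_comm, edist_eq_enorm_sub]
    _ = _ := by rw [h2]; ring

theorem RegularGradient.exists_bound (hg : RegularGradient f Θ β θ₀ r₀) :
    ∃ C : ℝ, 1 ≤ C ∧ ∀ θ ∈ Metric.closedBall θ₀ r₀, ‖pastGrad f Θ θ 0‖ ≤ C := by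
  obtain ⟨C, hC⟩ := (isCompact_closedBall θ₀ r₀).exists_bound_of_continuousOn (hg.cont 0)
  exact ⟨max C 1, le_max_right _ _, fun θ hθ => (hC θ hθ).trans (le_max_left _ _)⟩

/-- If the score at the true parameter is orthogonal to `w`, then `w` is in the kernel of the
information matrix `I`. -/
theorem infoI_mulVec_eq_zero [IsFiniteMeasure P] (hY : ∀ t, Measurable (Y t))
    (hg : RegularGradient f Θ β θ₀ r₀) (hOD : ClassOD P univ f θ₀ Y)
    (hI : ∀ i j, Integrable (infoIIntegrand P f Θ θ₀ Y i j) P) {w : Param d}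
    (hw : ∀ᵐ ω ∂P, inner ℝ w (((Y 0 ω : ℝ) - lam f (path Y ω) 0 θ₀)
      • pastGrad f Θ θ₀ (past (path Y ω) 0)) = 0) :
    (infoI P f Θ θ₀ Y).mulVec w.ofLp = 0 := by
  set X : Ω → ℝ := fun ω => (Y 0 ω : ℝ) with hX
  set G : Ω → Param d := fun ω => pastGrad f Θ θ₀ (past (path Y ω) 0) with hG
  have hm := pastSigma_le hY 0
  have hcv : ∀ᵐ ω ∂P, condVar (pastSigma Y 0) X P ω * inner ℝ w (G ω) = 0 := by
    by_cases hint : Integrable (fun ω => (X ω - (P[X | pastSigma Y 0]) ω) ^ 2) P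
    -- On `A` the hypothesis forces `Y 0` to equal its conditional mean. Since `A` is determined by
    -- the past, the conditional variance vanishes on `A`, so its product with `⟪w, G⟫` vanishes
    -- everywhere.
    · set A : Set Ω := {ω | inner ℝ w (G ω) ≠ 0} with hA
      have hGm : Measurable[pastSigma Y 0] G :=
        hg.measurable.comp (measurable_past_path_pastSigma Y 0)
      have hAm : MeasurableSet[pastSigma Y 0] A := by
        have h1 : Measurable[pastSigma Y 0] fun ω => inner ℝ w (G ω) :=
          (continuous_const.inner continuous_id : Continuous fun v : Param d =>
            inner ℝ w v).measurable.comp hGm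
        exact h1 (measurableSet_singleton (0 : ℝ)).compl
      have h2 := condExp_indicator (m := pastSigma Y 0) hint hAm
      have h3 : A.indicator (fun ω => (X ω - (P[X | pastSigma Y 0]) ω) ^ 2) =ᵐ[P] 0 := by
        filter_upwards [hw, hOD.condMean 0 trivial] with ω hω hc
        by_cases hωA : ω ∈ A
        · rw [indicator_of_mem hωA, hc]
          rw [inner_smul_right] at hω
          have h4 := (mul_eq_zero.1 hω).resolve_right hωA
          simp [hX, h4]
        · rw [indicator_of_notMem hωA]; rfl
      have h5 := (condExp_congr_ae (m := pastSigma Y 0) h3).symm.trans h2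
      rw [condExp_zero] at h5
      filter_upwards [h5] with ω hω
      by_cases hωA : ω ∈ A
      · rw [indicator_of_mem hωA] at hω
        have h6 : condVar (pastSigma Y 0) X P ω = 0 := hω.symm
        rw [h6, zero_mul]
      · have h6 : inner ℝ w (G ω) = 0 := not_not.1 hωA
        rw [h6, mul_zero]
    -- The conditional variance takes the default value `0` when the squared deviation is not
    -- integrable.
    · rw [condVar_of_not_integrable hint]
      simp
  funext i
  have h1 : (infoI P f Θ θ₀ Y).mulVec w.ofLp i
      = ∫ ω, ∑ j, infoIIntegrand P f Θ θ₀ Y i j ω * w j ∂P := by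
    rw [integral_finsetSum _ fun j _ => (hI i j).mul_const _]
    simp only [Matrix.mulVec, dotProduct, infoI, Matrix.of_apply, integral_mul_const]
  rw [h1, Pi.zero_apply]
  refine integral_eq_zero_of_ae ?_
  filter_upwards [hcv] with ω hω
  have h2 : inner ℝ w (G ω) = ∑ j, G ω j * w j := by
    rw [PiLp.inner_apply]
    exact Finset.sum_congr rfl fun j _ => by simp
  rw [h2] at hω
  have h3 : ∑ j, infoIIntegrand P f Θ θ₀ Y i j ω * w j
      = 1 / lam f (path Y ω) 0 θ₀ ^ 2 * G ω i
        * (condVar (pastSigma Y 0) X P ω * ∑ j, G ω j * w j) := by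
    simp only [Finset.mul_sum]
    refine Finset.sum_congr rfl fun j _ => ?_
    change condVar (pastSigma Y 0) X P ω / lam f (path Y ω) 0 θ₀ ^ 2 * (G ω i * G ω j) * w j = _
    ring
  rw [h3, hω, mul_zero]
  rfl

/-- The quadratic form of the sandwich matrix on the first `u n = o(n)` observations, at a
consistent sequence of estimates, exceeds `B / n` for every `B`. -/
theorem negligible_quadraticForm_sandwich_lt [IsProbabilityMeasure P] (h : RegularMean f Θ β c)
    (hg : RegularGradient f Θ β θ₀ r₀) (hOD : ClassOD P univ f θ₀ Y)
    (herg : StationaryErgodic P Y) (hZ : CubicBound P Z M) (hM : M ≠ ∞)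
    (hYZ : ∀ ω t, (1 : ℝ≥0∞) + Y t ω ≤ Z ω t)
    (hnd : ∀ w : Param d,
      (∀ᵐ ω ∂P, inner ℝ w (gradientWithin (lam f (path Y ω) 0) Θ θ₀) = 0) → w = 0)
    (hI : ∀ i j, Integrable (infoIIntegrand P f Θ θ₀ Y i j) P)
    (hdet : (infoI P f Θ θ₀ Y).det ≠ 0) {x : ℕ → Ω → ℤ → ℕ} {u : ℕ → ℕ}
    (hu : Tendsto u atTop atTop) (hun : Tendsto (fun n : ℕ => (u n : ℝ) / n) atTop (𝓝 0))
    (hx : ∀ᶠ n in atTop, ∀ ω, Tracks (x n ω) (path Y ω) (Z ω) 0 1 (u n))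
    {e : ℕ → Ω → Param d}
    (he : ∀ ρ : ℝ, 0 < ρ → Negligible P fun n => {ω | ρ ≤ dist (e n ω) θ₀}) (B : ℝ) :
    Negligible P fun n => {ω | ∃ v : Param d,
      v.ofLp ⬝ᵥ (sandwich f Θ (x n ω) 1 (u n) (e n ω)).mulVec v.ofLp < B / n * ‖v‖ ^ 2} := by
  have hY := hOD.measurable
  have hβ := h.nonneg
  have hmass := mass_ne_top h.summable hβ
  have hν := hZ.map_path hY hYZ
  have hpm := measurable_path hY
  have hθ₀ball : θ₀ ∈ Metric.closedBall θ₀ r₀ := Metric.mem_closedBall_self hg.pos.le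
  have hθ₀ : θ₀ ∈ Θ := hg.subset hθ₀ball
  obtain ⟨C₀, hC₀, hC₀b⟩ := h.exists_bound
  obtain ⟨C₁, hC₁, hC₁b⟩ := hg.exists_bound
  set C : ℝ := max C₀ C₁ with hCdef
  have hC : 1 ≤ C := hC₀.trans (le_max_left _ _)
  have hfb : ∀ θ ∈ Θ, ‖f θ 0‖ ≤ C := fun θ hθ => (hC₀b θ hθ).trans (le_max_left _ _)
  have hgb : ∀ θ ∈ Metric.closedBall θ₀ r₀, ‖pastGrad f Θ θ 0‖ ≤ C := fun θ hθ =>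
    (hC₁b θ hθ).trans (le_max_right _ _)
  have hZ1 := hZ.one_le
  have hwin : Tendsto (fun n => u n + 1 - 1) atTop atTop := by simpa using hu
  have hb : ∀ᶠ n : ℕ in atTop, (fun _ : ℕ => 0) n < (fun _ : ℕ => 1) n :=
    Eventually.of_forall fun _ => Nat.zero_lt_one
  have hf0m : Measurable fun x : ℤ → ℕ => lam f x 0 θ₀ :=
    (h.measurable θ₀ hθ₀).comp (measurable_past 0)
  have hG0m : Measurable fun x : ℤ → ℕ => pastGrad f Θ θ₀ (past x 0) :=
    hg.measurable.comp (measurable_past 0)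
  have hx0m : Measurable fun x : ℤ → ℕ => (x 0 : ℝ) :=
    (measurable_of_countable _).comp (measurable_pi_apply 0)
  have hfν : ∀ x : ℤ → ℕ, ‖lam f x 0 θ₀‖ₑ
      ≤ ENNReal.ofReal C * env β (fun t => (1 : ℝ≥0∞) + x t) 0 := fun x =>
    enorm_le_mul_env hβ (h.lip θ₀ hθ₀) hC (hfb θ₀ hθ₀) (fun _ => le_self_add)
      (fun k => le_add_self)
  have hGν : ∀ x : ℤ → ℕ, ‖pastGrad f Θ θ₀ (past x 0)‖ₑ
      ≤ ENNReal.ofReal C * env β (fun t => (1 : ℝ≥0∞) + x t) 0 := fun x =>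
    enorm_le_mul_env hβ (hg.lip θ₀ hθ₀ball) hC (hgb θ₀ hθ₀ball) (fun _ => le_self_add)
      (fun k => le_add_self)
  have hΦJ : Integrable (fun x : ℤ → ℕ => pastGrad f Θ θ₀ (past x 0)) (P.map (path Y)) := by
    refine ⟨hG0m.aestronglyMeasurable, ?_⟩
    refine lt_of_le_of_lt (lintegral_mono hGν) ?_
    rw [lintegral_const_mul' _ _ ENNReal.ofReal_ne_top]
    refine ENNReal.mul_lt_top ENNReal.ofReal_lt_top
      (lt_of_le_of_lt (hν.lintegral_env 0) ?_)
    exact ENNReal.mul_lt_top (by simpa using hmass.lt_top) hM.lt_top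
  have hΦI : Integrable (fun x : ℤ → ℕ => ((x 0 : ℝ) - lam f x 0 θ₀)
      • pastGrad f Θ θ₀ (past x 0)) (P.map (path Y)) := by
    refine ⟨((hx0m.sub hf0m).smul hG0m).aestronglyMeasurable, ?_⟩
    refine lt_of_le_of_lt (b := ∫⁻ x : ℤ → ℕ, ENNReal.ofReal ((1 + C) * C)
      * (env β (fun t => (1 : ℝ≥0∞) + x t) 0 * env β (fun t => (1 : ℝ≥0∞) + x t) 0)
      ∂(P.map (path Y))) (lintegral_mono fun x => ?_) ?_
    · rw [enorm_smul, ENNReal.ofReal_mul (by positivity), ENNReal.ofReal_add (by norm_num)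
        (by positivity), ENNReal.ofReal_one]
      have h1 : ‖(x 0 : ℝ)‖ₑ ≤ env β (fun t => (1 : ℝ≥0∞) + x t) 0 := by
        rw [Real.enorm_natCast]
        exact le_add_self.trans le_self_add
      calc _ ≤ (env β (fun t => (1 : ℝ≥0∞) + x t) 0
              + ENNReal.ofReal C * env β (fun t => (1 : ℝ≥0∞) + x t) 0)
            * (ENNReal.ofReal C * env β (fun t => (1 : ℝ≥0∞) + x t) 0) :=
            mul_le_mul' (enorm_sub_le.trans (add_le_add h1 (hfν x))) (hGν x)
        _ = _ := by ring
    · rw [lintegral_const_mul' _ _ ENNReal.ofReal_ne_top]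
      refine ENNReal.mul_lt_top ENNReal.ofReal_lt_top
        (lt_of_le_of_lt (hν.lintegral_env_mul_env 0) ?_)
      have h1 : 1 + mass β < ∞ := by simpa using hmass.lt_top
      exact ENNReal.mul_lt_top h1 (ENNReal.mul_lt_top h1 hM.lt_top)
  have herr : ∀ m : ℕ, 0 < m → ∀ η : ℝ, 0 < η → ∃ ρ > 0, ∀ᶠ n in atTop, ∀ ω θ, dist θ θ₀ < ρ →
      θ ∈ Metric.closedBall θ₀ r₀ ∧ ∀ t ∈ Finset.Icc 1 (u n),
        edist (f θ (observedPast (x n ω) t)) (f θ₀ (past (path Y ω) t))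
          ≤ (ENNReal.ofReal η + 2 * rem β m (Z ω) t) + cut β (t - 1 - 0) (Z ω) t ∧
        edist (pastGrad f Θ θ (observedPast (x n ω) t)) (pastGrad f Θ θ₀ (past (path Y ω) t))
          ≤ (ENNReal.ofReal η + 2 * rem β m (Z ω) t) + cut β (t - 1 - 0) (Z ω) t := by
    intro m hm η hη
    -- The parameter is first moved to `θ₀` along the observed past, costing the modulus; then the
    -- past is made stationary at `θ₀`, costing the `cut` term.
    obtain ⟨r1, hr1, h1⟩ := exists_modulus hβ h.compact h.cont h.lip hm hη
    obtain ⟨r2, hr2, h2⟩ := exists_modulus hβ (isCompact_closedBall θ₀ r₀) hg.cont hg.lip hm hη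
    refine ⟨min r₀ (min r1 r2), lt_min hg.pos (lt_min hr1 hr2), ?_⟩
    filter_upwards [hx] with n hn ω θ hθ
    have hθb : θ ∈ Metric.closedBall θ₀ r₀ := (hθ.le.trans (min_le_left _ _))
    have hθ1 : dist θ θ₀ < r1 := hθ.trans_le ((min_le_right _ _).trans (min_le_left _ _))
    have hθ2 : dist θ θ₀ < r2 := hθ.trans_le ((min_le_right _ _).trans (min_le_right _ _))
    refine ⟨hθb, fun t ht => ?_⟩
    have hw := (hn ω).wdist_le hβ ht
    have ho := (hn ω).observedPast_le t ht
    constructor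
    · exact (edist_triangle _ (f θ₀ (observedPast (x n ω) t)) _).trans
        (add_le_add (h1 θ (hg.subset hθb) θ₀ hθ₀ hθ1 _ (Z ω) t ho)
          ((h.lip θ₀ hθ₀ _ _).trans hw))
    · exact (edist_triangle _ (pastGrad f Θ θ₀ (observedPast (x n ω) t)) _).trans
        (add_le_add (h2 θ hθb θ₀ hθ₀ball hθ2 _ (Z ω) t ho)
          ((hg.lip θ₀ hθ₀ball _ _).trans hw))
  obtain ⟨κJ, hκJ, hLJ⟩ := exists_locallyNegligible_sum_abs_inner_lt h.summable hβ hY herg hZ hM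
    (b := fun _ => 0) (l := fun _ => 1) (l' := u) hb hwin hΦJ
    (fun w hw => hnd w (ae_of_ae_map hpm.aemeasurable hw))
    (Φh := fun n ω t θ => pastGrad f Θ θ (observedPast (x n ω) t)) (θ₀ := θ₀) (C := 1) one_pos
    (by
      intro m hm η hη
      obtain ⟨ρ, hρ, hev⟩ := herr m hm η hη
      refine ⟨ρ, hρ, ?_⟩
      filter_upwards [hev] with n hn ω θ hθ t ht
      rw [past_shift_iterate, ENNReal.ofReal_one, one_mul, one_mul, ← mul_add]
      exact ((hn ω θ hθ).2 t ht).2.trans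
        (le_mul_of_one_le_left zero_le (one_le_env (hZ1 ω) t)))
  -- Nonsingularity of `I` enters here: a vector orthogonal to the stationary score lies in the
  -- kernel of `I`, so the score is not concentrated on a hyperplane.
  obtain ⟨κI, hκI, hLI⟩ := exists_locallyNegligible_sum_abs_inner_lt h.summable hβ hY herg hZ hM
    (b := fun _ => 0) (l := fun _ => 1) (l' := u) hb hwin hΦI
    (fun w hw => by
      have h1 := infoI_mulVec_eq_zero hY hg hOD hI (ae_of_ae_map hpm.aemeasurable hw)
      have h2 := Matrix.eq_zero_of_mulVec_eq_zero hdet h1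
      ext i
      exact congrFun h2 i)
    (Φh := fun n ω t θ => ((x n ω t : ℝ) - lamHat f (x n ω) t θ)
      • pastGrad f Θ θ (observedPast (x n ω) t)) (θ₀ := θ₀) (C := 1 + 2 * C) (by linarith)
    (by
      intro m hm η hη
      obtain ⟨ρ, hρ, hev⟩ := herr m hm η hη
      refine ⟨ρ, hρ, ?_⟩
      filter_upwards [hev, hx] with n hn hxn ω θ hθ t ht
      rw [← mul_add, ← mul_add]
      obtain ⟨hθb, hn'⟩ := hn ω θ hθ
      have hlam : lam f (shift^[t] (path Y ω)) 0 θ₀ = f θ₀ (past (path Y ω) t) := by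
        rw [lam, past_shift_iterate]
      rw [past_shift_iterate, hlam, (hxn ω).eq t ht, shift_iterate, zero_add]
      refine edist_sub_smul_le (by linarith) (hn' t ht).1 (hn' t ht).2 ?_ ?_ ?_
      · rw [Real.enorm_natCast]
        exact (le_add_self.trans (hYZ ω t)).trans le_self_add
      · exact enorm_le_mul_env hβ (h.lip θ (hg.subset hθb)) hC (hfb θ (hg.subset hθb)) (hZ1 ω)
          ((hxn ω).observedPast_le t ht)
      · exact enorm_le_mul_env hβ (hg.lip θ₀ hθ₀ball) hC (hgb θ₀ hθ₀ball) (hZ1 ω)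
          ((hxn ω).past_le t))
  set κ : ℝ := min κJ κI with hκdef
  have hκ : 0 < κ := lt_min hκJ hκI
  rw [negligible_iff]
  intro δ hδ
  set A : ℝ≥0∞ := (1 + mass β) * M with hA
  have hA' : A ≠ ∞ := ENNReal.mul_ne_top (by simp [hmass]) hM
  set D : ℝ := (1 / c + 1) * C with hD
  have hD1 : C ≤ D := by
    have : 0 < 1 / c := one_div_pos.2 h.pos
    rw [hD]; nlinarith
  have hD0 : 0 < D := by linarith
  -- Chosen so that Markov's inequality bounds the probability of a large average of `env * Z` by `δ
  -- / 4`; there are four exceptional events in all.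
  set K₀ : ℝ := (A.toReal + 1) / (δ / 4) with hK₀
  have hK₀pos : 0 < K₀ := by
    have : (0 : ℝ) ≤ A.toReal := ENNReal.toReal_nonneg
    positivity
  set K : ℝ := D * K₀ with hK
  have hKpos : 0 < K := by positivity
  -- Here `u n = o(n)` pays for the factor `u n` lost in the crude bound on `Î`.
  have hlarge : ∀ᶠ n : ℕ in atTop, B / n ≤ (κ / K) ^ 4 / u n := by
    have h1 : Tendsto (fun n : ℕ => B * ((u n : ℝ) / n)) atTop (𝓝 0) := by
      simpa using hun.const_mul B
    filter_upwards [h1.eventually (gt_mem_nhds (show (0 : ℝ) < (κ / K) ^ 4 by positivity)),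
      eventually_gt_atTop 0, hu.eventually_gt_atTop 0] with n hn hn0 hu0
    have hn0' : (0 : ℝ) < n := by exact_mod_cast hn0
    have hu0' : (0 : ℝ) < u n := by exact_mod_cast hu0
    rw [div_le_div_iff₀ hn0' hu0']
    rw [mul_div_assoc', div_lt_iff₀ hn0'] at hn
    exact hn.le
  filter_upwards [negligible_iff.1 (hLJ.negligible he) (δ / 4) (by positivity),
    negligible_iff.1 (hLI.negligible he) (δ / 4) (by positivity),
    negligible_iff.1 (he r₀ hg.pos) (δ / 4) (by positivity), hlarge, hx,
    hu.eventually_gt_atTop 0] with n hn1 hn2 hn3 hn4 hxn hu0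
  have hMarkov := measure_sum_ge_le (P := P) (W := fun t ω => env β (Z ω) t * Z ω t)
    (fun t => (hZ.measurable_env t).fun_mul (hZ.measurable t)) (a := A.toReal + 1)
    (fun t => (hZ.lintegral_env_mul t t).trans (by
      rw [← hA]
      conv_lhs => rw [← ENNReal.ofReal_toReal hA']
      exact ENNReal.ofReal_le_ofReal (by linarith)))
    (l := 1) (l' := u n) (by omega) hK₀pos
  have hAK : (A.toReal + 1) / K₀ = δ / 4 := by
    have : (A.toReal + 1) ≠ 0 := by
      have : (0 : ℝ) ≤ A.toReal := ENNReal.toReal_nonneg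
      positivity
    rw [hK₀]; field_simp
  rw [hAK] at hMarkov
  have hu0' : (0 : ℝ) < u n := by exact_mod_cast hu0
  refine (measure_mono (t := (({ω | ∃ w : Param d, ‖w‖ = 1 ∧ ∑ t ∈ Finset.Icc 1 (u n),
      |inner ℝ w (pastGrad f Θ (e n ω) (observedPast (x n ω) t))| < κJ * (u n + 1 - 1 : ℕ)} ∪
    {ω | ∃ w : Param d, ‖w‖ = 1 ∧ ∑ t ∈ Finset.Icc 1 (u n),
      |inner ℝ w (((x n ω t : ℝ) - lamHat f (x n ω) t (e n ω))
        • pastGrad f Θ (e n ω) (observedPast (x n ω) t))| < κI * (u n + 1 - 1 : ℕ)}) ∪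
    {ω | r₀ ≤ dist (e n ω) θ₀}) ∪
    {ω | ENNReal.ofReal (K₀ * (u n + 1 - 1 : ℕ))
      ≤ ∑ t ∈ Finset.Icc 1 (u n), env β (Z ω) t * Z ω t}) ?_).trans ?_
  · rintro ω ⟨v, hv⟩
    by_contra hcon
    simp only [mem_union, mem_ofPred_eq, not_or, not_exists, not_and, not_lt, not_le,
      Nat.add_sub_cancel] at hcon
    obtain ⟨⟨⟨h1, h2⟩, h3⟩, h4⟩ := hcon
    set θ := e n ω with hθdef
    have hθb : θ ∈ Metric.closedBall θ₀ r₀ := h3.le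
    have hθΘ := hg.subset hθb
    have hpos : ∀ y, 0 < f θ y := fun y => h.pos.trans_le (h.le θ hθΘ y)
    have hfe : ∀ t ∈ Finset.Icc 1 (u n), ‖lamHat f (x n ω) t θ‖ₑ
        ≤ ENNReal.ofReal C * env β (Z ω) t := fun t ht =>
      enorm_le_mul_env hβ (h.lip θ hθΘ) hC (hfb θ hθΘ) (hZ1 ω) ((hxn ω).observedPast_le t ht)
    have hge : ∀ t ∈ Finset.Icc 1 (u n), ‖gradientWithin (lamHat f (x n ω) t) Θ θ‖ₑ
        ≤ ENNReal.ofReal C * env β (Z ω) t := fun t ht =>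
      enorm_le_mul_env hβ (hg.lip θ hθb) hC (hgb θ hθb) (hZ1 ω) ((hxn ω).observedPast_le t ht)
    have hDK : ∑ t ∈ Finset.Icc 1 (u n), ENNReal.ofReal D * (env β (Z ω) t * Z ω t)
        < ENNReal.ofReal (K * u n) := by
      rw [← Finset.mul_sum, hK, mul_assoc, ENNReal.ofReal_mul hD0.le]
      exact ENNReal.mul_lt_mul_right (by simpa using hD0) ENNReal.ofReal_ne_top h4
    have hsum1 : ∑ t ∈ Finset.Icc 1 (u n), lamHat f (x n ω) t θ ≤ K * u n := by
      have := abs_sum_lt_of_ofReal_le (a := fun t : ℕ => lamHat f (x n ω) t θ) (fun t ht => by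
        rw [← Real.enorm_eq_ofReal_abs]
        refine (hfe t ht).trans ?_
        refine mul_le_mul' (ENNReal.ofReal_le_ofReal hD1) ?_
        exact le_mul_of_one_le_right zero_le (hZ1 ω t)) hDK
      exact (Finset.sum_le_sum fun t _ => le_abs_self _).trans this.le
    have hsum2 : ∑ t ∈ Finset.Icc 1 (u n), |(x n ω t : ℝ) / lamHat f (x n ω) t θ - 1|
        * ‖gradientWithin (lamHat f (x n ω) t) Θ θ‖ ≤ K * u n := by
      have := abs_sum_lt_of_ofReal_le (a := fun t : ℕ =>
          |(x n ω t : ℝ) / lamHat f (x n ω) t θ - 1|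
            * ‖gradientWithin (lamHat f (x n ω) t) Θ θ‖) (fun t ht => by
        have hl : c ≤ lamHat f (x n ω) t θ := h.le θ hθΘ _
        have h5 : |(x n ω t : ℝ) / lamHat f (x n ω) t θ - 1| ≤ (1 / c + 1) * (1 + Y t ω) := by
          rw [(hxn ω).eq t ht]
          have hYn : (0 : ℝ) ≤ Y t ω := Nat.cast_nonneg _
          have h6 : (Y t ω : ℝ) / lamHat f (x n ω) t θ ≤ Y t ω / c :=
            div_le_div_of_nonneg_left hYn h.pos hl
          have h7 : 0 ≤ (Y t ω : ℝ) / lamHat f (x n ω) t θ :=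
            div_nonneg hYn (h.pos.le.trans hl)
          have h8 : 0 < 1 / c := one_div_pos.2 h.pos
          have h9 : (Y t ω : ℝ) / c = 1 / c * Y t ω := by ring
          change |(Y t ω : ℝ) / lamHat f (x n ω) t θ - 1| ≤ _
          rw [abs_le]
          constructor <;> nlinarith
        have hc8 : 0 < 1 / c := one_div_pos.2 h.pos
        rw [abs_mul, abs_abs, abs_norm, ENNReal.ofReal_mul (abs_nonneg _), ofReal_norm]
        have h10 : ENNReal.ofReal (1 + (Y t ω : ℝ)) ≤ Z ω t := by
          rw [ENNReal.ofReal_add (by norm_num) (Nat.cast_nonneg _), ENNReal.ofReal_one,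
            ENNReal.ofReal_natCast]
          exact hYZ ω t
        calc _ ≤ (ENNReal.ofReal (1 / c + 1) * Z ω t) * (ENNReal.ofReal C * env β (Z ω) t) := by
              refine mul_le_mul' ((ENNReal.ofReal_le_ofReal h5).trans ?_) (hge t ht)
              rw [ENNReal.ofReal_mul (by positivity)]
              gcongr
          _ = ENNReal.ofReal D * (env β (Z ω) t * Z ω t) := by
              rw [hD, ENNReal.ofReal_mul (by positivity)]; ring) hDK
      exact (Finset.sum_le_sum fun t _ => le_abs_self _).trans this.le
    have key := le_quadraticForm_sandwich_Icc (f := f) (Θ := Θ) (x := x n ω) (η := θ) hu0 hpos hκ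
      hKpos
      (fun w hw => (mul_le_mul_of_nonneg_right (min_le_left _ _) hu0'.le).trans (h1 w hw))
      (fun w hw => (mul_le_mul_of_nonneg_right (min_le_right _ _) hu0'.le).trans (h2 w hw))
      hsum1 hsum2 v
    have hfin : B / n * ‖v‖ ^ 2 ≤ (κ / K) ^ 4 / u n * ‖v‖ ^ 2 :=
      mul_le_mul_of_nonneg_right hn4 (sq_nonneg _)
    exact absurd hv (not_lt.2 (hfin.trans key))
  · refine (measure_union_le _ _).trans ?_
    refine (add_le_add ((measure_union_le _ _).trans
      (add_le_add ((measure_union_le _ _).trans (add_le_add hn1 hn2)) hn3)) hMarkov).trans ?_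
    rw [← ENNReal.ofReal_add (by positivity) (by positivity),
      ← ENNReal.ofReal_add (by positivity) (by positivity),
      ← ENNReal.ofReal_add (by positivity) (by positivity)]
    exact ENNReal.ofReal_le_ofReal (by linarith)

end Information

/-! ### From the assumptions of the model to the working hypotheses. -/

section Hypotheses

variable {d : ℕ} {Ω : Type*} [MeasurableSpace Ω] {P : Measure Ω}

theorem LipschitzCondition.edist_le {f : Param d → (ℕ → ℕ) → ℝ} {Θ : Set (Param d)} {α β : ℕ → ℝ}
    (hA : LipschitzCondition f Θ 0 α) (hle : ∀ k, α k ≤ β k) {θ : Param d} (hθ : θ ∈ Θ)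
    (y y' : ℕ → ℕ) : edist (f θ y) (f θ y') ≤ wdist β y y' := by
  refine le_trans ?_ ((hA.lipschitz y y' θ hθ).trans (wdist_le_of_le hle y y'))
  rw [edist_dist, dist_eq_norm]
  apply ENNReal.ofReal_le_ofReal
  have h := (iteratedFDerivWithin ℝ 0 (fun θ' => f θ' y) Θ θ
    - iteratedFDerivWithin ℝ 0 (fun θ' => f θ' y') Θ θ).le_opNorm 0
  simpa [iteratedFDerivWithin_zero_apply] using h

theorem regularMean_of_lipschitzCondition {f : Param d → (ℕ → ℕ) → ℝ} {Θ : Set (Param d)}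
    {α β : ℕ → ℝ} (hΘ : IsCompact Θ) (hm : ∀ θ ∈ Θ, Measurable (f θ))
    (hA : LipschitzCondition f Θ 0 α) (hle : ∀ k, α k ≤ β k) (hs : Summable β) {c : ℝ} (hc : 0 < c)
    (hlow : ∀ θ ∈ Θ, ∀ y, c ≤ f θ y) : RegularMean f Θ β c where
  compact := hΘ
  measurable := hm
  pos := hc
  le := hlow
  cont y := (hA.contDiffOn y).continuousOn
  lip _ hθ y y' := hA.edist_le hle hθ y y'
  nonneg k := (hA.nonneg k).trans (hle k)
  summable := hs

theorem lintegral_natCast_pow_three_le {Y : ℤ → Ω → ℕ} {ε C : ℝ} (hε : 2 < ε) {t : ℤ}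
    (hi : Integrable (fun ω => (Y t ω : ℝ) ^ (1 + ε)) P)
    (hC : ∫ ω, (Y t ω : ℝ) ^ (1 + ε) ∂P < C) :
    ∫⁻ ω, (Y t ω : ℝ≥0∞) ^ 3 ∂P ≤ ENNReal.ofReal C := by
  have h1 : ∀ y : ℕ, (y : ℝ≥0∞) ^ 3 ≤ ENNReal.ofReal ((y : ℝ) ^ (1 + ε)) := fun y => by
    rw [← ENNReal.ofReal_natCast, ← ENNReal.ofReal_pow (Nat.cast_nonneg _)]
    apply ENNReal.ofReal_le_ofReal
    rcases Nat.eq_zero_or_pos y with rfl | hy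
    · simp [Real.zero_rpow (by linarith : 1 + ε ≠ 0)]
    · rw [← Real.rpow_natCast]
      exact Real.rpow_le_rpow_of_exponent_le (by exact_mod_cast hy) (by push_cast; linarith)
  refine (lintegral_mono fun ω => h1 (Y t ω)).trans ?_
  rw [← ofReal_integral_eq_lintegral_ofReal hi
    (Eventually.of_forall fun ω => Real.rpow_nonneg (Nat.cast_nonneg _) _)]
  exact ENNReal.ofReal_le_ofReal hC.le

theorem mul_mul_le_pow_three_add (a b c : ℝ≥0∞) : a * b * c ≤ a ^ 3 + b ^ 3 + c ^ 3 := by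
  have h : a * b * c ≤ (max a (max b c)) ^ 3 := by
    rw [pow_three, mul_assoc]
    exact mul_le_mul' (le_max_left _ _) (mul_le_mul' ((le_max_left _ _).trans (le_max_right _ _))
      ((le_max_right _ _).trans (le_max_right _ _)))
  refine h.trans ?_
  rcases max_choice a (max b c) with h1 | h1
  · rw [h1, add_assoc]; exact le_self_add
  · rw [h1]
    rcases max_choice b c with h2 | h2
    · rw [h2, add_comm (a ^ 3), add_assoc]; exact le_self_add
    · rw [h2]; exact le_add_self

/-- The majorant `1 + Y₁ + Y₂` dominates both regimes and the observed path, whatever their joint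
law. -/
theorem cubicBound_one_add_add [IsProbabilityMeasure P] {Y₁ Y₂ : ℤ → Ω → ℕ}
    (hY₁ : ∀ t, Measurable (Y₁ t)) (hY₂ : ∀ t, Measurable (Y₂ t)) {ε : ℝ} (hε : 2 < ε)
    (h₁ : MomentBound P Y₁ ε) (h₂ : MomentBound P Y₂ ε) :
    ∃ M : ℝ≥0∞, M ≠ ∞ ∧
      CubicBound P (fun ω t => (1 : ℝ≥0∞) + Y₁ t ω + Y₂ t ω) M := by
  obtain ⟨C₁, hC₁, h₁⟩ := h₁
  obtain ⟨C₂, hC₂, h₂⟩ := h₂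
  have hm₁ : ∀ t, Measurable fun ω => (Y₁ t ω : ℝ≥0∞) := fun t =>
    (measurable_of_countable (fun y : ℕ => (y : ℝ≥0∞))).comp (hY₁ t)
  have hm₂ : ∀ t, Measurable fun ω => (Y₂ t ω : ℝ≥0∞) := fun t =>
    (measurable_of_countable (fun y : ℕ => (y : ℝ≥0∞))).comp (hY₂ t)
  have hm : ∀ t, Measurable fun ω => (1 : ℝ≥0∞) + Y₁ t ω + Y₂ t ω := fun t =>
    ((hm₁ t).const_add 1).fun_add (hm₂ t)
  set B : ℝ≥0∞ := 27 * (1 + ENNReal.ofReal C₁ + ENNReal.ofReal C₂) with hB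
  have hcube : ∀ t, ∫⁻ ω, ((1 : ℝ≥0∞) + Y₁ t ω + Y₂ t ω) ^ 3 ∂P ≤ B := by
    intro t
    -- The cube expands into `27` monomials, each at most `a ^ 3 + b ^ 3 + c ^ 3`.
    have h3 : ∀ a b c : ℝ≥0∞, (a + b + c) ^ 3 ≤ 27 * (a ^ 3 + b ^ 3 + c ^ 3) := by
      intro a b c
      have h4 : (a + b + c) ^ 3 = a * a * a + b * b * b + c * c * c
          + 3 * (a * a * b) + 3 * (a * a * c) + 3 * (b * b * a) + 3 * (b * b * c)
          + 3 * (c * c * a) + 3 * (c * c * b) + 6 * (a * b * c) := by ring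
      have hs : ∀ x y z : ℝ≥0∞, x ^ 3 ≤ a ^ 3 + b ^ 3 + c ^ 3 → y ^ 3 ≤ a ^ 3 + b ^ 3 + c ^ 3 →
          z ^ 3 ≤ a ^ 3 + b ^ 3 + c ^ 3 → x * y * z ≤ a ^ 3 + b ^ 3 + c ^ 3 := by
        intro x y z hx hy hz
        have h5 : x * y * z ≤ (max x (max y z)) ^ 3 := by
          rw [pow_three, mul_assoc]
          exact mul_le_mul' (le_max_left _ _)
            (mul_le_mul' ((le_max_left _ _).trans (le_max_right _ _))
              ((le_max_right _ _).trans (le_max_right _ _)))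
        refine h5.trans ?_
        rcases max_choice x (max y z) with h1 | h1
        · rwa [h1]
        · rw [h1]
          rcases max_choice y z with h2 | h2 <;> rwa [h2]
      have ha : a ^ 3 ≤ a ^ 3 + b ^ 3 + c ^ 3 := by rw [add_assoc]; exact le_self_add
      have hb : b ^ 3 ≤ a ^ 3 + b ^ 3 + c ^ 3 := by
        rw [add_comm (a ^ 3), add_assoc]; exact le_self_add
      have hc : c ^ 3 ≤ a ^ 3 + b ^ 3 + c ^ 3 := le_add_self
      rw [h4]
      refine (add_le_add (add_le_add (add_le_add (add_le_add (add_le_add (add_le_add (add_le_add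
        (add_le_add (add_le_add (hs a a a ha ha ha) (hs b b b hb hb hb)) (hs c c c hc hc hc))
        (mul_le_mul' le_rfl (hs a a b ha ha hb))) (mul_le_mul' le_rfl (hs a a c ha ha hc)))
        (mul_le_mul' le_rfl (hs b b a hb hb ha))) (mul_le_mul' le_rfl (hs b b c hb hb hc)))
        (mul_le_mul' le_rfl (hs c c a hc hc ha))) (mul_le_mul' le_rfl (hs c c b hc hc hb)))
        (mul_le_mul' le_rfl (hs a b c ha hb hc))).trans_eq ?_
      ring
    refine (lintegral_mono fun ω => h3 _ _ _).trans ?_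
    rw [lintegral_const_mul' _ _ (by simp), hB]
    gcongr
    rw [lintegral_add_right _ ((hm₂ t).pow_const 3), lintegral_add_right _ ((hm₁ t).pow_const 3)]
    refine add_le_add (add_le_add (by simp) ?_) ?_
    · exact lintegral_natCast_pow_three_le hε (h₁ t).1 (h₁ t).2
    · exact lintegral_natCast_pow_three_le hε (h₂ t).1 (h₂ t).2
  refine ⟨B + B + B, ?_, hm, fun ω t => by rw [add_assoc]; exact le_self_add, fun r s t => ?_⟩
  · have : B ≠ ∞ := ENNReal.mul_ne_top (by simp) (by simp)
    simp [this]
  · refine (lintegral_mono fun ω => mul_mul_le_pow_three_add _ _ _).trans ?_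
    rw [lintegral_add_right _ ((hm t).pow_const 3), lintegral_add_right _ ((hm s).pow_const 3)]
    exact add_le_add (add_le_add (hcube r) (hcube s)) (hcube t)

end Hypotheses

/-! ### The observed path on either side of the change. -/

section Change

variable {Ω : Type*} {Y₁ Y₂ : ℤ → Ω → ℕ}

theorem changePath_of_le {T t : ℤ} (h : t ≤ T) (ω : Ω) :
    changePath Y₁ Y₂ T ω t = path Y₁ ω t := by simp [changePath, path, h]

theorem changePath_of_lt {T t : ℤ} (h : T < t) (ω : Ω) :
    changePath Y₁ Y₂ T ω t = path Y₂ ω t := by simp [changePath, path, not_le.2 h]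

theorem observedPast_changePath_le (T t : ℤ) (ω : Ω) (k : ℕ) :
    (observedPast (changePath Y₁ Y₂ T ω) t k : ℝ≥0∞)
      ≤ 1 + Y₁ (t - 1 - k) ω + Y₂ (t - 1 - k) ω := by
  unfold observedPast
  split_ifs
  · unfold changePath
    split_ifs
    · exact le_add_self.trans le_self_add
    · exact le_add_self
  · simp

/-- Agreement reaches back to time `0`, as only the unobserved times before `1` are replaced by
zeros. -/
theorem tracks_changePath_left {T l l' : ℕ} (hl' : l' ≤ T) (ω : Ω) :
    Tracks (changePath Y₁ Y₂ T ω) (path Y₁ ω) (fun t => (1 : ℝ≥0∞) + Y₁ t ω + Y₂ t ω)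
      0 l l' where
  eq t ht := changePath_of_le (by have := (Finset.mem_Icc.1 ht).2; omega) ω
  past_eq t ht k hk := by
    have := (Finset.mem_Icc.1 ht).2
    rw [observedPast, if_pos (by omega), past]
    exact changePath_of_le (by omega) ω
  observedPast_le t _ k := observedPast_changePath_le T t ω k
  le t := le_self_add

/-- Agreement stops at `T`: older lags show values of the other regime, or zeros. -/
theorem tracks_changePath_right {T l l' : ℕ} (hl : T < l) (ω : Ω) :
    Tracks (changePath Y₁ Y₂ T ω) (path Y₂ ω) (fun t => (1 : ℝ≥0∞) + Y₁ t ω + Y₂ t ω)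
      T l l' where
  eq t ht := changePath_of_lt (by have := (Finset.mem_Icc.1 ht).1; omega) ω
  past_eq t ht k hk := by
    rw [observedPast, if_pos (by omega), past]
    exact changePath_of_lt (by omega) ω
  observedPast_le t _ k := observedPast_changePath_le T t ω k
  le t := by
    rw [add_right_comm]
    exact le_self_add

end Change

/-! ### Behaviour of the estimates on pure and on mixed windows. -/

section Estimation

theorem tendsto_atTop_of_div_tendsto {m : ℕ → ℕ} {a : ℝ} (ha : 0 < a)
    (h : Tendsto (fun n : ℕ => (m n : ℝ) / n) atTop (𝓝 a)) : Tendsto m atTop atTop := by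
  have h1 : Tendsto (fun n : ℕ => (m n : ℝ)) atTop atTop := by
    refine (h.pos_mul_atTop ha tendsto_natCast_atTop_atTop).congr' ?_
    filter_upwards [eventually_gt_atTop 0] with n hn
    have : (n : ℝ) ≠ 0 := by exact_mod_cast hn.ne'
    field_simp
  exact tendsto_natCast_atTop_iff.1 h1

variable {d : ℕ} {Ω : Type*} [MeasurableSpace Ω] {P : Measure Ω} {f : Param d → (ℕ → ℕ) → ℝ}
  {Θ : Set (Param d)} {β : ℕ → ℝ} {c : ℝ} {M : ℝ≥0∞}

/-- Consistency of the estimates on windows where the observations follow one regime. -/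
theorem negligible_le_dist_of_isPQMLE [IsProbabilityMeasure P] {Y : ℤ → Ω → ℕ}
    {Z : Ω → ℤ → ℝ≥0∞} (h : RegularMean f Θ β c)
    {θ₀ : Param d} (hθ₀ : θ₀ ∈ Θ) (hOD : ClassOD P univ f θ₀ Y) (herg : StationaryErgodic P Y)
    (hZ : CubicBound P Z M) (hM : M ≠ ∞) (hYZ : ∀ ω t, (1 : ℝ≥0∞) + Y t ω ≤ Z ω t)
    (hid : ∀ θ₁ ∈ Θ, ∀ θ₂ ∈ Θ,
      (∀ᵐ ω ∂P, lam f (path Y ω) 0 θ₁ = lam f (path Y ω) 0 θ₂) → θ₁ = θ₂)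
    {x : ℕ → Ω → ℤ → ℕ} {b l l' : ℕ → ℕ} (hb : ∀ᶠ n in atTop, b n < l n)
    (hl : Tendsto (fun n => l' n + 1 - l n) atTop atTop)
    (hx : ∀ᶠ n in atTop, ∀ ω, Tracks (x n ω) (path Y ω) (Z ω) (b n) (l n) (l' n))
    {e : ℕ → Ω → Param d}
    (he : ∀ᶠ n in atTop, ∀ ω, IsPQMLE f Θ (x n ω) (l n) (l' n) (e n ω)) {ρ : ℝ} (hρ : 0 < ρ) :
    Negligible P fun n => {ω | ρ ≤ dist (e n ω) θ₀} := by
  have hν := hZ.map_path hOD.measurable hYZ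
  have : IsProbabilityMeasure (P.map (path Y)) :=
    Measure.isProbabilityMeasure_map (measurable_path hOD.measurable).aemeasurable
  have hcl : IsClosed {θ : Param d | ρ ≤ dist θ θ₀} :=
    isClosed_le continuous_const (continuous_id.dist continuous_const)
  -- Wald's argument: the part of `Θ` at distance at least `ρ` from `θ₀` is compact, and `θ₀`
  -- strictly beats every point of it.
  refine (negligible_argmax_mem (A := Θ ∩ {θ | ρ ≤ dist θ θ₀}) (h.compact.inter_right hcl)
    inter_subset_left ((continuousOn_meanLogLik h hν hM).mono inter_subset_left) hθ₀
    (fun θ hθ => meanLogLik_lt h hOD hZ hM hYZ hid hθ₀ hθ.1 ?_)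
    (s := fun n => (l' n + 1 - l n : ℕ)) ?_
    (fun η hη => negligible_logLikHat h hOD.measurable herg hZ hM hYZ hb hl hx hη)
    (e := e) ?_).mono ?_
  · rintro rfl
    have := hθ.2
    simp only [mem_ofPred_eq, dist_self] at this
    linarith
  · filter_upwards [hl.eventually_gt_atTop 0] with n hn
    exact_mod_cast hn
  · filter_upwards [he] with n hn ω using (hn ω).2 θ₀ hθ₀
  · filter_upwards [he] with n hn ω hω using ⟨(hn ω).1, hω⟩

/-- Estimates on windows containing the change avoid the parameters at which the corresponding
mixture of the mean quasi-log-likelihoods is not maximal. -/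
theorem negligible_mem_of_isPQMLE_mixture [IsProbabilityMeasure P] {Y₁ Y₂ : ℤ → Ω → ℕ}
    (h : RegularMean f Θ β c) (hY₁ : ∀ t, Measurable (Y₁ t)) (hY₂ : ∀ t, Measurable (Y₂ t))
    (herg₁ : StationaryErgodic P Y₁) (herg₂ : StationaryErgodic P Y₂)
    (hZ : CubicBound P (fun ω t => (1 : ℝ≥0∞) + Y₁ t ω + Y₂ t ω) M) (hM : M ≠ ∞)
    {T l l' : ℕ → ℕ} {a b : ℝ} (ha : 0 < a) (hb : 0 < b) (hl : ∀ᶠ n in atTop, 1 ≤ l n)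
    (hl1 : ∀ᶠ n in atTop, l n ≤ T n) (hl2 : ∀ᶠ n in atTop, T n < l' n)
    (hla : Tendsto (fun n : ℕ => ((T n + 1 - l n : ℕ) : ℝ) / n) atTop (𝓝 a))
    (hlb : Tendsto (fun n : ℕ => ((l' n - T n : ℕ) : ℝ) / n) atTop (𝓝 b))
    {e : ℕ → Ω → Param d} (he : ∀ᶠ n in atTop, ∀ ω,
      IsPQMLE f Θ (changePath Y₁ Y₂ (T n) ω) (l n) (l' n) (e n ω))
    {A : Set (Param d)} (hA : IsCompact A) (hAΘ : A ⊆ Θ) {θ' : Param d} (hθ' : θ' ∈ Θ)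
    (hlt : ∀ θ ∈ A, a * meanLogLik f (P.map (path Y₁)) θ + b * meanLogLik f (P.map (path Y₂)) θ
      < a * meanLogLik f (P.map (path Y₁)) θ' + b * meanLogLik f (P.map (path Y₂)) θ') :
    Negligible P fun n => {ω | e n ω ∈ A} := by
  have hYZ₁ : ∀ ω t, (1 : ℝ≥0∞) + Y₁ t ω ≤ 1 + Y₁ t ω + Y₂ t ω := fun ω t => le_self_add
  have hYZ₂ : ∀ ω t, (1 : ℝ≥0∞) + Y₂ t ω ≤ 1 + Y₁ t ω + Y₂ t ω := fun ω t => by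
    rw [add_right_comm]; exact le_self_add
  have hν₁ := hZ.map_path hY₁ hYZ₁
  have hν₂ := hZ.map_path hY₂ hYZ₂
  have : IsProbabilityMeasure (P.map (path Y₁)) :=
    Measure.isProbabilityMeasure_map (measurable_path hY₁).aemeasurable
  have : IsProbabilityMeasure (P.map (path Y₂)) :=
    Measure.isProbabilityMeasure_map (measurable_path hY₂).aemeasurable
  set L₁ := meanLogLik f (P.map (path Y₁)) with hL₁
  set L₂ := meanLogLik f (P.map (path Y₂)) with hL₂
  have hc₁ : ContinuousOn L₁ Θ := continuousOn_meanLogLik h hν₁ hM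
  have hc₂ : ContinuousOn L₂ Θ := continuousOn_meanLogLik h hν₂ hM
  have hm₁ := tendsto_atTop_of_div_tendsto ha hla
  have hm₂ : Tendsto (fun n => l' n + 1 - (T n + 1)) atTop atTop := by
    simpa using tendsto_atTop_of_div_tendsto hb hlb
  obtain ⟨C₁, hC₁⟩ := h.compact.exists_bound_of_continuousOn hc₁
  obtain ⟨C₂, hC₂⟩ := h.compact.exists_bound_of_continuousOn hc₂
  refine negligible_argmax_mem hA hAΘ (D := fun θ => a * L₁ θ + b * L₂ θ)
    (((continuousOn_const.mul hc₁).add (continuousOn_const.mul hc₂)).mono hAΘ) hθ' hlt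
    (S := fun n ω θ => logLikHat f (changePath Y₁ Y₂ (T n) ω) (l n) (l' n) θ)
    (s := fun n => n) ?_ (fun η hη => ?_) ?_
  · filter_upwards [eventually_gt_atTop 0] with n hn
    exact_mod_cast hn
  -- The sum is split at the change. Four errors of at most `η / 4 * n` arise: a stochastic one on
  -- each side, and one on each side from replacing the window length by its limiting fraction of
  -- `n`.
  · have h1 := negligible_logLikHat h hY₁ herg₁ hZ hM hYZ₁
      (x := fun n => changePath Y₁ Y₂ (T n)) (b := fun _ => 0) (l := l) (l' := T)
      (by filter_upwards [hl] with n hn using hn) hm₁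
      (Eventually.of_forall fun n ω => tracks_changePath_left le_rfl ω) (η := η / (8 * a))
      (by positivity)
    have h2 := negligible_logLikHat h hY₂ herg₂ hZ hM hYZ₂
      (x := fun n => changePath Y₁ Y₂ (T n)) (b := T) (l := fun n => T n + 1) (l' := l')
      (Eventually.of_forall fun n => Nat.lt_succ_self _) hm₂
      (Eventually.of_forall fun n ω => tracks_changePath_right (Nat.lt_succ_self _) ω)
      (η := η / (8 * b)) (by positivity)
    refine (h1.union h2).mono ?_
    have hε₁ : 0 < η / (4 * (|C₁| + 1)) := by positivity
    have hε₂ : 0 < η / (4 * (|C₂| + 1)) := by positivity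
    filter_upwards [hl1, hl2, eventually_gt_atTop 0,
      Metric.tendsto_nhds.1 hla _ hε₁, Metric.tendsto_nhds.1 hlb _ hε₂,
      hla.eventually (ge_mem_nhds (show a < 2 * a by linarith)),
      hlb.eventually (ge_mem_nhds (show b < 2 * b by linarith))]
      with n hn1 hn2 hn0 hd₁ hd₂ ha2 hb2
    rintro ω ⟨θ, hθ, hω⟩
    by_contra hcon
    simp only [mem_union, mem_ofPred_eq, not_or, not_exists, not_and, not_lt] at hcon
    have h3 := hcon.1 θ hθ
    have h4 := hcon.2 θ hθ
    rw [Nat.add_sub_add_right] at h4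
    have hn0' : (0 : ℝ) < n := by exact_mod_cast hn0
    have hsplit : logLikHat f (changePath Y₁ Y₂ (T n) ω) (l n) (l' n) θ
        = logLikHat f (changePath Y₁ Y₂ (T n) ω) (l n) (T n) θ
          + logLikHat f (changePath Y₁ Y₂ (T n) ω) (T n + 1) (l' n) θ := by
      have hIcc : ∀ p q : ℕ, Finset.Icc p q = Finset.Ico p (q + 1) := fun p q => by ext; simp
      simp only [logLikHat, hIcc]
      exact (Finset.sum_Ico_consecutive _ (by omega) (by omega)).symm
    rw [hsplit] at hω
    set m₁ : ℝ := ((T n + 1 - l n : ℕ) : ℝ) with hm₁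
    set m₂ : ℝ := ((l' n - T n : ℕ) : ℝ) with hm₂
    have hcoef : ∀ {m r C ε L : ℝ}, dist (m / n) r < ε → ε = η / (4 * (|C| + 1)) → |L| ≤ C →
        |m * L - n * (r * L)| ≤ η / 4 * n := by
      intro m r C ε L hd hε hL
      have h5 : m * L - n * (r * L) = n * (m / n - r) * L := by field_simp
      rw [h5, abs_mul, abs_mul, abs_of_pos hn0']
      rw [Real.dist_eq] at hd
      have h6 : |L| ≤ |C| + 1 := hL.trans ((le_abs_self C).trans (by linarith))
      have h7 : 0 < ε := (abs_nonneg _).trans_lt hd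
      calc (n : ℝ) * |m / n - r| * |L| ≤ n * ε * (|C| + 1) := by gcongr
        _ = η / 4 * n := by rw [hε]; field_simp
    have h5 := hcoef hd₁ rfl (hC₁ θ hθ)
    have h6 := hcoef hd₂ rfl (hC₂ θ hθ)
    have h7 : η / (8 * a) * m₁ ≤ η / 4 * n := by
      rw [div_le_iff₀ hn0'] at ha2
      calc η / (8 * a) * m₁ ≤ η / (8 * a) * (2 * a * n) := by gcongr
        _ = η / 4 * n := by field_simp; ring
    have h8 : η / (8 * b) * m₂ ≤ η / 4 * n := by
      rw [div_le_iff₀ hn0'] at hb2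
      calc η / (8 * b) * m₂ ≤ η / (8 * b) * (2 * b * n) := by gcongr
        _ = η / 4 * n := by field_simp; ring
    have h9 := abs_le.1 h3
    have h10 := abs_le.1 h4
    have h11 := abs_le.1 h5
    have h12 := abs_le.1 h6
    rcases lt_abs.1 hω with hω | hω <;> nlinarith
  · filter_upwards [he] with n hn ω using (hn ω).2 θ' hθ'

end Estimation

/-! ### Divergence of the statistic from separation of the estimates. -/

section Statistic

variable {d : ℕ} {Ω : Type*} [MeasurableSpace Ω] {P : Measure Ω} {f : Param d → (ℕ → ℕ) → ℝ}
  {Θ : Set (Param d)}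

/-- The normalization equals `n (k/n)² (1 - k/n)²`, whose factor `n` cancels the `1 / n` in the
bound `B / n` on the quadratic form. -/
theorem le_CHatAt {q : ℝ → ℝ} {x : ℤ → ℕ} {est : ℕ → ℕ → Param d} {u n k : ℕ} (hu : u ≤ n)
    (hn : 0 < n) {Q g ρ B : ℝ} (hQ : 0 < q ((k : ℝ) / n)) (hq : q ((k : ℝ) / n) ≤ Q)
    (hg : g ≤ ((k : ℝ) / n) ^ 2 * (1 - (k : ℝ) / n) ^ 2) (hg0 : 0 ≤ g) (hB : 0 ≤ B) (hρ : 0 ≤ ρ)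
    (hd : ρ ≤ dist (est 1 k) (est (k + 1) n))
    (hS : ∀ v : Param d,
      B / n * ‖v‖ ^ 2 ≤ v.ofLp ⬝ᵥ (sandwich f Θ x 1 u (est 1 u)).mulVec v.ofLp) :
    1 / Q ^ 2 * g * (1 / 2 * (B * ρ ^ 2)) ≤ CHatAt f Θ q x est u n k := by
  set v := est 1 k - est (k + 1) n with hv
  have hn' : (0 : ℝ) < n := by exact_mod_cast hn
  have hquad : v.ofLp ⬝ᵥ (SigmaHat f Θ x est u n).mulVec v.ofLp
      = 1 / 2 * (v.ofLp ⬝ᵥ (sandwich f Θ x 1 u (est 1 u)).mulVec v.ofLp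
        + v.ofLp ⬝ᵥ (sandwich f Θ x (u + 1) n (est (u + 1) n)).mulVec v.ofLp) := by
    rw [SigmaHat, Matrix.smul_mulVec, Matrix.add_mulVec, dotProduct_smul, dotProduct_add,
      smul_eq_mul]
  have h1 := quadraticForm_sandwichHat_nonneg (f := f) (Θ := Θ) (x := x) (η := est (u + 1) n)
    (Nat.add_le_add_right hu 1) v.ofLp
  have h2 := hS v
  have h3 : ρ ^ 2 ≤ ‖v‖ ^ 2 := by
    rw [hv, ← dist_eq_norm]
    gcongr
  have h4 : B / n * ρ ^ 2 ≤ B / n * ‖v‖ ^ 2 := by gcongr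
  have h5 : 1 / 2 * (B / n * ρ ^ 2) ≤ v.ofLp ⬝ᵥ (SigmaHat f Θ x est u n).mulVec v.ofLp := by
    rw [hquad]
    linarith
  have h6 : (k : ℝ) ^ 2 * ((n : ℝ) - k) ^ 2 / (n : ℝ) ^ 3
      = n * (((k : ℝ) / n) ^ 2 * (1 - (k : ℝ) / n) ^ 2) := by
    field_simp
  have h7 : 1 / Q ^ 2 * g * (1 / 2 * (B * ρ ^ 2))
      = 1 / Q ^ 2 * (n * g) * (1 / 2 * (B / n * ρ ^ 2)) := by
    field_simp
  rw [h7]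
  unfold CHatAt
  rw [h6]
  gcongr

theorem CHatAt_le_CHat {q : ℝ → ℝ} {x : ℤ → ℕ} {est : ℕ → ℕ → Param d} {u v n k : ℕ}
    (hv : v ≤ k) (hk : k + v ≤ n) : CHatAt f Θ q x est u n k ≤ CHat f Θ q x est u v n := by
  refine le_csSup (Set.Finite.bddAbove (Set.Finite.image _ ?_)) ⟨k, ⟨hv, hk⟩, rfl⟩
  exact (Set.finite_Iic n).subset fun j hj => by
    have := hj.2
    exact mem_Iic.2 (by omega)

/-- The statistic diverges as soon as, at some candidate `⌊n s⌋` where the weight stays bounded,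
the two estimates stay apart. -/
theorem divergesInProbability_CHat {q : ℝ → ℝ} (hq : ∀ τ ∈ Ioo (0 : ℝ) 1, 0 < q τ)
    {u v : ℕ → ℕ} (hun : Tendsto (fun n : ℕ => (u n : ℝ) / n) atTop (𝓝 0))
    (hvn : Tendsto (fun n : ℕ => (v n : ℝ) / n) atTop (𝓝 0))
    {x : ℕ → Ω → ℤ → ℕ} {est : ℕ → Ω → ℕ → ℕ → Param d}
    (hS : ∀ B : ℝ, Negligible P fun n => {ω | ∃ w : Param d,
      w.ofLp ⬝ᵥ (sandwich f Θ (x n ω) 1 (u n) (est n ω 1 (u n))).mulVec w.ofLp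
        < B / n * ‖w‖ ^ 2})
    {k : ℕ → ℕ} {s : ℝ} (hs : s ∈ Ioo (0 : ℝ) 1)
    (hk : Tendsto (fun n : ℕ => (k n : ℝ) / n) atTop (𝓝 s)) {Q : ℝ}
    (hQ : ∀ᶠ n : ℕ in atTop, q ((k n : ℝ) / n) ≤ Q) {ρ : ℝ} (hρ : 0 < ρ)
    (hd : Negligible P fun n => {ω | dist (est n ω 1 (k n)) (est n ω (k n + 1) n) < ρ}) :
    DivergesInProbability P fun n ω => CHat f Θ q (x n ω) (est n ω) (u n) (v n) n := by
  intro m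
  have hkpos : ∀ᶠ n : ℕ in atTop, ((k n : ℝ) / n) ∈ Ioo (0 : ℝ) 1 :=
    hk.eventually (isOpen_Ioo.mem_nhds hs)
  have hQpos : 0 < Q := by
    obtain ⟨n, hn1, hn2⟩ := (hkpos.and hQ).exists
    exact (hq _ hn1).trans_le hn2
  set g : ℝ := s ^ 2 * (1 - s) ^ 2 / 2 with hg
  have hs0 := hs.1
  have hs1 : 0 < 1 - s := sub_pos.2 hs.2
  have hg0 : 0 < g := by positivity
  -- Chosen so that the lower bound for the statistic becomes `|m| + 1`, beyond the level `m`.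
  set B : ℝ := 2 * (|m| + 1) * Q ^ 2 / (g * ρ ^ 2) with hB
  have hB0 : 0 ≤ B := by positivity
  refine Negligible.mono (t := fun n => _ ∪ _) ((hS B).union hd) ?_
  have hgk : ∀ᶠ n : ℕ in atTop, g ≤ ((k n : ℝ) / n) ^ 2 * (1 - (k n : ℝ) / n) ^ 2 := by
    have h1 : Tendsto (fun n : ℕ => ((k n : ℝ) / n) ^ 2 * (1 - (k n : ℝ) / n) ^ 2) atTop
        (𝓝 (s ^ 2 * (1 - s) ^ 2)) := (hk.pow 2).mul ((tendsto_const_nhds.sub hk).pow 2)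
    refine h1.eventually (le_mem_nhds ?_)
    have : 0 < s ^ 2 * (1 - s) ^ 2 := by positivity
    rw [hg]; linarith
  have hu1 : ∀ᶠ n : ℕ in atTop, (u n : ℝ) / n < 1 := hun.eventually (gt_mem_nhds one_pos)
  have hv1 : ∀ᶠ n : ℕ in atTop, (v n : ℝ) / n < (k n : ℝ) / n :=
    hvn.eventually_lt hk hs0
  have hv2 : ∀ᶠ n : ℕ in atTop, (v n : ℝ) / n < 1 - (k n : ℝ) / n :=
    hvn.eventually_lt (tendsto_const_nhds.sub hk) hs1
  filter_upwards [hkpos, hQ, hgk, hu1, hv1, hv2, eventually_gt_atTop 0]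
    with n hn1 hn2 hn3 hn4 hn5 hn6 hn0 ω hω
  have hn0' : (0 : ℝ) < n := by exact_mod_cast hn0
  by_contra hcon
  simp only [mem_union, mem_ofPred_eq, not_or, not_exists, not_lt] at hcon hω
  have hun' : u n ≤ n := by
    rw [div_lt_one hn0'] at hn4
    exact_mod_cast hn4.le
  have hvk : v n ≤ k n := by
    have := (div_lt_div_iff_of_pos_right hn0').1 hn5
    exact_mod_cast this.le
  have hkv : k n + v n ≤ n := by
    rw [lt_sub_iff_add_lt, ← add_div, div_lt_one hn0'] at hn6
    have : v n + k n ≤ n := by exact_mod_cast hn6.le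
    omega
  have h1 := le_CHatAt (f := f) (Θ := Θ) (x := x n ω) (est := est n ω) hun' hn0 (hq _ hn1) hn2 hn3
    hg0.le hB0 hρ.le hcon.2 hcon.1
  have h2 : 1 / Q ^ 2 * g * (1 / 2 * (B * ρ ^ 2)) = |m| + 1 := by
    rw [hB]; field_simp
  have h3 := CHatAt_le_CHat (f := f) (Θ := Θ) (q := q) (x := x n ω) (est := est n ω) (u := u n)
    hvk hkv
  have := le_abs_self m
  linarith

/-- Subadditivity gives `1 ≤ P (c < X) + P (X ≤ c)` even when `X` is not measurable. -/
theorem DivergesInProbability.tendsto_measure_lt [IsProbabilityMeasure P] {X : ℕ → Ω → ℝ}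
    (h : DivergesInProbability P X) (c : ℝ) :
    Tendsto (fun n => P {ω | c < X n ω}) atTop (𝓝 1) := by
  have h1 : Tendsto (fun n => 1 - P {ω | X n ω ≤ c}) atTop (𝓝 1) := by
    simpa using ENNReal.Tendsto.sub (tendsto_const_nhds (x := (1 : ℝ≥0∞))) (h c) (Or.inl (by simp))
  refine tendsto_of_tendsto_of_tendsto_of_le_of_le h1 tendsto_const_nhds (fun n => ?_)
    (fun n => prob_le_one)
  rw [tsub_le_iff_right, ← measure_univ (μ := P)]
  refine (measure_mono fun ω _ => ?_).trans (measure_union_le _ _)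
  exact lt_or_ge c (X n ω)

end Statistic

/-! ### Separation of the estimates at a suitable candidate. -/

section Consistency

theorem tendsto_natFloor_mul_div {a : ℝ} (ha : 0 ≤ a) :
    Tendsto (fun n : ℕ => ((⌊(n : ℝ) * a⌋₊ : ℕ) : ℝ) / n) atTop (𝓝 a) := by
  simpa only [mul_comm, Function.comp_def] using
    (tendsto_nat_floor_mul_div_atTop ha).comp tendsto_natCast_atTop_atTop

theorem tendsto_natSub_div {m k : ℕ → ℕ} {a b : ℝ}
    (hm : Tendsto (fun n : ℕ => (m n : ℝ) / n) atTop (𝓝 a))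
    (hk : Tendsto (fun n : ℕ => (k n : ℝ) / n) atTop (𝓝 b)) (hle : ∀ n, k n ≤ m n) :
    Tendsto (fun n : ℕ => ((m n - k n : ℕ) : ℝ) / n) atTop (𝓝 (a - b)) := by
  refine (hm.sub hk).congr fun n => ?_
  rw [Nat.cast_sub (hle n), sub_div]

theorem eventually_lt_of_div_tendsto {m k : ℕ → ℕ} {a b : ℝ}
    (hm : Tendsto (fun n : ℕ => (m n : ℝ) / n) atTop (𝓝 a))
    (hk : Tendsto (fun n : ℕ => (k n : ℝ) / n) atTop (𝓝 b)) (hab : b < a) :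
    ∀ᶠ n in atTop, k n < m n := by
  filter_upwards [hk.eventually_lt hm hab, eventually_gt_atTop 0] with n hn hn0
  have hn0' : (0 : ℝ) < n := by exact_mod_cast hn0
  exact_mod_cast (div_lt_div_iff_of_pos_right hn0').1 hn

theorem _root_.ContinuousOn.exists_forall_closedBall_lt {X : Type*} [PseudoMetricSpace X]
    {D : X → ℝ} {s : Set X} (hD : ContinuousOn D s) {x : X} (hx : x ∈ s) {r : ℝ} (h : D x < r) :
    ∃ ρ > 0, ∀ y ∈ s ∩ Metric.closedBall x ρ, D y < r := by
  have h1 : {y | D y < r} ∈ 𝓝[s] x := (hD x hx).eventually (gt_mem_nhds h)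
  obtain ⟨ε, hε, hsub⟩ := Metric.mem_nhdsWithin_iff.1 h1
  refine ⟨ε / 2, half_pos hε, fun y hy => hsub ⟨?_, hy.1⟩⟩
  exact Metric.closedBall_subset_ball (half_lt_self hε) hy.2

/-- One estimate comes within `ρ / 2` of `x₀` while the other stays farther than `ρ` from it; no
limit is required for the second. -/
theorem Negligible.dist_lt {Ω : Type*} [MeasurableSpace Ω] {P : Measure Ω} {X : Type*}
    [PseudoMetricSpace X] {s : Set X} {x₀ : X} {ρ : ℝ} {a b : ℕ → Ω → X}
    (ha : Negligible P fun n => {ω | ρ / 2 ≤ dist (a n ω) x₀})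
    (hb : Negligible P fun n => {ω | b n ω ∈ s ∩ Metric.closedBall x₀ ρ})
    (hs : ∀ᶠ n in atTop, ∀ ω, b n ω ∈ s) :
    Negligible P fun n => {ω | dist (a n ω) (b n ω) < ρ / 2} := by
  refine (ha.union hb).mono ?_
  filter_upwards [hs] with n hn ω hω
  rw [mem_ofPred_eq] at hω
  by_contra hcon
  simp only [mem_union, mem_ofPred_eq, mem_inter_iff, hn ω, true_and, not_or, not_le,
    Metric.mem_closedBall] at hcon
  have := dist_triangle_left (b n ω) x₀ (a n ω)
  linarith [hcon.1, hcon.2]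

variable {d : ℕ} {Ω : Type*} [MeasurableSpace Ω] {P : Measure Ω} [IsProbabilityMeasure P]
  {f : Param d → (ℕ → ℕ) → ℝ} {Θ : Set (Param d)} {β : ℕ → ℝ} {c : ℝ} {M : ℝ≥0∞}
  {Y₁ Y₂ : ℤ → Ω → ℕ} {θ₁ θ₂ : Param d} {T : ℕ → ℕ} {τ s : ℝ}
  {est : ℕ → Ω → ℕ → ℕ → Param d}

theorem negligible_le_dist_of_isPQMLE_left (h : RegularMean f Θ β c) (hθ₁ : θ₁ ∈ Θ)
    (hOD : ClassOD P univ f θ₁ Y₁) (herg : StationaryErgodic P Y₁)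
    (hid : ∀ θ ∈ Θ, ∀ θ' ∈ Θ,
      (∀ᵐ ω ∂P, lam f (path Y₁ ω) 0 θ = lam f (path Y₁ ω) 0 θ') → θ = θ')
    (hZ : CubicBound P (fun ω t => (1 : ℝ≥0∞) + Y₁ t ω + Y₂ t ω) M) (hM : M ≠ ∞)
    (hTn : ∀ n, T n ≤ n)
    (hest : ∀ (n : ℕ) (ω : Ω) (l l' : ℕ), 1 ≤ l → l ≤ l' → l' ≤ n →
      IsPQMLE f Θ (changePath Y₁ Y₂ (T n) ω) l l' (est n ω l l'))
    {k : ℕ → ℕ} (hk : Tendsto k atTop atTop) (hkT : ∀ᶠ n in atTop, k n ≤ T n) {ρ : ℝ}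
    (hρ : 0 < ρ) : Negligible P fun n => {ω | ρ ≤ dist (est n ω 1 (k n)) θ₁} := by
  refine negligible_le_dist_of_isPQMLE h hθ₁ hOD herg hZ hM (fun ω t => le_self_add) hid
    (x := fun n ω => changePath Y₁ Y₂ (T n) ω) (b := fun _ => 0) (l := fun _ => 1) (l' := k)
    (e := fun n ω => est n ω 1 (k n)) (Eventually.of_forall fun _ => one_pos) ?_ ?_ ?_ hρ
  · simpa using hk
  · filter_upwards [hkT] with n hn ω using tracks_changePath_left hn ω
  · filter_upwards [hkT, hk.eventually_ge_atTop 1] with n hn hn1 ω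
    exact hest n ω 1 _ le_rfl hn1 (hn.trans (hTn n))

theorem negligible_le_dist_of_isPQMLE_right (h : RegularMean f Θ β c) (hθ₂ : θ₂ ∈ Θ)
    (hOD : ClassOD P univ f θ₂ Y₂) (herg : StationaryErgodic P Y₂)
    (hid : ∀ θ ∈ Θ, ∀ θ' ∈ Θ,
      (∀ᵐ ω ∂P, lam f (path Y₂ ω) 0 θ = lam f (path Y₂ ω) 0 θ') → θ = θ')
    (hZ : CubicBound P (fun ω t => (1 : ℝ≥0∞) + Y₁ t ω + Y₂ t ω) M) (hM : M ≠ ∞)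
    (hest : ∀ (n : ℕ) (ω : Ω) (l l' : ℕ), 1 ≤ l → l ≤ l' → l' ≤ n →
      IsPQMLE f Θ (changePath Y₁ Y₂ (T n) ω) l l' (est n ω l l'))
    {k : ℕ → ℕ} (hk : Tendsto (fun n => n - k n) atTop atTop)
    (hkT : ∀ᶠ n in atTop, T n ≤ k n) {ρ : ℝ} (hρ : 0 < ρ) :
    Negligible P fun n => {ω | ρ ≤ dist (est n ω (k n + 1) n) θ₂} := by
  refine negligible_le_dist_of_isPQMLE h hθ₂ hOD herg hZ hM
    (fun ω t => by rw [add_right_comm]; exact le_self_add) hid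
    (x := fun n ω => changePath Y₁ Y₂ (T n) ω) (b := T) (l := fun n => k n + 1) (l' := fun n => n)
    (e := fun n ω => est n ω (k n + 1) n) ?_ ?_ ?_ ?_ hρ
  · filter_upwards [hkT] with n hn using Nat.lt_succ_of_le hn
  · simpa using hk
  · filter_upwards [hkT] with n hn ω using tracks_changePath_right (Nat.lt_succ_of_le hn) ω
  · filter_upwards [hk.eventually_ge_atTop 1] with n hn ω
    exact hest n ω _ _ (by omega) (by omega) le_rfl

/-- If the overall mean quasi-log-likelihood does not favour `θ₁`, then the estimates separate at
any candidate before the change. -/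
theorem exists_negligible_dist_lt_of_lt (h : RegularMean f Θ β c) (hθ₁ : θ₁ ∈ Θ) (hθ₂ : θ₂ ∈ Θ)
    (hne : θ₁ ≠ θ₂) (hOD : ClassOD P univ f θ₁ Y₁) (hY₂ : ∀ t, Measurable (Y₂ t))
    (herg₁ : StationaryErgodic P Y₁) (herg₂ : StationaryErgodic P Y₂)
    (hid : ∀ θ ∈ Θ, ∀ θ' ∈ Θ,
      (∀ᵐ ω ∂P, lam f (path Y₁ ω) 0 θ = lam f (path Y₁ ω) 0 θ') → θ = θ')
    (hZ : CubicBound P (fun ω t => (1 : ℝ≥0∞) + Y₁ t ω + Y₂ t ω) M) (hM : M ≠ ∞)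
    (hTn : ∀ n, T n ≤ n) (hT : Tendsto (fun n : ℕ => (T n : ℝ) / n) atTop (𝓝 τ)) (hτ : τ < 1)
    (hest : ∀ (n : ℕ) (ω : Ω) (l l' : ℕ), 1 ≤ l → l ≤ l' → l' ≤ n →
      IsPQMLE f Θ (changePath Y₁ Y₂ (T n) ω) l l' (est n ω l l'))
    (hmix : τ * meanLogLik f (P.map (path Y₁)) θ₁ + (1 - τ) * meanLogLik f (P.map (path Y₂)) θ₁
      ≤ τ * meanLogLik f (P.map (path Y₁)) θ₂ + (1 - τ) * meanLogLik f (P.map (path Y₂)) θ₂)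
    (hs : 0 < s) (hsτ : s < τ) {k : ℕ → ℕ} (hkT : ∀ n, k n ≤ T n)
    (hk : Tendsto (fun n : ℕ => (k n : ℝ) / n) atTop (𝓝 s)) :
    ∃ ρ > 0, Negligible P fun n => {ω | dist (est n ω 1 (k n)) (est n ω (k n + 1) n) < ρ} := by
  have hYZ₁ : ∀ ω t, (1 : ℝ≥0∞) + Y₁ t ω ≤ 1 + Y₁ t ω + Y₂ t ω := fun ω t => le_self_add
  have hYZ₂ : ∀ ω t, (1 : ℝ≥0∞) + Y₂ t ω ≤ 1 + Y₁ t ω + Y₂ t ω := fun ω t => by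
    rw [add_right_comm]; exact le_self_add
  have := Measure.isProbabilityMeasure_map (μ := P) (measurable_path hOD.measurable).aemeasurable
  have := Measure.isProbabilityMeasure_map (μ := P) (measurable_path hY₂).aemeasurable
  have hlt := meanLogLik_lt h hOD hZ hM hYZ₁ hid hθ₁ hθ₂ hne.symm
  have hcont : ContinuousOn (fun θ => (τ - s) * meanLogLik f (P.map (path Y₁)) θ
      + (1 - τ) * meanLogLik f (P.map (path Y₂)) θ) Θ :=
    ((continuousOn_meanLogLik h (hZ.map_path hOD.measurable hYZ₁) hM).const_mul _).add
      ((continuousOn_meanLogLik h (hZ.map_path hY₂ hYZ₂) hM).const_mul _)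
  -- The strict inequality at `θ₁` is `hmix` minus `s` times `hlt`; continuity extends it to a
  -- neighbourhood of `θ₁`.
  obtain ⟨ρ, hρ, hA⟩ := hcont.exists_forall_closedBall_lt hθ₁
    (r := (τ - s) * meanLogLik f (P.map (path Y₁)) θ₂
      + (1 - τ) * meanLogLik f (P.map (path Y₂)) θ₂) (by nlinarith)
  have hn : Tendsto (fun n : ℕ => (n : ℝ) / n) atTop (𝓝 1) := by
    refine tendsto_const_nhds.congr' ?_
    filter_upwards [eventually_ne_atTop 0] with n hn
    rw [div_self (by exact_mod_cast hn)]
  have hkT' := eventually_lt_of_div_tendsto hT hk hsτ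
  have hTn' := eventually_lt_of_div_tendsto hn hT hτ
  refine ⟨ρ / 2, half_pos hρ, Negligible.dist_lt (s := Θ) (x₀ := θ₁) ?_ ?_ ?_⟩
  · exact negligible_le_dist_of_isPQMLE_left h hθ₁ hOD herg₁ hid hZ hM hTn hest
      (tendsto_atTop_of_div_tendsto hs hk) (Eventually.of_forall hkT) (half_pos hρ)
  · refine negligible_mem_of_isPQMLE_mixture h hOD.measurable hY₂ herg₁ herg₂ hZ hM
      (T := T) (l := fun n => k n + 1) (l' := fun n => n) (sub_pos.2 hsτ) (sub_pos.2 hτ)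
      (Eventually.of_forall fun n => by omega) hkT' hTn' ?_ (tendsto_natSub_div hn hT hTn) ?_
      (h.compact.inter_right Metric.isClosed_closedBall) inter_subset_left hθ₂ hA
    · simpa using tendsto_natSub_div hT hk hkT
    · filter_upwards [hkT', hTn'] with n h1 h2 ω
      exact hest n ω _ _ (by omega) (by omega) le_rfl
  · filter_upwards [hkT', hTn'] with n h1 h2 ω
    exact (hest n ω _ _ (by omega) (by omega) le_rfl).1

/-- If the overall mean quasi-log-likelihood does not favour `θ₂`, then the estimates separate at
any candidate after the change. -/
theorem exists_negligible_dist_lt_of_gt (h : RegularMean f Θ β c) (hθ₁ : θ₁ ∈ Θ) (hθ₂ : θ₂ ∈ Θ)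
    (hne : θ₁ ≠ θ₂) (hOD : ClassOD P univ f θ₂ Y₂) (hY₁ : ∀ t, Measurable (Y₁ t))
    (herg₁ : StationaryErgodic P Y₁) (herg₂ : StationaryErgodic P Y₂)
    (hid : ∀ θ ∈ Θ, ∀ θ' ∈ Θ,
      (∀ᵐ ω ∂P, lam f (path Y₂ ω) 0 θ = lam f (path Y₂ ω) 0 θ') → θ = θ')
    (hZ : CubicBound P (fun ω t => (1 : ℝ≥0∞) + Y₁ t ω + Y₂ t ω) M) (hM : M ≠ ∞)
    (hT : Tendsto (fun n : ℕ => (T n : ℝ) / n) atTop (𝓝 τ)) (hτ : 0 < τ)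
    (hest : ∀ (n : ℕ) (ω : Ω) (l l' : ℕ), 1 ≤ l → l ≤ l' → l' ≤ n →
      IsPQMLE f Θ (changePath Y₁ Y₂ (T n) ω) l l' (est n ω l l'))
    (hmix : τ * meanLogLik f (P.map (path Y₁)) θ₂ + (1 - τ) * meanLogLik f (P.map (path Y₂)) θ₂
      ≤ τ * meanLogLik f (P.map (path Y₁)) θ₁ + (1 - τ) * meanLogLik f (P.map (path Y₂)) θ₁)
    (hs : s < 1) (hsτ : τ < s) {k : ℕ → ℕ} (hkT : ∀ n, T n ≤ k n) (hkn : ∀ n, k n ≤ n)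
    (hk : Tendsto (fun n : ℕ => (k n : ℝ) / n) atTop (𝓝 s)) :
    ∃ ρ > 0, Negligible P fun n => {ω | dist (est n ω 1 (k n)) (est n ω (k n + 1) n) < ρ} := by
  have hYZ₁ : ∀ ω t, (1 : ℝ≥0∞) + Y₁ t ω ≤ 1 + Y₁ t ω + Y₂ t ω := fun ω t => le_self_add
  have hYZ₂ : ∀ ω t, (1 : ℝ≥0∞) + Y₂ t ω ≤ 1 + Y₁ t ω + Y₂ t ω := fun ω t => by
    rw [add_right_comm]; exact le_self_add
  have := Measure.isProbabilityMeasure_map (μ := P) (measurable_path hOD.measurable).aemeasurable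
  have := Measure.isProbabilityMeasure_map (μ := P) (measurable_path hY₁).aemeasurable
  have hlt := meanLogLik_lt h hOD hZ hM hYZ₂ hid hθ₂ hθ₁ hne
  have hcont : ContinuousOn (fun θ => τ * meanLogLik f (P.map (path Y₁)) θ
      + (s - τ) * meanLogLik f (P.map (path Y₂)) θ) Θ :=
    ((continuousOn_meanLogLik h (hZ.map_path hY₁ hYZ₁) hM).const_mul _).add
      ((continuousOn_meanLogLik h (hZ.map_path hOD.measurable hYZ₂) hM).const_mul _)
  -- Here the mixture on the window equals the full one minus `1 - s` times the second mean
  -- log-likelihood, which is strictly larger at `θ₂`.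
  obtain ⟨ρ, hρ, hA⟩ := hcont.exists_forall_closedBall_lt hθ₂
    (r := τ * meanLogLik f (P.map (path Y₁)) θ₁
      + (s - τ) * meanLogLik f (P.map (path Y₂)) θ₁) (by nlinarith)
  have hn : Tendsto (fun n : ℕ => (n : ℝ) / n) atTop (𝓝 1) := by
    refine tendsto_const_nhds.congr' ?_
    filter_upwards [eventually_ne_atTop 0] with n hn
    rw [div_self (by exact_mod_cast hn)]
  have hkT' := eventually_lt_of_div_tendsto hk hT hsτ
  have hT1 := (tendsto_atTop_of_div_tendsto hτ hT).eventually_ge_atTop 1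
  have hmain : Negligible P fun n => {ω | dist (est n ω (k n + 1) n) (est n ω 1 (k n)) < ρ / 2} := by
    refine Negligible.dist_lt (s := Θ) (x₀ := θ₂) ?_ ?_ ?_
    · exact negligible_le_dist_of_isPQMLE_right h hθ₂ hOD herg₂ hid hZ hM hest
        (tendsto_atTop_of_div_tendsto (sub_pos.2 hs) (tendsto_natSub_div hn hk hkn))
        (Eventually.of_forall hkT) (half_pos hρ)
    · refine negligible_mem_of_isPQMLE_mixture h hY₁ hOD.measurable herg₁ herg₂ hZ hM
        (T := T) (l := fun _ => 1) (l' := k) hτ (sub_pos.2 hsτ)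
        (Eventually.of_forall fun n => le_rfl) hT1 hkT' ?_ (tendsto_natSub_div hk hT hkT) ?_
        (h.compact.inter_right Metric.isClosed_closedBall) inter_subset_left hθ₁ hA
      · simpa using hT
      · filter_upwards [hkT', hT1] with n h1 h2 ω
        exact hest n ω _ _ le_rfl (by omega) (hkn n)
    · filter_upwards [hkT', hT1] with n h1 h2 ω
      exact (hest n ω _ _ le_rfl (by omega) (hkn n)).1
  exact ⟨ρ / 2, half_pos hρ, by simpa only [dist_comm] using hmain⟩

end Consistency

end ChangePoint

theorem theorem3p2 {d : ℕ} {Ω : Type*} [MeasurableSpace Ω] (P : Measure Ω)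
    [IsProbabilityMeasure P]
    -- the model
    (Θ : Set (Param d)) (hΘ : IsCompact Θ)
    (f : Param d → (ℕ → ℕ) → ℝ)
    (hf_meas : ∀ θ ∈ Θ, Measurable (f θ)) (hf_nonneg : ∀ θ ∈ Θ, ∀ y, 0 ≤ f θ y)
    -- the Lipschitz-type conditions for orders 0, 1, 2, and the decay of the coefficients
    (α : ℕ → ℕ → ℝ) (hA : ∀ i ≤ 2, LipschitzCondition f Θ i (α i))
    (γ : ℝ) (hγ : 3 / 2 < γ)
    (hα : (fun k : ℕ => α 0 k + α 1 k) =O[atTop] fun k : ℕ => ((k : ℝ) + 1) ^ (-γ))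
    -- the weight function and the two trimming sequences
    (q : ℝ → ℝ) (hq : IsWeight q) (u v : ℕ → ℕ)
    (hu : Tendsto u atTop atTop) (hv : Tendsto v atTop atTop)
    (hun : Tendsto (fun n : ℕ => (u n : ℝ) / n) atTop (𝓝 0))
    (hvn : Tendsto (fun n : ℕ => (v n : ℝ) / n) atTop (𝓝 0))
    -- the two regimes
    (θ₁ θ₂ : Param d) (hθ : θ₁ ≠ θ₂) (Y₁ Y₂ : ℤ → Ω → ℕ)
    (hOD₁ : ClassOD P univ f θ₁ Y₁) (hOD₂ : ClassOD P univ f θ₂ Y₂)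
    (hse₁ : StationaryErgodic P Y₁) (hse₂ : StationaryErgodic P Y₂)
    (ε : ℝ) (hε : 2 < ε) (hmom₁ : MomentBound P Y₁ ε) (hmom₂ : MomentBound P Y₂ ε)
    (hreg₁ : Regularity P f Θ θ₁ Y₁) (hreg₂ : Regularity P f Θ θ₂ Y₂)
    -- the matrix `I` of the first regime is nonsingular
    (hI₁ : (infoI P f Θ θ₁ Y₁).det ≠ 0)
    -- the break fraction: the change occurs after time `⌊n τ⌋`
    (τ : ℝ) (hτ : τ ∈ Ioo (0 : ℝ) 1)
    -- the quasi-maximum likelihood estimates from the observations `1, …, n`, any choice of argmax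
    (est : ℕ → Ω → ℕ → ℕ → Param d)
    (hest : ∀ (n : ℕ) (ω : Ω) (l l' : ℕ), 1 ≤ l → l ≤ l' → l' ≤ n →
      IsPQMLE f Θ (changePath Y₁ Y₂ ⌊(n : ℝ) * τ⌋ ω) l l' (est n ω l l')) :
    DivergesInProbability P
        (fun n ω => CHat f Θ q (changePath Y₁ Y₂ ⌊(n : ℝ) * τ⌋ ω) (est n ω) (u n) (v n) n) ∧
      ∀ c : ℝ, Tendsto
        (fun n : ℕ => P {ω | c <
          CHat f Θ q (changePath Y₁ Y₂ ⌊(n : ℝ) * τ⌋ ω) (est n ω) (u n) (v n) n})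
        atTop (𝓝 1) := by
  -- The sum of the coefficients of orders `0` and `1` serves as a single weight sequence for both
  -- the function and its gradient.
  have hsum := (hA 0 (by norm_num)).summable.add (hA 1 (by norm_num)).summable
  have hle₀ : ∀ k, α 0 k ≤ α 0 k + α 1 k := fun k =>
    le_add_of_nonneg_right ((hA 1 (by norm_num)).nonneg k)
  have hle₁ : ∀ k, α 1 k ≤ α 0 k + α 1 k := fun k =>
    le_add_of_nonneg_left ((hA 0 (by norm_num)).nonneg k)
  obtain ⟨c, hc, hlow⟩ := hreg₁.lowerBound
  have h := regularMean_of_lipschitzCondition hΘ hf_meas (hA 0 (by norm_num)) hle₀ hsum hc hlow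
  obtain ⟨r₀, hg⟩ := (hA 1 (by norm_num)).exists_regularGradient hle₁ hf_meas hreg₁.interior
  have hθ₁ := interior_subset hreg₁.interior
  have hθ₂ := interior_subset hreg₂.interior
  obtain ⟨M, hM, hZ⟩ := cubicBound_one_add_add hOD₁.measurable hOD₂.measurable hε hmom₁ hmom₂
  have hid₁ := fun θ hθ θ' hθ' => hreg₁.identifiable θ hθ θ' hθ' 0
  have hid₂ := fun θ hθ θ' hθ' => hreg₂.identifiable θ hθ θ' hθ' 0
  simp only [Nat.cast_zero] at hid₁ hid₂
  have hτ0 := hτ.1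
  have hτ1 := hτ.2
  set T : ℕ → ℕ := fun n => ⌊(n : ℝ) * τ⌋₊ with hTdef
  have hTfloor : ∀ n : ℕ, ⌊(n : ℝ) * τ⌋ = (T n : ℤ) := fun n =>
    (Int.natCast_floor_eq_floor (by positivity)).symm
  simp only [hTfloor] at hest ⊢
  have hT : Tendsto (fun n : ℕ => (T n : ℝ) / n) atTop (𝓝 τ) := tendsto_natFloor_mul_div hτ0.le
  have hfloor : ∀ {s : ℝ}, s ≤ 1 → ∀ n : ℕ, ⌊(n : ℝ) * s⌋₊ ≤ n := fun hs n =>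
    Nat.floor_le_of_le (mul_le_of_le_one_right n.cast_nonneg hs)
  have huT : ∀ᶠ n in atTop, u n ≤ T n :=
    (eventually_lt_of_div_tendsto hT hun hτ0).mono fun n hn => hn.le
  have hS := negligible_quadraticForm_sandwich_lt h hg hOD₁ hse₁ hZ hM
    (fun ω t => le_self_add) hreg₁.nondegenerate hreg₁.existsI hI₁
    (x := fun n ω => changePath Y₁ Y₂ (T n) ω) hu hun
    (huT.mono fun n hn ω => tracks_changePath_left hn ω)
    (e := fun n ω => est n ω 1 (u n)) fun ρ hρ =>
      negligible_le_dist_of_isPQMLE_left h hθ₁ hOD₁ hse₁ hid₁ hZ hM (hfloor hτ1.le) hest hu huT hρ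
  suffices hdiv : DivergesInProbability P fun n ω =>
      CHat f Θ q (changePath Y₁ Y₂ (T n) ω) (est n ω) (u n) (v n) n from
    ⟨hdiv, hdiv.tendsto_measure_lt⟩
  -- The full-sample mixture decides on which side of the change the candidate is taken.
  rcases le_total
    (τ * meanLogLik f (P.map (path Y₁)) θ₁ + (1 - τ) * meanLogLik f (P.map (path Y₂)) θ₁)
    (τ * meanLogLik f (P.map (path Y₁)) θ₂ + (1 - τ) * meanLogLik f (P.map (path Y₂)) θ₂)
    with hmix | hmix
  · obtain ⟨δ, hδ, hmono⟩ := hq.monotone_zero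
    -- The candidate lies before the change and where `q` is non-decreasing; as `⌊n s⌋ / n ≤ s`, the
    -- weight there is at most `q s`.
    obtain ⟨s, hs0, hs⟩ := exists_between (lt_min hδ.1 hτ0)
    obtain ⟨hsδ, hsτ⟩ := lt_min_iff.1 hs
    have hk := tendsto_natFloor_mul_div hs0.le
    obtain ⟨ρ, hρ, hd⟩ := exists_negligible_dist_lt_of_lt h hθ₁ hθ₂ hθ hOD₁ hOD₂.measurable hse₁
      hse₂ hid₁ hZ hM (hfloor hτ1.le) hT hτ1 hest hmix hs0 hsτ
      (fun n => Nat.floor_le_floor (by gcongr)) hk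
    refine divergesInProbability_CHat hq.pos hun hvn hS ⟨hs0, hsτ.trans hτ1⟩ hk (Q := q s) ?_ hρ hd
    filter_upwards [hk.eventually (lt_mem_nhds hs0), eventually_gt_atTop 0] with n hn hn0
    have hn0' : (0 : ℝ) < n := by exact_mod_cast hn0
    have hks : (⌊(n : ℝ) * s⌋₊ : ℝ) / n ≤ s := by
      rw [div_le_iff₀ hn0', mul_comm s]
      exact Nat.floor_le (by positivity)
    exact hmono ⟨hn, hks.trans_lt hsδ⟩ ⟨hs0, hsδ⟩ hks
  · obtain ⟨δ, hδ, hanti⟩ := hq.antitone_one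
    -- Rounding down may fall below `s`, where a non-increasing `q` can exceed `q s`; an auxiliary
    -- `r < s` leaves room, and `q r` bounds the weight.
    obtain ⟨r, hr, hr1⟩ := exists_between (max_lt (sub_lt_self 1 hδ.1) hτ1)
    obtain ⟨hrδ, hrτ⟩ := max_lt_iff.1 hr
    obtain ⟨s, hrs, hs1⟩ := exists_between hr1
    have hs0 : 0 < s := hτ0.trans (hrτ.trans hrs)
    have hk := tendsto_natFloor_mul_div hs0.le
    obtain ⟨ρ, hρ, hd⟩ := exists_negligible_dist_lt_of_gt h hθ₁ hθ₂ hθ hOD₂ hOD₁.measurable hse₁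
      hse₂ hid₂ hZ hM hT hτ0 hest hmix hs1 (hrτ.trans hrs)
      (fun n => Nat.floor_le_floor (by gcongr; exact (hrτ.trans hrs).le)) (hfloor hs1.le) hk
    refine divergesInProbability_CHat hq.pos hun hvn hS ⟨hs0, hs1⟩ hk (Q := q r) ?_ hρ hd
    filter_upwards [hk.eventually (isOpen_Ioo.mem_nhds ⟨hrs, hs1⟩)] with n hn
    exact hanti ⟨hrδ, hr1⟩ ⟨hrδ.trans hn.1, hn.2⟩ hn.1.le
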